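/- **Setting.** Let $U\subseteq\mathbb R^d$ be open and let $f:U\to\mathbb R$ be differentiable, bounded below and closed (every sublevel set $\{x\in U: f(x)\le a\}$ is closed in $\mathbb R^d$; this is automatic if $U=\mathbb R^d$). Let $0\le\rho<2$, $L_0,L_\rho\ge 0$, $\sigma\ge0$. A function $h:U\to\mathbb R$ is called *$(L_0,L_\rho)$-smooth* if it is twice differentiable on $U$ and $\|\nabla^2h(x)\|\le L_0+L_\rho\|\nabla h(x)\|^\rho$ for almost every $x\in U$ (spectral and Euclidean norm). Let $\mathsf P$ be a probability distribution on a space $\Xi$ and let $f(\cdot,\xi):U\to\mathbb R$, $\xi\in\Xi$, be component functions. Assume that $f$ and every $f(\cdot,\xi)$ are $(L_0,L_\rho)$-smooth, and that for every $x\in U$ $$\mathbb E_{\xi\sim\mathsf P}[\nabla f(x,\xi)]=\nabla f(x),\qquad \|\nabla f(x,\xi)-\nabla f(x)\|\le\sigma\quad\text{for $\mathsf P$-almost every }\xi .$$ **Algorithm (VRAdam)** with inputs $\beta,\beta_2,\eta,\lambda,T,S_1$ and $x_1\in U$; vector operations are coordinate-wise. Draw a batch $\mathcal S_1$ of $S_1$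 samples, let $m_1$ be the average of $\nabla f(x_1,\xi)$ over $\xi\in\mathcal S_1$, $v_1=\beta_2m_1^2$, and $x_2=x_1-\eta m_1/(|m_1|+\lambda)$. For $t=2,\dots,T$ draw a new sample $\xi_t$ and set $$m_t=(1-\beta)m_{t-1}+\beta\nabla f(x_t,\xi_t)+(1-\beta)\big(\nabla f(x_t,\xi_t)-\nabla f(x_{t-1},\xi_t)\big),$$ $$v_t=(1-\beta_2)v_{t-1}+\beta_2(\nabla f(x_t,\xi_t))^2,\quad \hat v_t=\frac{v_t}{1-(1-\beta_2)^t},\quad x_{t+1}=x_t-\frac{\eta}{\sqrt{\hat v_t}+\lambda}\odot m_t .$$ All samples (the batch and $\xi_2,\dots,\xi_T$) are i.i.d. with law $\mathsf P$. The algorithm evaluates $S_1+2(T-1)$ stochastic gradients. **Parameters.** Let $\Delta_1=f(x_1)-\inf_Uf$. For $G>0$ let $L=3L_0+4L_\rho G^\rho$ and $r=\min\big\{\frac1{5L_\rho G^{\rho-1}},\frac1{5(L_0^{\rho-1}L_\rho)^{1/\rho}}\big\}$, where the second term is omitted if $\rho=0$ or $L_0=0$. Quotients with denominator $0$ in the conditions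 on $\beta_2$, $\eta$ and in $r$ are read as $+\infty$. Given numbers $c,C>0$, $0<\delta<1$ and $\epsilon>0$, the choice of $G,\lambda,\beta_2,\beta,\eta,T,S_1$ is called *admissible* if $G,\lambda,\eta>0$, $$G\ge\max\Big\{2\lambda,\,2\sigma,\,2\|\nabla f(x_1)\|,\,\sqrt{\tfrac{C\Delta_1L_0\sqrt d}{\sqrt{\beta_2}\,\delta}},\,\Big(\tfrac{C\Delta_1L_\rho\sqrt d}{\sqrt{\beta_2}\,\delta}\Big)^{\frac1{2-\rho}}\Big\},$$ $$0<\beta_2\le 1,\qquad \sqrt{\beta_2}\le\frac{\lambda}{2\sigma},\qquad \beta=\theta^2\eta^2\le1\ \text{ with }\ \theta=40L\sqrt G\,\lambda^{-3/2},$$ $$\eta\le c\min\Big\{r\sqrt{\tfrac{\beta_2}d},\ \tfrac GL\sqrt{\tfrac{\beta_2}d},\ \tfrac\lambda L,\ \tfrac{\lambda^4d\,\delta}{\beta_2\Delta_1L^2},\ \tfrac{\lambda^2\sqrt\delta\,\epsilon}{\sigma GL}\Big\},\qquad T=\Big\lceil\frac{C\,G\Delta_1}{\eta\delta\epsilon^2}\Big\rceil,\qquad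 S_1\ge\max\Big\{1,\frac1{2\beta^2T}\Big\}$$ (the last lower bound being just $S_1\ge1$ in the degenerate case $\beta^2T=0$). **Theorem.** There are numerical constants $c,C>0$ such that the following holds. 1. In the above setting, for every $0<\delta<1$, every $\epsilon>0$ and every admissible choice of the parameters, with probability at least $1-\delta$ we have $$x_t\in U\ \text{ and }\ \|\nabla f(x_t)\|\le G\quad\text{for all }1\le t\le T,\qquad\text{and}\qquad \frac1T\sum_{t=1}^T\|\nabla f(x_t)\|^2\le\epsilon^2 .$$ 2. (Gradient complexity $\mathcal O(d^{\frac{2+\rho}{2(2-\rho)}}\epsilon^{-3})$.) For all fixed values of $L_0,L_\rho,\rho,\sigma,\Delta_1,\|\nabla f(x_1)\|,\delta,\lambda,\beta_2$ (with $0<\beta_2\le1$, $\sqrt{\beta_2}\le\frac\lambda{2\sigma}$) there is a constant $K$, depending on these values but not on $d$ and $\epsilon$, such that for every $d\ge1$ and all sufficiently small $\epsilon>0$ (how small may depend on $d$) there is an admissible choice of $G,\beta,\eta,T,S_1$ with $$S_1+2(T-1)\le K\,d^{\frac{2+\rho}{2(2-\rho)}}\,\epsilon^{-3}.$$ -/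

import Mathlib

open MeasureTheory ProbabilityTheory
open scoped ENNReal

/-! ### Function class -/

/-- `f` is `(L₀, Lρ)`-smooth (with exponent `ρ`) on the open set `U`: it is twice differentiable at
every point of `U`, and for almost every `x ∈ U` the spectral norm of the Hessian is at most
`L₀ + Lρ ‖∇f(x)‖ ^ ρ`. -/
structure IsGenSmoothOn {d : ℕ} (U : Set (EuclideanSpace ℝ (Fin d)))
    (f : EuclideanSpace ℝ (Fin d) → ℝ) (L₀ Lρ ρ : ℝ) : Prop where
  differentiableOn : DifferentiableOn ℝ f U
  differentiableOn_gradient : DifferentiableOn ℝ (gradient f) U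
  hessian_le : ∀ᵐ x ∂(volume.restrict U),
    ‖fderiv ℝ (gradient f) x‖ ≤ L₀ + Lρ * ‖gradient f x‖ ^ ρ

/-- Standing assumptions on the objective `f` with domain `U`: the domain is open, `f` is
differentiable on it and bounded below on it, and `f` is a closed function, i.e. its sublevel sets
are closed in `ℝ^d` (this is automatic if `U = ℝ^d`). Values of `f` outside `U` play no role. -/
structure IsObjective {d : ℕ} (U : Set (EuclideanSpace ℝ (Fin d)))
    (f : EuclideanSpace ℝ (Fin d) → ℝ) : Prop where
  isOpen : IsOpen U
  differentiableOn : DifferentiableOn ℝ f U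
  bddBelow : BddBelow (f '' U)
  isClosed_sublevel : ∀ a : ℝ, IsClosed {x ∈ U | f x ≤ a}

/-- The stochastic gradient `∇F(x, ξ)`, the gradient in the first argument. -/
noncomputable def stochGrad {d : ℕ} {Ξ : Type*} (F : EuclideanSpace ℝ (Fin d) → Ξ → ℝ)
    (x : EuclideanSpace ℝ (Fin d)) (ξ : Ξ) : EuclideanSpace ℝ (Fin d) :=
  gradient (fun y => F y ξ) x

/-- Under the sampling distribution `P`, the stochastic gradient is at every point of the domain
unbiased, and its noise is almost surely bounded by `σ`. -/
structure IsBoundedNoise {d : ℕ} {Ξ : Type*} [MeasurableSpace Ξ]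
    (U : Set (EuclideanSpace ℝ (Fin d))) (f : EuclideanSpace ℝ (Fin d) → ℝ)
    (F : EuclideanSpace ℝ (Fin d) → Ξ → ℝ) (P : Measure Ξ) (σ : ℝ) : Prop where
  measurable : ∀ x ∈ U, Measurable (stochGrad F x)
  unbiased : ∀ x ∈ U, ∫ ξ, stochGrad F x ξ ∂P = gradient f x
  bounded : ∀ x ∈ U, ∀ᵐ ξ ∂P, ‖stochGrad F x ξ - gradient f x‖ ≤ σ

/-! ### The algorithm -/

/-- The numerical inputs of VRAdam. -/
structure VRAdamInput where
  /-- momentum parameter -/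
  β : ℝ
  /-- second order momentum parameter -/
  β₂ : ℝ
  /-- step size -/
  η : ℝ
  /-- the regularizer `λ` in the denominator -/
  lam : ℝ
  /-- number of iterations -/
  T : ℕ
  /-- size of the initial mega-batch -/
  S₁ : ℕ

/-- The quantities held at the end of iteration `t`: `x = x_t`, `xNext = x_{t+1}`, `m = m_t`,
`v = v_t`. -/
structure VRAdamState (d : ℕ) where
  x : EuclideanSpace ℝ (Fin d)
  xNext : EuclideanSpace ℝ (Fin d)
  m : EuclideanSpace ℝ (Fin d)
  v : EuclideanSpace ℝ (Fin d)

/-- Iteration `1`: the mega-batch `ζ` gives `m₁`, the average of the stochastic gradients at `x₁`;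
`v₁ = β₂ m₁²` and `x₂ = x₁ - η m₁ / (|m₁| + λ)`, coordinate-wise. -/
noncomputable def vrAdamInit {d : ℕ} {Ξ : Type*} (p : VRAdamInput)
    (g : EuclideanSpace ℝ (Fin d) → Ξ → EuclideanSpace ℝ (Fin d))
    (x₁ : EuclideanSpace ℝ (Fin d)) (ζ : Fin p.S₁ → Ξ) : VRAdamState d :=
  let m : EuclideanSpace ℝ (Fin d) := (1 / (p.S₁ : ℝ)) • ∑ i, g x₁ (ζ i)
  { x := x₁
    xNext := WithLp.toLp 2 fun i => x₁ i - p.η * m i / (|m i| + p.lam)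
    m := m
    v := WithLp.toLp 2 fun i => p.β₂ * m i ^ 2 }

/-- Iteration `t ≥ 2`, from the state `s` at the end of iteration `t - 1` and the new sample
`ξ = ξ_t`. -/
noncomputable def vrAdamStep {d : ℕ} {Ξ : Type*} (p : VRAdamInput)
    (g : EuclideanSpace ℝ (Fin d) → Ξ → EuclideanSpace ℝ (Fin d))
    (t : ℕ) (s : VRAdamState d) (ξ : Ξ) : VRAdamState d :=
  let x := s.xNext
  let m : EuclideanSpace ℝ (Fin d) :=
    (1 - p.β) • s.m + p.β • g x ξ + (1 - p.β) • (g x ξ - g s.x ξ)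
  let v : EuclideanSpace ℝ (Fin d) :=
    WithLp.toLp 2 fun i => (1 - p.β₂) * s.v i + p.β₂ * (g x ξ i) ^ 2
  let vHat : EuclideanSpace ℝ (Fin d) :=
    WithLp.toLp 2 fun i => v i / (1 - (1 - p.β₂) ^ t)
  { x := x
    xNext := WithLp.toLp 2 fun i => x i - p.η / (√(vHat i) + p.lam) * m i
    m := m
    v := v }

/-- The state at the end of iteration `k + 1`; iteration `t ≥ 2` uses the sample `ξ t`. -/
noncomputable def vrAdamState {d : ℕ} {Ξ : Type*} (p : VRAdamInput)
    (g : EuclideanSpace ℝ (Fin d) → Ξ → EuclideanSpace ℝ (Fin d))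
    (x₁ : EuclideanSpace ℝ (Fin d)) (ζ : Fin p.S₁ → Ξ) (ξ : ℕ → Ξ) : ℕ → VRAdamState d
  | 0 => vrAdamInit p g x₁ ζ
  | k + 1 => vrAdamStep p g (k + 2) (vrAdamState p g x₁ ζ ξ k) (ξ (k + 2))

/-- The iterate `x_t` of VRAdam, for `t ≥ 1`. -/
noncomputable def vrAdamIterate {d : ℕ} {Ξ : Type*} (p : VRAdamInput)
    (g : EuclideanSpace ℝ (Fin d) → Ξ → EuclideanSpace ℝ (Fin d))
    (x₁ : EuclideanSpace ℝ (Fin d)) (ζ : Fin p.S₁ → Ξ) (ξ : ℕ → Ξ) (t : ℕ) :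
    EuclideanSpace ℝ (Fin d) :=
  (vrAdamState p g x₁ ζ ξ (t - 1)).x

/-- The number of stochastic gradients that VRAdam evaluates: `S₁` in the mega-batch, and two (at
`x_t` and at `x_{t-1}`) in each iteration `t = 2, …, T`. -/
def VRAdamInput.gradientEvals (p : VRAdamInput) : ℕ := p.S₁ + 2 * (p.T - 1)

/-- All the samples, i.e. the mega-batch `ζ` together with `ξ_2, …, ξ_T`, are i.i.d. with law `P`. -/
structure IsIIDSampling {Ω Ξ : Type*} [MeasurableSpace Ω] [MeasurableSpace Ξ] (μ : Measure Ω)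
    (P : Measure Ξ) (S₁ T : ℕ) (ζ : Fin S₁ → Ω → Ξ) (ξ : ℕ → Ω → Ξ) : Prop where
  measurable_batch : ∀ i, Measurable (ζ i)
  measurable_sample : ∀ t ∈ Finset.Icc 2 T, Measurable (ξ t)
  law_batch : ∀ i, μ.map (ζ i) = P
  law_sample : ∀ t ∈ Finset.Icc 2 T, μ.map (ξ t) = P
  indep : iIndepFun (Sum.elim ζ fun t : Finset.Icc 2 T => ξ t) μ

/-! ### The choice of parameters -/

/-- The quotient `a / b` of non-negative reals with `a / 0 = ∞` for `a > 0`. -/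
noncomputable def extDiv (a b : ℝ) : ℝ≥0∞ := ENNReal.ofReal a / ENNReal.ofReal b

/-- `L = 3 L₀ + 4 Lρ G^ρ`. -/
noncomputable def effSmooth (L₀ Lρ ρ G : ℝ) : ℝ := 3 * L₀ + 4 * Lρ * G ^ ρ

/-- `r = min {1 / (5 Lρ G^(ρ-1)), 1 / (5 (L₀^(ρ-1) Lρ)^(1/ρ))}`, with `1 / 0 = ∞`. The second term
is absent if `ρ = 0` or `L₀ = 0`, where its formula has no meaning. -/
noncomputable def localRadius (L₀ Lρ ρ G : ℝ) : ℝ≥0∞ :=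
  min (extDiv 1 (5 * Lρ * G ^ (ρ - 1)))
    (if ρ = 0 ∨ L₀ = 0 then ⊤ else extDiv 1 (5 * (L₀ ^ (ρ - 1) * Lρ) ^ (1 / ρ)))

/-- The minimum of five terms that bounds the step size up to the factor `c`. -/
noncomputable def stepBound (d : ℕ) (L₀ Lρ ρ σ Δ₁ δ ε G lam β₂ : ℝ) : ℝ≥0∞ :=
  let L := effSmooth L₀ Lρ ρ G
  min (localRadius L₀ Lρ ρ G * ENNReal.ofReal √(β₂ / d)) <|
  min (extDiv (G * √(β₂ / d)) L) <|
  min (extDiv lam L) <|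
  min (extDiv (lam ^ 4 * d * δ) (β₂ * Δ₁ * L ^ 2))
    (extDiv (lam ^ 2 * √δ * ε) (σ * G * L))

/-- The conditions on `G` and on the inputs of VRAdam. Here `Δ₁` is the initial suboptimality gap,
`g₁` the initial gradient norm, and `c`, `C` are the numerical constants. -/
structure IsAdmissible (c C : ℝ) (d : ℕ) (L₀ Lρ ρ σ Δ₁ g₁ δ ε G : ℝ) (p : VRAdamInput) :
    Prop where
  lam_pos : 0 < p.lam
  G_pos : 0 < G
  lam_le : 2 * p.lam ≤ G
  sigma_le : 2 * σ ≤ G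
  grad_le : 2 * g₁ ≤ G
  L₀_le : √(C * Δ₁ * L₀ * √d / (√p.β₂ * δ)) ≤ G
  Lρ_le : (C * Δ₁ * Lρ * √d / (√p.β₂ * δ)) ^ (1 / (2 - ρ)) ≤ G
  β₂_pos : 0 < p.β₂
  β₂_le_one : p.β₂ ≤ 1
  /-- `√β₂ ≤ λ / (2σ)`, which is no condition if `σ = 0` -/
  sqrt_β₂_le : 2 * σ * √p.β₂ ≤ p.lam
  /-- `β = θ² η²` with `θ = 40 L √G λ^(-3/2)` -/
  β_eq : p.β = (40 * effSmooth L₀ Lρ ρ G * √G * p.lam ^ (-(3 / 2) : ℝ)) ^ 2 * p.η ^ 2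
  β_le_one : p.β ≤ 1
  η_pos : 0 < p.η
  η_le : ENNReal.ofReal p.η ≤
    ENNReal.ofReal c * stepBound d L₀ Lρ ρ σ Δ₁ δ ε G p.lam p.β₂
  T_eq : p.T = ⌈C * G * Δ₁ / (p.η * δ * ε ^ 2)⌉₊
  S₁_pos : 1 ≤ p.S₁
  S₁_ge : 1 / (2 * p.β ^ 2 * p.T) ≤ (p.S₁ : ℝ)

/-! ### From an almost everywhere bound on the Hessian to local smoothness -/

/-! While gradients are at most 2G, the Hessian bound makes the gradient L-Lipschitz on short
segments, and closedness of f keeps short steps inside U. So everything is easy as long as ‖∇f(x_t)‖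
≤ G. To show that this persists with high probability, all estimates are summed only as long as the
trajectory is "alive", and the probability of dying is bounded afterwards by Markov's inequality, so
the argument is not circular.

Let e = m - ∇f(x) be the estimation error, N the noise of the stochastic gradient and D = √(d/β₂).
The denominator dominates √β₂ times a gradient estimate, so a step has length at most 2ηD while ‖e‖
≤ λD. From x to the next iterate x', with new sample ξ, the error becomes (1-β)e + N(x',ξ) -
(1-β)N(x,ξ). Split e = u + w, where u' = (1-β)u + βN(x',ξ) and w' = (1-β)(w + N(x',ξ) - N(x,ξ)).
Then ‖u‖ ≤ σ always, by convexity, and the increments of w are at most 2L‖x'-x‖. Alive means that x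
∈ U, the gap f(x) - inf f is at most G²/(6L), and ‖w‖ ≤ λD/2. Since ‖∇f‖² ≤ 6L·gap and 2σ ≤ λD, this
gives ‖∇f(x)‖ ≤ G and ‖e‖ ≤ λD (`IsAlive.isRegularState`).

Two drift inequalities hold on the alive event. The potential gap + η/(λβ)‖e‖² decreases by a
multiple of ‖∇f‖² plus a multiple of ‖x'-x‖², up to a small noise term and a term linear in the new
noise (`IsScaledStep.potential_le`). The sixth power ‖w‖⁶ grows by at most a multiple of ‖x'-x‖²,
again up to a linear term. Aliveness is determined by the past, and the new sample is independent of
the past, so the linear terms integrate to zero; `setIntegral_drift` sums such inequalities over the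
alive events.

With Δ the initial gap, the first sum bounds by 2Δ the expected squared gradients, squared steps and
potential at death, with their weights. Markov's inequality then bounds death through a large gap,
death through a large w (whose sixth moment is paid for by the squared steps), and a large average
of squared gradients on surviving runs. The sixth power is the one that fits: Markov for ‖w‖^(2m)
gives a bound of order (G/λ)^(3-m) δ/D², which is free of G/λ at m = 3. The constants c = 1/10000
and C = 1000 make the three probabilities add up to less than δ.

Measurability of the stochastic gradient is known only at points of U, so the analysis concerns a
run whose gradients are set to zero outside U; it agrees with the actual run while that stays in U.

For the complexity, take G proportional to d^(1/(2(2-ρ))) and η proportional to ε. Then T is of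
order G²L/ε³ with L = O(G^ρ) in its dependence on d, and the batch is of lower order in ε. -/

/-- An everywhere differentiable curve whose speed is almost everywhere at most `M` moves by at most
`M` in unit time. -/
theorem norm_sub_le_of_ae_norm_deriv_le {F : Type*} [NormedAddCommGroup F] [InnerProductSpace ℝ F]
    {γ γ' : ℝ → F} {M : ℝ} (hγ : ∀ t ∈ Set.Icc (0 : ℝ) 1, HasDerivAt γ (γ' t) t)
    (hM : ∀ᵐ t : ℝ, t ∈ Set.Icc (0 : ℝ) 1 → ‖γ' t‖ ≤ M) : ‖γ 1 - γ 0‖ ≤ M := by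
  classical
  set u := γ 1 - γ 0 with hu
  set ψ : ℝ → ℝ := fun t => inner ℝ u (γ t) with hψ
  set ψ' : ℝ → ℝ := fun t => inner ℝ u (γ' t) with hψ'
  -- The integral inequality needs a majorant of ψ' at every point, while the bound on ψ' holds only
  -- almost everywhere. This maximum is such a majorant, and it equals the constant almost
  -- everywhere. Differentiability of the curve at every point matters: the Cantor function would be
  -- a counterexample.
  set φ : ℝ → ℝ := fun t => max (ψ' t) (‖u‖ * M) with hφ
  have hder : ∀ t ∈ Set.Icc (0 : ℝ) 1, HasDerivAt ψ (ψ' t) t := fun t ht => by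
    simpa using (hasDerivAt_const t u).inner ℝ (hγ t ht)
  have hae : ∀ᵐ t : ℝ, t ∈ Set.Icc (0 : ℝ) 1 → φ t = ‖u‖ * M := by
    filter_upwards [hM] with t ht h
    refine max_eq_right ((real_inner_le_norm _ _).trans ?_)
    exact mul_le_mul_of_nonneg_left (ht h) (norm_nonneg _)
  have hae' : φ =ᵐ[volume.restrict (Set.Icc (0 : ℝ) 1)] fun _ => ‖u‖ * M :=
    (ae_restrict_iff' measurableSet_Icc).2 hae
  have hint : IntegrableOn φ (Set.Icc (0 : ℝ) 1) :=
    Integrable.congr (integrable_const _) hae'.symm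
  have key := intervalIntegral.sub_le_integral_of_hasDeriv_right_of_le (g := ψ) (g' := ψ') (φ := φ)
    zero_le_one (fun t ht => (hder t ht).continuousAt.continuousWithinAt)
    (fun t ht => (hder t (Set.Ioo_subset_Icc_self ht)).hasDerivWithinAt) hint
    (fun t _ => le_max_left _ _)
  have hval : ∫ t in (0 : ℝ)..1, φ t = ‖u‖ * M := by
    rw [intervalIntegral.integral_congr_ae (g := fun _ => ‖u‖ * M)]
    · simp
    · filter_upwards [hae] with t ht h
      rw [Set.uIoc_of_le zero_le_one] at h
      exact ht (Set.Ioc_subset_Icc_self h)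
  have h1 : ψ 1 - ψ 0 = ‖u‖ * ‖u‖ := by
    simp only [hψ]
    rw [← inner_sub_right, ← hu, real_inner_self_eq_norm_mul_norm]
  rw [hval, h1] at key
  -- For u = 0 only 0 ≤ M is left to show; it holds because the bound is attained at some t.
  rcases (norm_nonneg u).eq_or_lt with h0 | h0
  · rw [← h0]
    have : ∃ t : ℝ, ‖γ' t‖ ≤ M := by
      by_contra hcon
      push Not at hcon
      have : ∀ᵐ t : ℝ, t ∉ Set.Icc (0 : ℝ) 1 := by
        filter_upwards [hM] with t ht h using absurd (ht h) (not_le.2 (hcon t))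
      have h2 : volume (Set.Icc (0 : ℝ) 1) = 0 := by
        simpa only [not_not, Set.ofPred_mem_eq] using ae_iff.1 this
      simp at h2
    obtain ⟨t, ht⟩ := this
    exact (norm_nonneg _).trans ht
  · exact le_of_mul_le_mul_left key h0

/-- A null property is null along almost every line of a given direction. -/
theorem ae_ae_add_smul {E : Type*} [NormedAddCommGroup E] [NormedSpace ℝ E]
    [FiniteDimensional ℝ E] [MeasurableSpace E] [BorelSpace E] (μ : Measure E) [μ.IsAddHaarMeasure]
    {p : E → Prop} (hp : ∀ᵐ x ∂μ, p x) (v : E) : ∀ᵐ y ∂μ, ∀ᵐ t : ℝ, p (y + t • v) := by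
  obtain ⟨s, hs, hsm, hs0⟩ := exists_measurable_superset_of_null (ae_iff.1 hp)
  have hq : ∀ᵐ x ∂μ, x ∉ s := by simpa [ae_iff] using hs0
  have hmeas : MeasurableSet {z : E × ℝ | z.1 + z.2 • v ∉ s} := by
    have : Measurable fun z : E × ℝ => z.1 + z.2 • v := by fun_prop
    exact this hsm.compl
  -- Fubini: for each fixed t, translation by t • v preserves null sets; then the two quantifiers
  -- are exchanged.
  have h := (Measure.ae_ae_comm (μ := μ) (ν := (volume : Measure ℝ))
    (p := fun y t => y + t • v ∉ s) hmeas).2 (Filter.Eventually.of_forall fun t =>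
      (measurePreserving_add_right μ (t • v)).quasiMeasurePreserving.ae hq)
  filter_upwards [h] with y hy
  filter_upwards [hy] with t ht
  by_contra hcon
  exact ht (hs hcon)

/-- For an everywhere differentiable function, a continuous almost everywhere bound on the norm of
the derivative holds everywhere. -/
theorem norm_fderiv_le_of_ae_le {E F : Type*} [NormedAddCommGroup E] [NormedSpace ℝ E]
    [FiniteDimensional ℝ E] [MeasurableSpace E] [BorelSpace E] (μ : Measure E) [μ.IsAddHaarMeasure]
    [NormedAddCommGroup F] [InnerProductSpace ℝ F] {U : Set E} (hU : IsOpen U) {g : E → F}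
    (hg : DifferentiableOn ℝ g U) {φ : E → ℝ} (hφ : ContinuousOn φ U)
    (h : ∀ᵐ x ∂(μ.restrict U), ‖fderiv ℝ g x‖ ≤ φ x) {x : E} (hx : x ∈ U) :
    ‖fderiv ℝ g x‖ ≤ φ x := by
  have hgd : ∀ z ∈ U, HasFDerivAt g (fderiv ℝ g z) z := fun z hz =>
    ((hg z hz).differentiableAt (hU.mem_nhds hz)).hasFDerivAt
  refine le_of_forall_pos_le_add fun e he => ?_
  have hev : ∀ᶠ z in nhds x, z ∈ U ∧ φ z < φ x + e := by
    refine (hU.eventually_mem hx).and ?_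
    exact ((hφ x hx).continuousAt (hU.mem_nhds hx)).eventually (gt_mem_nhds (by linarith))
  obtain ⟨r, hr, hball⟩ := Metric.eventually_nhds_iff_ball.1 hev
  have hae : ∀ᵐ z ∂μ, z ∈ U → ‖fderiv ℝ g z‖ ≤ φ z := (ae_restrict_iff' hU.measurableSet).1 h
  -- Almost every y has the bound along almost all of its line in direction v, so the
  -- one-dimensional estimate applies at a dense set of y, and y → x by continuity of g.
  have hlip : ∀ v : E, ‖v‖ < r / 2 → ‖g (x + v) - g x‖ ≤ (φ x + e) * ‖v‖ := by
    intro v hv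
    have hdense := Measure.dense_of_ae (ae_ae_add_smul μ hae v)
    have hgood : ∀ y ∈ Metric.ball x (r / 2),
        (∀ᵐ t : ℝ, y + t • v ∈ U → ‖fderiv ℝ g (y + t • v)‖ ≤ φ (y + t • v)) →
        ‖g (y + v) - g y‖ ≤ (φ x + e) * ‖v‖ := by
      intro y hy hyt
      have hmem : ∀ t ∈ Set.Icc (0 : ℝ) 1, y + t • v ∈ Metric.ball x r := by
        intro t ht
        rw [mem_ball_iff_norm] at hy ⊢
        have h1 : ‖t • v‖ ≤ ‖v‖ := by
          rw [norm_smul, Real.norm_of_nonneg ht.1]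
          exact mul_le_of_le_one_left (norm_nonneg _) ht.2
        calc ‖y + t • v - x‖ = ‖(y - x) + t • v‖ := by congr 1; abel
          _ ≤ ‖y - x‖ + ‖t • v‖ := norm_add_le _ _
          _ < r := by linarith
      have := norm_sub_le_of_ae_norm_deriv_le (γ := fun t => g (y + t • v))
        (γ' := fun t => fderiv ℝ g (y + t • v) v) (M := (φ x + e) * ‖v‖) ?_ ?_
      · simpa using this
      · intro t ht
        have h1 : HasDerivAt (fun t : ℝ => y + t • v) v t := by
          simpa using ((hasDerivAt_id t).smul_const v).const_add y
        exact (hgd _ (hball _ (hmem t ht)).1).comp_hasDerivAt t h1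
      · filter_upwards [hyt] with t ht h01
        have hb := hball _ (hmem t h01)
        refine (ContinuousLinearMap.le_opNorm _ _).trans ?_
        exact mul_le_mul_of_nonneg_right ((ht hb.1).trans hb.2.le) (norm_nonneg _)
    have hcont : Filter.Tendsto (fun y => ‖g (y + v) - g y‖) (nhds x) (nhds ‖g (x + v) - g x‖) := by
      have hxv : x + v ∈ U := by
        refine (hball _ ?_).1
        rw [mem_ball_iff_norm]; simp; linarith
      have h1 : ContinuousAt g (x + v) := (hgd _ hxv).continuousAt
      have h2 : ContinuousAt g x := (hgd _ hx).continuousAt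
      have h3 : ContinuousAt (fun y => g (y + v)) x :=
        ContinuousAt.comp (f := fun y => y + v) (g := g) h1 (by fun_prop)
      exact (h3.sub h2).norm
    refine le_of_tendsto_of_frequently hcont ?_
    have hfreq := (hdense x)
    rw [mem_closure_iff_frequently] at hfreq
    have := hfreq.and_eventually (Metric.ball_mem_nhds x (half_pos hr))
    exact this.mono fun y hy => hgood y hy.2 hy.1
  -- Sign of the bound: a nonzero v in the Lipschitz estimate forces it; in the zero space the
  -- almost everywhere bound holds at the only point there is.
  have hnn : 0 ≤ φ x + e := by
    by_contra hneg
    push Not at hneg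
    by_cases hE : ∃ v : E, v ≠ 0
    · obtain ⟨v, hv⟩ := hE
      have hvn : 0 < ‖v‖ := norm_pos_iff.2 hv
      have h1 := hlip ((r / 4 / ‖v‖) • v) (by
        rw [norm_smul, Real.norm_of_nonneg (by positivity), div_mul_cancel₀ _ hvn.ne']; linarith)
      rw [norm_smul, Real.norm_of_nonneg (by positivity), div_mul_cancel₀ _ hvn.ne'] at h1
      have := norm_nonneg (g (x + (r / 4 / ‖v‖) • v) - g x)
      nlinarith
    · push Not at hE
      have hs : Subsingleton E := ⟨fun a b => by rw [hE a, hE b]⟩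
      obtain ⟨z, hz⟩ := (Measure.dense_of_ae hae).nonempty
      have hzx : z = x := Subsingleton.elim _ _
      have := (norm_nonneg _).trans (hz (hzx ▸ hx))
      rw [hzx] at this
      linarith
  refine (hgd x hx).le_of_lip' hnn ?_
  filter_upwards [Metric.ball_mem_nhds x (half_pos hr)] with z hz
  have := hlip (z - x) (mem_ball_iff_norm.1 hz)
  simpa using this

/-! ### Lipschitz gradients, Taylor expansion and staying in the domain -/

section LocalSmoothness

variable {d : ℕ} {U : Set (EuclideanSpace ℝ (Fin d))} {f h : EuclideanSpace ℝ (Fin d) → ℝ}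
  {L₀ Lρ ρ G L : ℝ}

/-- The Hessian bound of an `(L₀, Lρ)`-smooth function holds at every point. -/
theorem IsGenSmoothOn.norm_hessian_le (hh : IsGenSmoothOn U h L₀ Lρ ρ) (hU : IsOpen U) (hρ : 0 ≤ ρ)
    {x : EuclideanSpace ℝ (Fin d)} (hx : x ∈ U) :
    ‖fderiv ℝ (gradient h) x‖ ≤ L₀ + Lρ * ‖gradient h x‖ ^ ρ := by
  refine norm_fderiv_le_of_ae_le volume hU hh.differentiableOn_gradient (φ := fun x =>
    L₀ + Lρ * ‖gradient h x‖ ^ ρ) ?_ hh.hessian_le hx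
  have h1 := hh.differentiableOn_gradient.continuousOn.norm
  exact continuousOn_const.add (continuousOn_const.mul (h1.rpow_const fun _ _ => Or.inr hρ))

/-- `L` is a Lipschitz constant of the gradient as long as gradients are below `2 G`. -/
structure IsEffSmooth (L₀ Lρ ρ G L : ℝ) : Prop where
  Lρ_nonneg : 0 ≤ Lρ
  ρ_nonneg : 0 ≤ ρ
  G_pos : 0 < G
  L_pos : 0 < L
  lt : L₀ + Lρ * (2 * G) ^ ρ < L

/-- Along a short segment inside the domain the gradient is `L`-Lipschitz. -/
theorem IsGenSmoothOn.norm_gradient_lineMap_sub_le (hh : IsGenSmoothOn U h L₀ Lρ ρ) (hU : IsOpen U)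
    (hL : IsEffSmooth L₀ Lρ ρ G L) {x v : EuclideanSpace ℝ (Fin d)}
    (hseg : ∀ t ∈ Set.Icc (0 : ℝ) 1, x + t • v ∈ U) (hx : ‖gradient h x‖ ≤ 3 / 2 * G)
    (hv : ‖v‖ ≤ G / (2 * L)) {t : ℝ} (ht : t ∈ Set.Icc (0 : ℝ) 1) :
    ‖gradient h (x + t • v) - gradient h x‖ ≤ L * ‖v‖ * t := by
  obtain ⟨hLρ, hρ, hG, hLpos, hlt⟩ := hL
  rcases eq_or_ne v 0 with rfl | hv0
  · simp
  have hvn : 0 < ‖v‖ := norm_pos_iff.2 hv0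
  have hLv : L * ‖v‖ ≤ G / 2 := by
    rw [le_div_iff₀ (by positivity)] at hv; linarith
  have hder : ∀ t ∈ Set.Icc (0 : ℝ) 1, HasDerivAt (fun t : ℝ => gradient h (x + t • v) - gradient h x)
      (fderiv ℝ (gradient h) (x + t • v) v) t := by
    intro t ht
    have h1 : HasDerivAt (fun t : ℝ => x + t • v) v t := by
      simpa using ((hasDerivAt_id t).smul_const v).const_add x
    have h2 : HasFDerivAt (gradient h) (fderiv ℝ (gradient h) (x + t • v)) (x + t • v) :=
      ((hh.differentiableOn_gradient _ (hseg t ht)).differentiableAt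
        (hU.mem_nhds (hseg t ht))).hasFDerivAt
    exact (h2.comp_hasDerivAt t h1).sub_const _
  -- Barrier argument: the derivative has to be compared only at times when the deviation equals
  -- L‖v‖t. There the gradient is at most 3/2 G + G/2 = 2G, so the Hessian is strictly below L.
  refine image_norm_le_of_norm_deriv_right_lt_deriv_boundary'
    (f := fun t : ℝ => gradient h (x + t • v) - gradient h x)
    (f' := fun t => fderiv ℝ (gradient h) (x + t • v) v) (a := 0) (b := 1)
    (B := fun t => L * ‖v‖ * t) (B' := fun _ => L * ‖v‖)
    (fun t ht => (hder t ht).continuousAt.continuousWithinAt)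
    (fun t ht => (hder t (Set.Ico_subset_Icc_self ht)).hasDerivWithinAt) (by simp)
    (by fun_prop) (fun t _ => ?_) ?_ ht
  · simpa using ((hasDerivAt_id t).const_mul (L * ‖v‖)).hasDerivWithinAt
  · intro t ht heq
    have ht' := Set.Ico_subset_Icc_self ht
    have hle : ‖gradient h (x + t • v)‖ ≤ 2 * G := by
      have h1 := norm_le_norm_add_norm_sub' (gradient h (x + t • v)) (gradient h x)
      have h2 : L * ‖v‖ * t ≤ G / 2 := by
        have := mul_le_of_le_one_right (by positivity : 0 ≤ L * ‖v‖) ht'.2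
        linarith
      linarith
    have h3 := hh.norm_hessian_le hU hρ (hseg t ht')
    have h4 : ‖gradient h (x + t • v)‖ ^ ρ ≤ (2 * G) ^ ρ :=
      Real.rpow_le_rpow (norm_nonneg _) hle hρ
    have h5 : ‖fderiv ℝ (gradient h) (x + t • v)‖ < L := by
      have := mul_le_mul_of_nonneg_left h4 hLρ
      linarith
    exact (ContinuousLinearMap.le_opNorm _ _).trans_lt (mul_lt_mul_of_pos_right h5 hvn)

/-- Along a short segment inside the domain the first order Taylor expansion has a quadratic
error. -/
theorem IsGenSmoothOn.abs_sub_sub_inner_le_of_segment (hh : IsGenSmoothOn U h L₀ Lρ ρ)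
    (hU : IsOpen U) (hL : IsEffSmooth L₀ Lρ ρ G L) {x v : EuclideanSpace ℝ (Fin d)}
    (hseg : ∀ t ∈ Set.Icc (0 : ℝ) 1, x + t • v ∈ U) (hx : ‖gradient h x‖ ≤ 3 / 2 * G)
    (hv : ‖v‖ ≤ G / (2 * L)) :
    |h (x + v) - h x - inner ℝ (gradient h x) v| ≤ L * ‖v‖ ^ 2 := by
  have hmem : ∀ z ∈ segment ℝ x (x + v), ∃ t ∈ Set.Icc (0 : ℝ) 1, z = x + t • v := by
    intro z hz
    rw [segment_eq_image'] at hz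
    obtain ⟨t, ht, rfl⟩ := hz
    exact ⟨t, ht, by simp⟩
  have hLpos := hL.L_pos
  have key := Convex.norm_image_sub_le_of_norm_fderiv_le' (𝕜 := ℝ) (f := h) (C := L * ‖v‖)
    (s := segment ℝ x (x + v)) (x := x) (y := x + v) (φ := fderiv ℝ h x) ?_ ?_ (convex_segment _ _)
    (left_mem_segment _ _ _) (right_mem_segment _ _ _)
  · have h1 : fderiv ℝ h x v = inner ℝ (gradient h x) v := by
      simp [gradient]
    simp only [add_sub_cancel_left, h1] at key
    rw [Real.norm_eq_abs] at key
    linarith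
  · intro z hz
    obtain ⟨t, ht, rfl⟩ := hmem z hz
    exact (hh.differentiableOn _ (hseg t ht)).differentiableAt (hU.mem_nhds (hseg t ht))
  · intro z hz
    obtain ⟨t, ht, rfl⟩ := hmem z hz
    have h1 := hh.norm_gradient_lineMap_sub_le hU hL hseg hx hv ht
    have h2 : ‖fderiv ℝ h (x + t • v) - fderiv ℝ h x‖
        = ‖gradient h (x + t • v) - gradient h x‖ := by
      rw [gradient, gradient, ← map_sub, LinearIsometryEquiv.norm_map]
    rw [h2]
    exact h1.trans (mul_le_of_le_one_right (by positivity) ht.2)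

/-- A closed function whose gradient at `x` is not too large is defined on a ball around `x`. -/
theorem IsObjective.add_smul_mem (hf : IsObjective U f) (hh : IsGenSmoothOn U f L₀ Lρ ρ)
    (hL : IsEffSmooth L₀ Lρ ρ G L) {x v : EuclideanSpace ℝ (Fin d)} (hxU : x ∈ U)
    (hx : ‖gradient f x‖ ≤ 3 / 2 * G) (hv : ‖v‖ ≤ G / (2 * L)) :
    ∀ t ∈ Set.Icc (0 : ℝ) 1, x + t • v ∈ U := by
  have hU := hf.isOpen
  by_contra hcon
  push Not at hcon
  have hcont : Continuous fun t : ℝ => x + t • v := by fun_prop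
  -- The set of exit times is compact, so there is a first exit time t₀.
  have hcpt : IsCompact (Set.Icc (0 : ℝ) 1 ∩ (fun t : ℝ => x + t • v) ⁻¹' Uᶜ) :=
    isCompact_Icc.inter_right (hU.isClosed_compl.preimage hcont)
  obtain ⟨t₁, ht₁, ht₁'⟩ := hcon
  obtain ⟨t₀, ⟨ht₀, ht₀U⟩, hmin⟩ := hcpt.exists_isLeast ⟨t₁, ht₁, ht₁'⟩
  have hlt : ∀ u ∈ Set.Ico 0 t₀, x + u • v ∈ U := by
    intro u hu
    by_contra hu'
    exact absurd (hmin ⟨⟨hu.1, hu.2.le.trans ht₀.2⟩, hu'⟩) (not_le.2 hu.2)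
  have hpos : 0 < t₀ := by
    rcases ht₀.1.eq_or_lt with h0 | h0
    · subst h0; exact absurd hxU (by simpa using ht₀U)
    · exact h0
  have hsub : ∀ u ∈ Set.Ico 0 t₀, x + u • v ∈ {z ∈ U | f z ≤ f x + 3 / 2 * G * ‖v‖ + L * ‖v‖ ^ 2} := by
    intro u hu
    refine ⟨hlt u hu, ?_⟩
    have huv : ‖u • v‖ ≤ ‖v‖ := by
      rw [norm_smul, Real.norm_of_nonneg hu.1]
      exact mul_le_of_le_one_left (norm_nonneg _) (hu.2.le.trans ht₀.2)
    have h1 := hh.abs_sub_sub_inner_le_of_segment hU hL (x := x) (v := u • v) (fun t ht => by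
      rw [smul_smul]
      exact hlt _ ⟨mul_nonneg ht.1 hu.1, (mul_le_of_le_one_left hu.1 ht.2).trans_lt hu.2⟩) hx
      (huv.trans hv)
    have h2 := real_inner_le_norm (gradient f x) (u • v)
    have h3 : ‖gradient f x‖ * ‖u • v‖ ≤ 3 / 2 * G * ‖v‖ := by
      have := hL.G_pos
      gcongr
    have h4 : L * ‖u • v‖ ^ 2 ≤ L * ‖v‖ ^ 2 := by
      have := hL.L_pos
      gcongr
    have := (abs_le.1 h1).2
    linarith
  -- Before t₀ the Taylor bound keeps the points in one sublevel set. This set is closed, so the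
  -- exit point lies in U, a contradiction.
  have hclosure : t₀ ∈ closure (Set.Ico 0 t₀) := by
    rw [closure_Ico hpos.ne]; exact ⟨hpos.le, le_rfl⟩
  have := map_mem_closure hcont hclosure hsub
  rw [(hf.isClosed_sublevel _).closure_eq] at this
  exact ht₀U this.1

/-- A closed function whose gradient at `x` is not too large is defined on a ball around `x`. -/
theorem IsObjective.add_mem (hf : IsObjective U f) (hh : IsGenSmoothOn U f L₀ Lρ ρ)
    (hL : IsEffSmooth L₀ Lρ ρ G L) {x v : EuclideanSpace ℝ (Fin d)} (hxU : x ∈ U)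
    (hx : ‖gradient f x‖ ≤ 3 / 2 * G) (hv : ‖v‖ ≤ G / (2 * L)) : x + v ∈ U := by
  simpa using hf.add_smul_mem hh hL hxU hx hv 1 (by simp)

/-- Local Lipschitz bound for the gradient of the objective or of a component. -/
theorem IsObjective.norm_gradient_sub_le (hf : IsObjective U f) (hfs : IsGenSmoothOn U f L₀ Lρ ρ)
    (hh : IsGenSmoothOn U h L₀ Lρ ρ) (hL : IsEffSmooth L₀ Lρ ρ G L)
    {x v : EuclideanSpace ℝ (Fin d)} (hxU : x ∈ U) (hxf : ‖gradient f x‖ ≤ 3 / 2 * G)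
    (hxh : ‖gradient h x‖ ≤ 3 / 2 * G) (hv : ‖v‖ ≤ G / (2 * L)) :
    ‖gradient h (x + v) - gradient h x‖ ≤ L * ‖v‖ := by
  simpa using hh.norm_gradient_lineMap_sub_le hf.isOpen hL (hf.add_smul_mem hfs hL hxU hxf hv) hxh hv
    (t := 1) (by simp)

theorem IsObjective.abs_sub_sub_inner_le (hf : IsObjective U f) (hh : IsGenSmoothOn U f L₀ Lρ ρ)
    (hL : IsEffSmooth L₀ Lρ ρ G L) {x v : EuclideanSpace ℝ (Fin d)} (hxU : x ∈ U)
    (hx : ‖gradient f x‖ ≤ 3 / 2 * G) (hv : ‖v‖ ≤ G / (2 * L)) :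
    |f (x + v) - f x - inner ℝ (gradient f x) v| ≤ L * ‖v‖ ^ 2 :=
  hh.abs_sub_sub_inner_le_of_segment hf.isOpen hL (hf.add_smul_mem hh hL hxU hx hv) hx hv

theorem IsObjective.gap_nonneg (hf : IsObjective U f) {x : EuclideanSpace ℝ (Fin d)} (hxU : x ∈ U) :
    0 ≤ f x - sInf (f '' U) :=
  sub_nonneg.2 (csInf_le hf.bddBelow ⟨x, hxU, rfl⟩)

/-- The gradient is controlled by the suboptimality gap. -/
theorem IsObjective.sq_norm_gradient_le (hf : IsObjective U f) (hh : IsGenSmoothOn U f L₀ Lρ ρ)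
    (hL : IsEffSmooth L₀ Lρ ρ G L) {x : EuclideanSpace ℝ (Fin d)} (hxU : x ∈ U)
    (hx : ‖gradient f x‖ ≤ 3 / 2 * G) :
    ‖gradient f x‖ ^ 2 ≤ 6 * L * (f x - sInf (f '' U)) := by
  have hLpos := hL.L_pos
  have hGpos := hL.G_pos
  -- A gradient step of size 1/(4L) decreases f by at least (1/4 - 1/16)‖∇f‖²/L, and it cannot go
  -- below the infimum; 16/3 ≤ 6.
  set v := -(1 / (4 * L)) • gradient f x with hv
  have hvn : ‖v‖ = ‖gradient f x‖ / (4 * L) := by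
    rw [hv, neg_smul, norm_neg, norm_smul, Real.norm_of_nonneg (by positivity)]
    ring
  have hvle : ‖v‖ ≤ G / (2 * L) := by
    rw [hvn, div_le_div_iff₀ (by positivity) (by positivity)]
    nlinarith
  have h1 := (abs_le.1 (hf.abs_sub_sub_inner_le hh hL hxU hx hvle)).2
  have h2 := hf.gap_nonneg (hf.add_mem hh hL hxU hx hvle)
  have h3 : inner ℝ (gradient f x) v = -(‖gradient f x‖ ^ 2 / (4 * L)) := by
    rw [hv, inner_smul_right, real_inner_self_eq_norm_sq]; ring
  rw [h3, hvn] at h1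
  have h4 : 3 / 16 * ‖gradient f x‖ ^ 2 / L ≤ f x - sInf (f '' U) := by
    have e1 : L * (‖gradient f x‖ / (4 * L)) ^ 2 = 1 / 16 * ‖gradient f x‖ ^ 2 / L := by
      field_simp; ring
    have e2 : ‖gradient f x‖ ^ 2 / (4 * L) = 1 / 4 * ‖gradient f x‖ ^ 2 / L := by
      field_simp
    have e3 : 3 / 16 * ‖gradient f x‖ ^ 2 / L
      = 1 / 4 * ‖gradient f x‖ ^ 2 / L - 1 / 16 * ‖gradient f x‖ ^ 2 / L := by ring
    linarith
  rw [div_le_iff₀ hLpos] at h4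
  nlinarith [hf.gap_nonneg hxU]

/-- With vanishing smoothness constants every point of the domain is a minimizer. -/
theorem IsObjective.gap_eq_zero (hf : IsObjective U f) (hh : IsGenSmoothOn U f 0 0 ρ)
    (hρ : 0 ≤ ρ) {x : EuclideanSpace ℝ (Fin d)} (hxU : x ∈ U) :
    f x - sInf (f '' U) = 0 := by
  refine le_antisymm ?_ (hf.gap_nonneg hxU)
  rw [sub_nonpos]
  refine le_csInf ⟨_, x, hxU, rfl⟩ ?_
  rintro _ ⟨y, hy, rfl⟩
  -- Every positive L is a Lipschitz constant here, at every scale G. Small L first forces the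
  -- gradient at x to vanish, then makes the Taylor error at any y at most e.
  have hsm : ∀ L G : ℝ, 0 < L → 0 < G → IsEffSmooth 0 0 ρ G L := fun L G h1 h2 =>
    ⟨le_rfl, hρ, h2, h1, by simpa using h1⟩
  have hg : gradient f x = 0 := by
    by_contra hne
    have hpos : 0 < ‖gradient f x‖ := norm_pos_iff.2 hne
    have hgap := hf.gap_nonneg hxU
    set Δ := f x - sInf (f '' U)
    have h1 := hf.sq_norm_gradient_le hh (hsm (‖gradient f x‖ ^ 2 / (12 * (Δ + 1))) ‖gradient f x‖
      (by positivity) hpos) hxU (by linarith)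
    have h2 : 6 * (‖gradient f x‖ ^ 2 / (12 * (Δ + 1))) * Δ
        = ‖gradient f x‖ ^ 2 * (Δ / (2 * (Δ + 1))) := by field_simp; ring
    have h3 : Δ / (2 * (Δ + 1)) < 1 := by rw [div_lt_one (by positivity)]; linarith
    have h4 : (0 : ℝ) < ‖gradient f x‖ ^ 2 := by positivity
    have : f x - sInf (f '' U) = Δ := rfl
    rw [this, h2] at h1
    nlinarith
  refine le_of_forall_pos_le_add fun e he => ?_
  have hL : 0 < e / (‖y - x‖ ^ 2 + 1) := by positivity
  -- This G makes the radius G/(2L) equal to ‖y - x‖ + 1, so that y is within reach.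
  have hG : 0 < 2 * (e / (‖y - x‖ ^ 2 + 1)) * (‖y - x‖ + 1) := by positivity
  have h1 := hf.abs_sub_sub_inner_le hh (hsm _ _ hL hG) (x := x) (v := y - x) hxU
    (by rw [hg, norm_zero]; positivity) (by
      rw [le_div_iff₀ (by positivity)]
      nlinarith)
  rw [hg] at h1
  simp only [add_sub_cancel, inner_zero_left, sub_zero] at h1
  have h2 : e / (‖y - x‖ ^ 2 + 1) * ‖y - x‖ ^ 2 ≤ e := by
    rw [div_mul_eq_mul_div, div_le_iff₀ (by positivity)]
    nlinarith
  have := (abs_le.1 h1).1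
  linarith

end LocalSmoothness

/-! ### One iteration, deterministically -/

/-- The real inequalities between the parameters on which the analysis rests. Here `D` stands for
`√(d / β₂)`. -/
structure IsTuned (d : ℕ) (L σ G D : ℝ) (p : VRAdamInput) : Prop where
  L_pos : 0 < L
  G_pos : 0 < G
  lam_pos : 0 < p.lam
  η_pos : 0 < p.η
  σ_nonneg : 0 ≤ σ
  β₂_pos : 0 < p.β₂
  β₂_le_one : p.β₂ ≤ 1
  one_le_D : 1 ≤ D
  sq_D : D ^ 2 = d / p.β₂
  lam_le : 2 * p.lam ≤ G
  σ_le_G : 2 * σ ≤ G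
  σ_le_D : 2 * σ ≤ p.lam * D
  sqrt_le : 2 * σ * √p.β₂ ≤ p.lam
  β_eq : p.β * p.lam ^ 3 = 1600 * L ^ 2 * G * p.η ^ 2
  β_le_one : p.β ≤ 1
  η_le_G : 10000 * p.η * L * D ≤ G
  η_le_lam : 10000 * p.η * L ≤ p.lam

theorem IsTuned.β_pos {d : ℕ} {L σ G D : ℝ} {p : VRAdamInput} (hp : IsTuned d L σ G D p) :
    0 < p.β := by
  have := hp.L_pos; have := hp.G_pos; have := hp.lam_pos; have := hp.η_pos
  have h : 0 < p.β * p.lam ^ 3 := by rw [hp.β_eq]; positivity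
  exact pos_of_mul_pos_left h (by positivity)

/-- The step lengths permitted by the tuning lie well inside the radius of local smoothness. -/
theorem IsTuned.step_le {d : ℕ} {L σ G D : ℝ} {p : VRAdamInput} (hp : IsTuned d L σ G D p) {r : ℝ}
    (hr : r ≤ 2 * p.η * D) : r ≤ G / (2 * L) ∧ L * r ≤ G / 2 := by
  have hL := hp.L_pos
  have h := hp.η_le_G
  have hG := hp.G_pos
  have : L * r ≤ G / 2 := by nlinarith
  exact ⟨by rw [le_div_iff₀ (by positivity)]; linarith, this⟩

/-- The coordinate-wise step `v = -η h ⊙ (g + e)`, where `g` is the gradient and `e` the error of its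
estimate. -/
structure IsScaledStep {d : ℕ} (p : VRAdamInput) (G : ℝ) (g e v : EuclideanSpace ℝ (Fin d))
    (h : Fin d → ℝ) : Prop where
  apply_eq : ∀ i, v i = -(p.η * (h i * (g i + e i)))
  le_h : ∀ i, 1 / (2 * G) ≤ h i
  h_le : ∀ i, h i ≤ 1 / p.lam
  h_mul_le : ∀ i, h i * |g i| ≤ 1 / √p.β₂

/-! ### Length of a step, descent and decrease of the potential -/

section Step

variable {d : ℕ} {L σ G D : ℝ} {p : VRAdamInput} {g e v : EuclideanSpace ℝ (Fin d)} {h : Fin d → ℝ}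

theorem IsScaledStep.h_nonneg (hs : IsScaledStep p G g e v h) (hG : 0 < G) (i : Fin d) : 0 ≤ h i :=
  le_trans (by positivity) (hs.le_h i)

/-- The gradient part of each coordinate is at most η/√β₂ by normalization, so it has norm at most
ηD over d coordinates; the error part has norm at most η‖e‖/λ ≤ ηD. -/
theorem IsScaledStep.norm_le (hs : IsScaledStep p G g e v h) (hp : IsTuned d L σ G D p)
    (he : ‖e‖ ≤ p.lam * D) : ‖v‖ ≤ 2 * p.η * D := by
  have hlam := hp.lam_pos
  have hη := hp.η_pos
  have hD : 0 ≤ D := zero_le_one.trans hp.one_le_D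
  have hcoord : ∀ i, ‖v i‖ ^ 2 ≤ 2 * p.η ^ 2 * (1 / p.β₂) + 2 * p.η ^ 2 / p.lam ^ 2 * ‖e i‖ ^ 2 := by
    intro i
    have h0 := hs.h_nonneg hp.G_pos i
    have h1 : (h i * g i) ^ 2 ≤ 1 / p.β₂ := by
      have := pow_le_pow_left₀ (by positivity) (hs.h_mul_le i) 2
      rwa [div_pow, Real.sq_sqrt hp.β₂_pos.le, one_pow, mul_pow, sq_abs, ← mul_pow] at this
    have h2 : (h i * e i) ^ 2 ≤ 1 / p.lam ^ 2 * e i ^ 2 := by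
      rw [mul_pow]
      have := pow_le_pow_left₀ h0 (hs.h_le i) 2
      rw [div_pow, one_pow] at this
      gcongr
    rw [Real.norm_eq_abs, sq_abs, Real.norm_eq_abs, sq_abs, hs.apply_eq]
    have h3 : (-(p.η * (h i * (g i + e i)))) ^ 2
        ≤ p.η ^ 2 * (2 * (h i * g i) ^ 2 + 2 * (h i * e i) ^ 2) := by
      have : (-(p.η * (h i * (g i + e i)))) ^ 2 = p.η ^ 2 * (h i * g i + h i * e i) ^ 2 := by ring
      rw [this]
      gcongr
      linarith [sq_nonneg (h i * g i - h i * e i)]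
    refine h3.trans ?_
    calc p.η ^ 2 * (2 * (h i * g i) ^ 2 + 2 * (h i * e i) ^ 2)
        ≤ p.η ^ 2 * (2 * (1 / p.β₂) + 2 * (1 / p.lam ^ 2 * e i ^ 2)) := by gcongr
      _ = _ := by ring
  have hsq : ‖v‖ ^ 2 ≤ (2 * p.η * D) ^ 2 := by
    calc ‖v‖ ^ 2 = ∑ i, ‖v i‖ ^ 2 := EuclideanSpace.norm_sq_eq v
      _ ≤ ∑ i, (2 * p.η ^ 2 * (1 / p.β₂) + 2 * p.η ^ 2 / p.lam ^ 2 * ‖e i‖ ^ 2) :=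
          Finset.sum_le_sum fun i _ => hcoord i
      _ = 2 * p.η ^ 2 * D ^ 2 + 2 * p.η ^ 2 / p.lam ^ 2 * ‖e‖ ^ 2 := by
          rw [Finset.sum_add_distrib, ← Finset.mul_sum, ← Finset.mul_sum,
            ← EuclideanSpace.norm_sq_eq, hp.sq_D]
          rw [Finset.sum_const, Finset.card_univ, Fintype.card_fin, nsmul_eq_mul, mul_one_div]
      _ ≤ 2 * p.η ^ 2 * D ^ 2 + 2 * p.η ^ 2 / p.lam ^ 2 * (p.lam * D) ^ 2 := by gcongr
      _ = _ := by field_simp; ring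
  exact le_of_sq_le_sq hsq (by positivity)

/-- Only one of the two factors h is replaced by 1/λ. The other is kept, so that the bound is in
terms of the weighted gradient norm that the descent inequality supplies. -/
theorem IsScaledStep.sq_norm_le (hs : IsScaledStep p G g e v h) (hp : IsTuned d L σ G D p) :
    ‖v‖ ^ 2 ≤ 2 * p.η ^ 2 / p.lam * (∑ i, h i * g i ^ 2 + ‖e‖ ^ 2 / p.lam) := by
  have hlam := hp.lam_pos
  have hη := hp.η_pos
  rw [EuclideanSpace.norm_sq_eq v, EuclideanSpace.norm_sq_eq e, Finset.sum_div,
    ← Finset.sum_add_distrib, Finset.mul_sum]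
  refine Finset.sum_le_sum fun i _ => ?_
  have h0 := hs.h_nonneg hp.G_pos i
  have h1 := hs.h_le i
  rw [Real.norm_eq_abs, sq_abs, Real.norm_eq_abs, sq_abs, hs.apply_eq]
  have h3 : (-(p.η * (h i * (g i + e i)))) ^ 2
      ≤ 2 * p.η ^ 2 * (h i * (h i * (g i ^ 2 + e i ^ 2))) := by
    have : (-(p.η * (h i * (g i + e i)))) ^ 2 = p.η ^ 2 * (h i * (h i * (g i + e i) ^ 2)) := by ring
    rw [this, mul_comm 2, mul_assoc (p.η ^ 2), mul_left_comm 2, mul_left_comm 2]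
    gcongr
    linarith [sq_nonneg (g i - e i)]
  refine h3.trans ?_
  have h4 : h i * (g i ^ 2 + e i ^ 2) ≤ h i * g i ^ 2 + e i ^ 2 / p.lam := by
    have : h i * e i ^ 2 ≤ 1 / p.lam * e i ^ 2 := by gcongr
    rw [mul_add]
    have e1 : 1 / p.lam * e i ^ 2 = e i ^ 2 / p.lam := by ring
    linarith
  have h5 : 0 ≤ h i * (g i ^ 2 + e i ^ 2) := by positivity
  calc 2 * p.η ^ 2 * (h i * (h i * (g i ^ 2 + e i ^ 2)))
      ≤ 2 * p.η ^ 2 * (1 / p.lam * (h i * g i ^ 2 + e i ^ 2 / p.lam)) := by gcongr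
    _ = _ := by ring

/-- Polarization: -g(g + e) = -g²/2 + e²/2 - (g + e)²/2 in each coordinate, with the last square
dropped. -/
theorem IsScaledStep.inner_le (hs : IsScaledStep p G g e v h) (hp : IsTuned d L σ G D p) :
    inner ℝ g v ≤ -(p.η / 2) * (∑ i, h i * g i ^ 2) + p.η / (2 * p.lam) * ‖e‖ ^ 2 := by
  have hlam := hp.lam_pos
  have hη := hp.η_pos
  rw [EuclideanSpace.norm_sq_eq e, PiLp.inner_apply, Finset.mul_sum, Finset.mul_sum,
    ← Finset.sum_add_distrib]
  refine Finset.sum_le_sum fun i _ => ?_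
  have h0 := hs.h_nonneg hp.G_pos i
  have h1 := hs.h_le i
  rw [Real.norm_eq_abs, sq_abs, hs.apply_eq]
  have h2 : h i * e i ^ 2 ≤ 1 / p.lam * e i ^ 2 := by gcongr
  have h3 : 0 ≤ h i * (g i + e i) ^ 2 := by positivity
  have h4 : inner ℝ (g i) (-(p.η * (h i * (g i + e i))))
      = p.η * (-(1 / 2) * (h i * g i ^ 2) + 1 / 2 * (h i * e i ^ 2)
        - 1 / 2 * (h i * (g i + e i) ^ 2)) := by
    simp only [RCLike.inner_apply, conj_trivial]; ring
  rw [h4]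
  calc p.η * (-(1 / 2) * (h i * g i ^ 2) + 1 / 2 * (h i * e i ^ 2)
        - 1 / 2 * (h i * (g i + e i) ^ 2))
      ≤ p.η * (-(1 / 2) * (h i * g i ^ 2) + 1 / 2 * (1 / p.lam * e i ^ 2)) := by
        gcongr
        linarith
    _ = _ := by field_simp

theorem IsScaledStep.sq_norm_gradient_le (hs : IsScaledStep p G g e v h) (hG : 0 < G) :
    ‖g‖ ^ 2 ≤ 2 * G * ∑ i, h i * g i ^ 2 := by
  rw [EuclideanSpace.norm_sq_eq g, Finset.mul_sum]
  refine Finset.sum_le_sum fun i _ => ?_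
  have h1 := mul_le_mul_of_nonneg_right (hs.le_h i) (sq_nonneg (g i))
  rw [Real.norm_eq_abs, sq_abs]
  calc g i ^ 2 = 2 * G * (1 / (2 * G) * g i ^ 2) := by field_simp
    _ ≤ 2 * G * (h i * g i ^ 2) := by gcongr

/-- The reciprocals of `q + λ` are admissible scalings when `q` dominates `√β₂ |y|` for an estimate
`y` of the gradient. -/
theorem isScaledStep_of_denominator (hp : IsTuned d L σ G D p) {y : EuclideanSpace ℝ (Fin d)}
    (hy : ‖y - g‖ ≤ σ) {q : Fin d → ℝ} (hq0 : ∀ i, 0 ≤ q i) (hqy : ∀ i, √p.β₂ * |y i| ≤ q i)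
    (hqG : ∀ i, q i ≤ 3 / 2 * G)
    (hv : ∀ i, v i = -(p.η / (q i + p.lam) * (g i + e i))) :
    IsScaledStep p G g e v fun i => 1 / (q i + p.lam) := by
  have hlam := hp.lam_pos
  have hG := hp.G_pos
  have hpos : ∀ i, 0 < q i + p.lam := fun i => by linarith [hq0 i]
  have hsq : 0 < √p.β₂ := Real.sqrt_pos.2 hp.β₂_pos
  refine ⟨fun i => ?_, fun i => ?_, fun i => ?_, fun i => ?_⟩
  · rw [hv i]; ring
  · exact one_div_le_one_div_of_le (hpos i) (by linarith [hqG i, hp.lam_le])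
  · exact one_div_le_one_div_of_le hlam (by linarith [hq0 i])
  · rw [one_div_mul_eq_div, div_le_div_iff₀ (hpos i) hsq, one_mul]
    -- Replacing g by its estimate y costs √β₂ σ ≤ λ/2, which the λ in the denominator absorbs.
    have h1 : |y i - g i| ≤ σ := by
      have := PiLp.norm_apply_le (y - g) i
      simp only [PiLp.sub_apply, Real.norm_eq_abs] at this
      linarith
    have h2 : |g i| ≤ |y i| + σ := by
      have := abs_sub_abs_le_abs_sub (g i) (y i)
      rw [abs_sub_comm] at this
      linarith
    have h3 := mul_le_mul_of_nonneg_left h2 hsq.le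
    linarith [hqy i, hp.sqrt_le]

variable {L₀ Lρ ρ : ℝ} {U : Set (EuclideanSpace ℝ (Fin d))} {f : EuclideanSpace ℝ (Fin d) → ℝ}
  {x : EuclideanSpace ℝ (Fin d)}

/-- Descent in one step. -/
theorem IsScaledStep.descent (hs : IsScaledStep p G (gradient f x) e v h)
    (hp : IsTuned d L σ G D p) (hf : IsObjective U f) (hfs : IsGenSmoothOn U f L₀ Lρ ρ)
    (hL : IsEffSmooth L₀ Lρ ρ G L) (hxU : x ∈ U) (hx : ‖gradient f x‖ ≤ G)
    (he : ‖e‖ ≤ p.lam * D) :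
    f (x + v) ≤ f x - 3 / 8 * p.η * (∑ i, h i * gradient f x i ^ 2)
      + 5 / 8 * (p.η / p.lam) * ‖e‖ ^ 2 := by
  have hlam := hp.lam_pos
  have hη := hp.η_pos
  have hLpos := hp.L_pos
  have hGpos := hp.G_pos
  set Γ := ∑ i, h i * gradient f x i ^ 2 with hΓ
  have hΓ0 : 0 ≤ Γ := Finset.sum_nonneg fun i _ =>
    mul_nonneg (hs.h_nonneg hGpos i) (sq_nonneg _)
  have h1 := (abs_le.1 (hf.abs_sub_sub_inner_le hfs hL hxU (by linarith)
    (hp.step_le (hs.norm_le hp he)).1)).2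
  have h2 := hs.inner_le hp
  have h3 := hs.sq_norm_le hp
  rw [← hΓ] at h2 h3
  have h4 : L * ‖v‖ ^ 2 ≤ 1 / 8 * p.η * (Γ + ‖e‖ ^ 2 / p.lam) := by
    have h5 : L * (2 * p.η ^ 2 / p.lam) ≤ 1 / 8 * p.η := by
      rw [mul_div_assoc', div_le_iff₀ hlam]
      nlinarith [hp.η_le_lam]
    calc L * ‖v‖ ^ 2 ≤ L * (2 * p.η ^ 2 / p.lam * (Γ + ‖e‖ ^ 2 / p.lam)) := by gcongr
      _ = L * (2 * p.η ^ 2 / p.lam) * (Γ + ‖e‖ ^ 2 / p.lam) := by ring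
      _ ≤ _ := by gcongr
  have e1 : p.η / (2 * p.lam) * ‖e‖ ^ 2 = 1 / 2 * (p.η / p.lam) * ‖e‖ ^ 2 := by field_simp
  have e2 : 1 / 8 * p.η * (Γ + ‖e‖ ^ 2 / p.lam)
    = 1 / 8 * p.η * Γ + 1 / 8 * (p.η / p.lam) * ‖e‖ ^ 2 := by ring
  linarith

/-- At the last iterate the potential controls the gradient. -/
theorem IsScaledStep.sq_norm_gradient_le_potential (hs : IsScaledStep p G (gradient f x) e v h)
    (hp : IsTuned d L σ G D p) (hf : IsObjective U f) (hfs : IsGenSmoothOn U f L₀ Lρ ρ)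
    (hL : IsEffSmooth L₀ Lρ ρ G L) (hxU : x ∈ U) (hx : ‖gradient f x‖ ≤ G)
    (he : ‖e‖ ≤ p.lam * D) :
    p.η / (16 * G) * ‖gradient f x‖ ^ 2
      ≤ f x - sInf (f '' U) + p.η / (p.lam * p.β) * ‖e‖ ^ 2 := by
  have hlam := hp.lam_pos
  have hη := hp.η_pos
  have hGpos := hp.G_pos
  have hβ := hp.β_pos
  have h1 := hs.descent hp hf hfs hL hxU hx he
  -- The next point cannot lie below the infimum, so the guaranteed decrease is at most the present
  -- gap.
  have h2 := hf.gap_nonneg (hf.add_mem hfs hL hxU (by linarith)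
    (hp.step_le (hs.norm_le hp he)).1)
  have h3 := hs.sq_norm_gradient_le hGpos
  set Γ := ∑ i, h i * gradient f x i ^ 2 with hΓ
  have h4 : p.η / (16 * G) * ‖gradient f x‖ ^ 2 ≤ 1 / 8 * p.η * Γ := by
    calc p.η / (16 * G) * ‖gradient f x‖ ^ 2 ≤ p.η / (16 * G) * (2 * G * Γ) := by gcongr
      _ = _ := by field_simp; ring
  have hΓ0 : 0 ≤ p.η * Γ := mul_nonneg hη.le (Finset.sum_nonneg fun i _ =>
    mul_nonneg (hs.h_nonneg hGpos i) (sq_nonneg _))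
  have h5 : p.η / p.lam * ‖e‖ ^ 2 ≤ p.η / (p.lam * p.β) * ‖e‖ ^ 2 := by
    gcongr
    exact mul_le_of_le_one_right hlam.le hp.β_le_one
  have h6 : 0 ≤ p.η / p.lam * ‖e‖ ^ 2 := by positivity
  linarith

/-- The potential `f - inf f + a ‖e‖²` with `a = η / (λ β)` decreases in one step, up to a noise term
and a term that is linear in the innovation `W`. -/
theorem IsScaledStep.potential_le (hs : IsScaledStep p G (gradient f x) e v h)
    (hp : IsTuned d L σ G D p) (hf : IsObjective U f) (hfs : IsGenSmoothOn U f L₀ Lρ ρ)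
    (hL : IsEffSmooth L₀ Lρ ρ G L) (hxU : x ∈ U) (hx : ‖gradient f x‖ ≤ G)
    (he : ‖e‖ ≤ p.lam * D) {W : EuclideanSpace ℝ (Fin d)} (hW : ‖W‖ ≤ p.β * σ + 2 * L * ‖v‖) :
    f (x + v) + p.η / (p.lam * p.β) * ‖(1 - p.β) • e + W‖ ^ 2
      ≤ f x + p.η / (p.lam * p.β) * ‖e‖ ^ 2
        - (p.η / (16 * G) * ‖gradient f x‖ ^ 2 + p.lam / (16 * p.η) * ‖v‖ ^ 2)
        + 2 * p.η * p.β * σ ^ 2 / p.lam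
        + 2 * (p.η / (p.lam * p.β)) * (1 - p.β) * inner ℝ e W := by
  have hlam := hp.lam_pos
  have hη := hp.η_pos
  have hGpos := hp.G_pos
  have hLpos := hp.L_pos
  have hβ := hp.β_pos
  have hσ := hp.σ_nonneg
  have h1 := hs.descent hp hf hfs hL hxU hx he
  have h2 := hs.sq_norm_gradient_le hGpos
  have h3 := hs.sq_norm_le hp
  set Γ := ∑ i, h i * gradient f x i ^ 2 with hΓ
  have hΓ0 : 0 ≤ Γ := Finset.sum_nonneg fun i _ =>
    mul_nonneg (hs.h_nonneg hGpos i) (sq_nonneg _)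
  set a := p.η / (p.lam * p.β) with ha
  have ha0 : 0 < a := by positivity
  have haβ : a * p.β = p.η / p.lam := by rw [ha]; field_simp
  have hWsq : ‖W‖ ^ 2 ≤ 2 * p.β ^ 2 * σ ^ 2 + 8 * L ^ 2 * ‖v‖ ^ 2 := by
    have := pow_le_pow_left₀ (norm_nonneg _) hW 2
    nlinarith [sq_nonneg (p.β * σ - 2 * L * ‖v‖)]
  have hexp : ‖(1 - p.β) • e + W‖ ^ 2
      = (1 - p.β) ^ 2 * ‖e‖ ^ 2 + 2 * (1 - p.β) * inner ℝ e W + ‖W‖ ^ 2 := by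
    rw [norm_add_sq_real, norm_smul, inner_smul_left, mul_pow, Real.norm_eq_abs, sq_abs]
    simp; ring
  -- This is where the value of θ matters: it makes the effect of a step on the next squared error,
  -- weighted by a, at most a small multiple of λ/η times the squared step.
  have haL : a * (8 * L ^ 2) ≤ p.lam / (400 * p.η) := by
    have : a * (8 * L ^ 2) = p.lam ^ 2 / (200 * G * p.η) := by
      rw [ha, div_mul_eq_mul_div, div_eq_div_iff (by positivity) (by positivity)]
      have := hp.β_eq
      linear_combination -this
    rw [this, div_le_div_iff₀ (by positivity) (by positivity)]
    nlinarith [hp.lam_le, mul_pos hlam hη, mul_pos (mul_pos hlam hη) hlam]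
  have hV : (p.lam / (400 * p.η) + p.lam / (16 * p.η)) * ‖v‖ ^ 2
      ≤ 13 / 100 * p.η * (Γ + ‖e‖ ^ 2 / p.lam) := by
    calc (p.lam / (400 * p.η) + p.lam / (16 * p.η)) * ‖v‖ ^ 2
        ≤ (p.lam / (400 * p.η) + p.lam / (16 * p.η))
          * (2 * p.η ^ 2 / p.lam * (Γ + ‖e‖ ^ 2 / p.lam)) := by gcongr
      _ = _ := by field_simp; ring
  have hg : p.η / (16 * G) * ‖gradient f x‖ ^ 2 ≤ 1 / 8 * p.η * Γ := by
    calc p.η / (16 * G) * ‖gradient f x‖ ^ 2 ≤ p.η / (16 * G) * (2 * G * Γ) := by gcongr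
      _ = _ := by field_simp; ring
  -- The weight a is chosen so that aβ = η/λ: contraction of the error then removes η/λ ‖e‖², more
  -- than the 5/8 of it that descent costs.
  have hcontr : a * ((1 - p.β) ^ 2 * ‖e‖ ^ 2) ≤ a * ‖e‖ ^ 2 - p.η / p.lam * ‖e‖ ^ 2 := by
    have : (1 - p.β) ^ 2 ≤ 1 - p.β := by nlinarith [hp.β_le_one]
    calc a * ((1 - p.β) ^ 2 * ‖e‖ ^ 2) ≤ a * ((1 - p.β) * ‖e‖ ^ 2) := by gcongr
      _ = a * ‖e‖ ^ 2 - (a * p.β) * ‖e‖ ^ 2 := by ring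
      _ = _ := by rw [haβ]
  have haW : a * ‖W‖ ^ 2 ≤ 2 * p.η * p.β * σ ^ 2 / p.lam + p.lam / (400 * p.η) * ‖v‖ ^ 2 := by
    calc a * ‖W‖ ^ 2 ≤ a * (2 * p.β ^ 2 * σ ^ 2 + 8 * L ^ 2 * ‖v‖ ^ 2) := by gcongr
      _ = 2 * (a * p.β) * p.β * σ ^ 2 + a * (8 * L ^ 2) * ‖v‖ ^ 2 := by ring
      _ ≤ 2 * (a * p.β) * p.β * σ ^ 2 + p.lam / (400 * p.η) * ‖v‖ ^ 2 := by gcongr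
      _ = _ := by rw [haβ]; ring
  have e2 : 13 / 100 * p.η * (Γ + ‖e‖ ^ 2 / p.lam)
    = 13 / 100 * (p.η * Γ) + 13 / 100 * (p.η / p.lam * ‖e‖ ^ 2) := by ring
  have hη1 : 0 ≤ p.η * Γ := by positivity
  have hη2 : 0 ≤ p.η / p.lam * ‖e‖ ^ 2 := by positivity
  -- Budget: of 3/8 ηΓ, 1/8 pays for the gradient term and 13/100 for the squared steps; of η/λ
  -- ‖e‖², 5/8 goes to descent and 13/100 to the squared steps.
  rw [hexp]
  linarith

end Step

/-- A sixth moment inequality in an inner product space. -/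
theorem norm_add_pow_six_le {E : Type*} [NormedAddCommGroup E] [InnerProductSpace ℝ E] (w z : E) :
    ‖w + z‖ ^ 6 ≤ ‖w‖ ^ 6 + 6 * ‖w‖ ^ 4 * inner ℝ w z
      + 40 * (‖w‖ ^ 4 * ‖z‖ ^ 2 + ‖z‖ ^ 6) := by
  have h1 : ‖w + z‖ ^ 6 = (‖w‖ ^ 2 + (2 * inner ℝ w z + ‖z‖ ^ 2)) ^ 3 := by
    rw [← add_assoc, ← norm_add_sq_real]; ring
  have h2 : |inner ℝ w z| ≤ ‖w‖ * ‖z‖ := abs_real_inner_le_norm w z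
  have hx := norm_nonneg w
  have he := norm_nonneg z
  set x := ‖w‖
  set e := ‖z‖
  set I : ℝ := inner ℝ w z
  have h3 : |2 * I + e ^ 2| ≤ 2 * x * e + e ^ 2 := by
    refine (abs_add_le _ _).trans ?_
    rw [abs_mul, abs_of_pos (zero_lt_two' ℝ), abs_of_nonneg (sq_nonneg e)]
    linarith
  have hsq : (2 * I + e ^ 2) ^ 2 ≤ (2 * x * e + e ^ 2) ^ 2 := by
    rw [← sq_abs (2 * I + e ^ 2)]
    exact pow_le_pow_left₀ (abs_nonneg _) h3 2
  have hcb : (2 * I + e ^ 2) ^ 3 ≤ (2 * x * e + e ^ 2) ^ 3 :=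
    (Odd.strictMono_pow (by decide : Odd 3)).monotone ((le_abs_self _).trans h3)
  have hsq' := mul_le_mul_of_nonneg_left hsq (sq_nonneg x)
  have k1 : x ^ 3 * e ^ 3 ≤ 1 / 2 * (x ^ 4 * e ^ 2) + 1 / 2 * (x ^ 2 * e ^ 4) := by
    nlinarith [sq_nonneg (x * (x * e) - x * (e * e))]
  have k2 : x ^ 2 * e ^ 4 ≤ 1 / 2 * (x ^ 4 * e ^ 2) + 1 / 2 * e ^ 6 := by
    nlinarith [sq_nonneg (e * x ^ 2 - e ^ 3)]
  have k3 : x * e ^ 5 ≤ 1 / 2 * (x ^ 2 * e ^ 4) + 1 / 2 * e ^ 6 := by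
    nlinarith [sq_nonneg (e ^ 2 * x - e ^ 3)]
  have k4 : 0 ≤ x ^ 4 * e ^ 2 := by positivity
  have k5 : 0 ≤ e ^ 6 := by positivity
  rw [h1]
  -- The term 6x⁴I is kept exactly, because it is linear in the new noise and will integrate to
  -- zero; all other terms may be estimated in absolute value.
  have e1 : (x ^ 2 + (2 * I + e ^ 2)) ^ 3 = x ^ 6 + 6 * x ^ 4 * I + 3 * (x ^ 4 * e ^ 2)
      + 3 * (x ^ 2 * (2 * I + e ^ 2) ^ 2) + (2 * I + e ^ 2) ^ 3 := by ring
  have e2 : 3 * (x ^ 2 * (2 * x * e + e ^ 2) ^ 2) + (2 * x * e + e ^ 2) ^ 3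
      = 12 * (x ^ 4 * e ^ 2) + 20 * (x ^ 3 * e ^ 3) + 15 * (x ^ 2 * e ^ 4) + 6 * (x * e ^ 5)
        + e ^ 6 := by ring
  rw [e1]
  linarith

/-- The sixth power of the contracted sum `(1 - β) (w + z)`: the drift is absorbed by the
contraction. -/
theorem norm_smul_add_pow_six_le {E : Type*} [NormedAddCommGroup E] [InnerProductSpace ℝ E]
    (w z : E) {β q : ℝ} (hβ : 0 < β) (hβ1 : β ≤ 1) (hq : 0 ≤ q) (hz : ‖z‖ ^ 2 ≤ q) :
    ‖(1 - β) • (w + z)‖ ^ 6 ≤ ‖w‖ ^ 6 + 6 * (1 - β) ^ 6 * (‖w‖ ^ 4 * inner ℝ w z)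
      + 2 * 40 ^ 3 * (q / β) ^ 2 * q := by
  have h1 := norm_add_pow_six_le w z
  have hx := norm_nonneg w
  set x := ‖w‖
  set I : ℝ := inner ℝ w z
  have hz6 : ‖z‖ ^ 6 ≤ q ^ 3 := by
    calc ‖z‖ ^ 6 = (‖z‖ ^ 2) ^ 3 := by ring
      _ ≤ q ^ 3 := by gcongr
  -- Young's inequality y²t ≤ y³ + t³ with y = x² and t = 40q/β. The surplus βx⁶ is absorbed by (1 -
  -- β)⁶(1 + β) ≤ 1.
  have hyoung : 40 * (x ^ 4 * q) ≤ β * x ^ 6 + 40 ^ 3 * (q / β) ^ 2 * q := by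
    have hy2 : 0 ≤ β * x ^ 6 + 40 ^ 3 * (q / β) ^ 2 * q - 40 * (x ^ 4 * q) := by
      have hb : β * (q / β) = q := by field_simp
      set s := q / β with hs
      have hs0 : 0 ≤ s := by positivity
      rw [← hb]
      set y := x ^ 2 with hydef
      have hy0 : 0 ≤ y := sq_nonneg x
      have e3 : β * x ^ 6 + 40 ^ 3 * s ^ 2 * (β * s) - 40 * (x ^ 4 * (β * s))
          = β * (y ^ 3 + (40 * s) ^ 3 - y ^ 2 * (40 * s)) := by rw [hydef]; ring
      rw [e3]
      refine mul_nonneg hβ.le ?_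
      have ht : 0 ≤ 40 * s := by positivity
      set t := 40 * s
      nlinarith [mul_nonneg hy0 (sq_nonneg (y - t)), mul_nonneg ht (sq_nonneg (y - t)),
        mul_nonneg hy0 (sq_nonneg t), pow_nonneg ht 3, pow_nonneg hy0 3]
    linarith
  have hq3 : 40 * q ^ 3 ≤ 40 ^ 3 * (q / β) ^ 2 * q := by
    have : q ≤ q / β := by rw [le_div_iff₀ hβ]; exact mul_le_of_le_one_right hq hβ1
    have h2 : q ^ 2 ≤ (q / β) ^ 2 := pow_le_pow_left₀ hq this 2
    have h3 := mul_le_mul_of_nonneg_right h2 hq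
    have h4 : 0 ≤ (q / β) ^ 2 * q := by positivity
    nlinarith
  have h2 : ‖w + z‖ ^ 6 ≤ (1 + β) * x ^ 6 + 6 * (x ^ 4 * I) + 2 * 40 ^ 3 * (q / β) ^ 2 * q := by
    have : x ^ 4 * ‖z‖ ^ 2 ≤ x ^ 4 * q := by gcongr
    linarith
  have hb0 : 0 ≤ 1 - β := by linarith
  have hb6 : (1 - β) ^ 6 ≤ 1 := pow_le_one₀ hb0 (by linarith)
  have hb : (1 - β) ^ 6 * (1 + β) ≤ 1 := by
    have h3 : (1 - β) * (1 + β) ≤ 1 := by nlinarith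
    have h4 : (1 - β) ^ 5 ≤ 1 := pow_le_one₀ hb0 (by linarith)
    calc (1 - β) ^ 6 * (1 + β) = (1 - β) ^ 5 * ((1 - β) * (1 + β)) := by ring
      _ ≤ 1 * 1 := by gcongr
      _ = 1 := one_mul 1
  rw [norm_smul, mul_pow, Real.norm_of_nonneg hb0]
  have h5 := mul_le_mul_of_nonneg_left h2 (pow_nonneg hb0 6)
  have h6 : (1 - β) ^ 6 * (2 * 40 ^ 3 * (q / β) ^ 2 * q) ≤ 2 * 40 ^ 3 * (q / β) ^ 2 * q :=
    mul_le_of_le_one_left (by positivity) hb6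
  have h7 : (1 - β) ^ 6 * (1 + β) * x ^ 6 ≤ x ^ 6 := mul_le_of_le_one_left (by positivity) hb
  linarith

/-! ### Trajectories inside the domain -/

section Trajectory

variable {d : ℕ} {Ξ : Type*}

/-- The stochastic gradient, set to zero outside the domain. -/
noncomputable def domGrad (U : Set (EuclideanSpace ℝ (Fin d))) (F : EuclideanSpace ℝ (Fin d) → Ξ → ℝ)
    (x : EuclideanSpace ℝ (Fin d)) (s : Ξ) : EuclideanSpace ℝ (Fin d) :=
  U.indicator (fun y => stochGrad F y s) x

/-- The noise of the stochastic gradient, set to zero outside the domain. -/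
noncomputable def domNoise (U : Set (EuclideanSpace ℝ (Fin d))) (f : EuclideanSpace ℝ (Fin d) → ℝ)
    (F : EuclideanSpace ℝ (Fin d) → Ξ → ℝ) (x : EuclideanSpace ℝ (Fin d)) (s : Ξ) :
    EuclideanSpace ℝ (Fin d) :=
  U.indicator (fun y => stochGrad F y s - gradient f y) x

variable {U : Set (EuclideanSpace ℝ (Fin d))} {f : EuclideanSpace ℝ (Fin d) → ℝ}
  {F : EuclideanSpace ℝ (Fin d) → Ξ → ℝ} {x₁ : EuclideanSpace ℝ (Fin d)} {p : VRAdamInput}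
  {ζ : Fin p.S₁ → Ξ} {ξ : ℕ → Ξ} {L₀ Lρ ρ L σ G D : ℝ}

theorem domGrad_eq {x : EuclideanSpace ℝ (Fin d)} (hx : x ∈ U) (s : Ξ) :
    domGrad U F x s = domNoise U f F x s + gradient f x := by
  simp [domGrad, domNoise, hx]

/-- The state of VRAdam run with gradients that are set to zero outside the domain. -/
noncomputable abbrev domState (U : Set (EuclideanSpace ℝ (Fin d)))
    (F : EuclideanSpace ℝ (Fin d) → Ξ → ℝ) (x₁ : EuclideanSpace ℝ (Fin d)) (p : VRAdamInput)
    (ζ : Fin p.S₁ → Ξ) (ξ : ℕ → Ξ) (k : ℕ) : VRAdamState d :=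
  vrAdamState p (domGrad U F) x₁ ζ ξ k

/-- The part of the estimation error `m - ∇f(x)` that comes from the differences of noises at
consecutive iterates. -/
noncomputable def domCorrection (U : Set (EuclideanSpace ℝ (Fin d)))
    (f : EuclideanSpace ℝ (Fin d) → ℝ) (F : EuclideanSpace ℝ (Fin d) → Ξ → ℝ)
    (x₁ : EuclideanSpace ℝ (Fin d)) (p : VRAdamInput) (ζ : Fin p.S₁ → Ξ) (ξ : ℕ → Ξ) :
    ℕ → EuclideanSpace ℝ (Fin d)
  | 0 => 0
  | k + 1 => (1 - p.β) • (domCorrection U f F x₁ p ζ ξ k +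
      (domNoise U f F (domState U F x₁ p ζ ξ (k + 1)).x (ξ (k + 2))
        - domNoise U f F (domState U F x₁ p ζ ξ k).x (ξ (k + 2))))

/-- If the run with truncated gradients stays in the domain, then it is the actual run. -/
theorem vrAdamState_eq_domState {n : ℕ} (h : ∀ k ≤ n, (domState U F x₁ p ζ ξ k).x ∈ U) :
    ∀ k ≤ n, vrAdamState p (stochGrad F) x₁ ζ ξ k = domState U F x₁ p ζ ξ k := by
  have hd : ∀ {x : EuclideanSpace ℝ (Fin d)} (s : Ξ), x ∈ U → domGrad U F x s = stochGrad F x s :=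
    fun s hx => by simp [domGrad, hx]
  intro k hk
  induction k with
  | zero =>
    have hx : x₁ ∈ U := h 0 hk
    simp only [domState, vrAdamState, vrAdamInit, hd _ hx]
  | succ k ih =>
    have h1 : (domState U F x₁ p ζ ξ k).x ∈ U := h k (by omega)
    have h2 : (domState U F x₁ p ζ ξ k).xNext ∈ U := h (k + 1) hk
    have ih' := ih (by omega)
    simp only [domState] at ih' h1 h2 ⊢
    rw [vrAdamState, vrAdamState, ih']
    simp only [vrAdamStep, hd _ h1, hd _ h2]

/-- The standing assumptions, with effective smoothness constant `L` and tuned parameters. -/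
structure IsTunedProblem (U : Set (EuclideanSpace ℝ (Fin d))) (f : EuclideanSpace ℝ (Fin d) → ℝ)
    (F : EuclideanSpace ℝ (Fin d) → Ξ → ℝ) (L₀ Lρ ρ L σ G D : ℝ) (p : VRAdamInput) : Prop where
  objective : IsObjective U f
  smooth : IsGenSmoothOn U f L₀ Lρ ρ
  smooth_component : ∀ s, IsGenSmoothOn U (fun x => F x s) L₀ Lρ ρ
  effSmooth : IsEffSmooth L₀ Lρ ρ G L
  tuned : IsTuned d L σ G D p

/-- The noise along the trajectory does not exceed `σ`. -/
structure IsNoiseBounded (U : Set (EuclideanSpace ℝ (Fin d))) (f : EuclideanSpace ℝ (Fin d) → ℝ)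
    (F : EuclideanSpace ℝ (Fin d) → Ξ → ℝ) (x₁ : EuclideanSpace ℝ (Fin d)) (σ : ℝ) (p : VRAdamInput)
    (ζ : Fin p.S₁ → Ξ) (ξ : ℕ → Ξ) : Prop where
  batch : ‖(domState U F x₁ p ζ ξ 0).m - gradient f x₁‖ ≤ σ
  sample : ∀ k, k + 2 ≤ p.T → ‖domNoise U f F (domState U F x₁ p ζ ξ (k + 1)).x (ξ (k + 2))‖ ≤ σ
  sample_prev : ∀ k, k + 2 ≤ p.T → ‖domNoise U f F (domState U F x₁ p ζ ξ k).x (ξ (k + 2))‖ ≤ σ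

/-- Up to iteration `k + 1` the iterates stay in the domain, and neither the suboptimality gap nor
the correction has become large. -/
def IsAlive (U : Set (EuclideanSpace ℝ (Fin d))) (f : EuclideanSpace ℝ (Fin d) → ℝ)
    (F : EuclideanSpace ℝ (Fin d) → Ξ → ℝ) (x₁ : EuclideanSpace ℝ (Fin d)) (L G D : ℝ)
    (p : VRAdamInput) (ζ : Fin p.S₁ → Ξ) (ξ : ℕ → Ξ) (k : ℕ) : Prop :=
  ∀ j ≤ k, (domState U F x₁ p ζ ξ j).x ∈ U ∧
    f (domState U F x₁ p ζ ξ j).x - sInf (f '' U) ≤ G ^ 2 / (6 * L) ∧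
    ‖domCorrection U f F x₁ p ζ ξ j‖ ≤ p.lam * D / 2

/-- What holds at the end of iteration `k + 1`, in the state `s` and with correction `w`. -/
structure IsRegularState (U : Set (EuclideanSpace ℝ (Fin d))) (f : EuclideanSpace ℝ (Fin d) → ℝ)
    (σ G D : ℝ) (p : VRAdamInput) (k : ℕ) (s : VRAdamState d) (w : EuclideanSpace ℝ (Fin d)) :
    Prop where
  mem : s.x ∈ U
  gradient_le : ‖gradient f s.x‖ ≤ G
  error_sub_le : ‖s.m - gradient f s.x - w‖ ≤ σ
  error_le : ‖s.m - gradient f s.x‖ ≤ p.lam * D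
  v_nonneg : ∀ i, 0 ≤ s.v i
  v_le : ∀ i, s.v i ≤ (1 - (1 - p.β₂) ^ (k + 1)) * (3 / 2 * G) ^ 2
  exists_scaling : ∃ h, IsScaledStep p G (gradient f s.x) (s.m - gradient f s.x) (s.xNext - s.x) h

/-- Both the objective and the component have an L-Lipschitz gradient near x: the component's
gradient there is at most G + σ ≤ 3/2 G. -/
theorem norm_noise_sub_le (hP : IsTunedProblem U f F L₀ Lρ ρ L σ G D p)
    {x v : EuclideanSpace ℝ (Fin d)} {s : Ξ} (hx : x ∈ U) (hg : ‖gradient f x‖ ≤ G)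
    (hv : ‖v‖ ≤ 2 * p.η * D) (hn : ‖domNoise U f F x s‖ ≤ σ) :
    ‖domNoise U f F (x + v) s - domNoise U f F x s‖ ≤ 2 * L * ‖v‖ := by
  have hG := hP.tuned.G_pos
  have hv' := (hP.tuned.step_le hv).1
  have hxv : x + v ∈ U := hP.objective.add_mem hP.smooth hP.effSmooth hx (by linarith) hv'
  have h1 := hP.objective.norm_gradient_sub_le hP.smooth hP.smooth hP.effSmooth hx (by linarith)
    (by linarith) hv'
  have hF : ‖gradient (fun y => F y s) x‖ ≤ 3 / 2 * G := by
    have e1 : gradient (fun y => F y s) x = domNoise U f F x s + gradient f x := by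
      rw [← domGrad_eq hx]; simp [domGrad, hx, stochGrad]
    rw [e1]
    refine (norm_add_le _ _).trans ?_
    linarith [hP.tuned.σ_le_G]
  have h2 := hP.objective.norm_gradient_sub_le hP.smooth (hP.smooth_component s) hP.effSmooth hx
    (by linarith) hF hv'
  have e2 : domNoise U f F (x + v) s - domNoise U f F x s
      = (gradient (fun y => F y s) (x + v) - gradient (fun y => F y s) x)
        - (gradient f (x + v) - gradient f x) := by
    simp only [domNoise, hx, hxv, Set.indicator_of_mem, stochGrad]; abel
  rw [e2]
  refine (norm_sub_le _ _).trans ?_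
  linarith

/-! ### One iteration from a regular state -/

section Transition

variable {k : ℕ} {s : VRAdamState d} {w : EuclideanSpace ℝ (Fin d)}

theorem IsRegularState.norm_step_le (hs : IsRegularState U f σ G D p k s w)
    (hP : IsTunedProblem U f F L₀ Lρ ρ L σ G D p) : ‖s.xNext - s.x‖ ≤ 2 * p.η * D := by
  obtain ⟨h, hh⟩ := hs.exists_scaling
  exact hh.norm_le hP.tuned hs.error_le

theorem IsRegularState.xNext_mem (hs : IsRegularState U f σ G D p k s w)
    (hP : IsTunedProblem U f F L₀ Lρ ρ L σ G D p) : s.xNext ∈ U := by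
  have h := hP.objective.add_mem hP.smooth hP.effSmooth hs.mem
    (hs.gradient_le.trans (by linarith [hP.tuned.G_pos])) (hP.tuned.step_le (hs.norm_step_le hP)).1
  simpa using h

theorem IsRegularState.norm_gradient_xNext_le (hs : IsRegularState U f σ G D p k s w)
    (hP : IsTunedProblem U f F L₀ Lρ ρ L σ G D p) : ‖gradient f s.xNext‖ ≤ 3 / 2 * G := by
  have hG := hP.tuned.G_pos
  have hst := hP.tuned.step_le (hs.norm_step_le hP)
  have h1 := hP.objective.norm_gradient_sub_le hP.smooth hP.smooth hP.effSmooth hs.mem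
    (hs.gradient_le.trans (by linarith)) (hs.gradient_le.trans (by linarith)) hst.1
  rw [add_sub_cancel] at h1
  have h2 := norm_le_norm_add_norm_sub' (gradient f s.xNext) (gradient f s.x)
  linarith [hs.gradient_le]

/-- The recursion of the estimation error. -/
theorem error_step_eq (hx : s.x ∈ U) (hx' : s.xNext ∈ U) (y : Ξ) :
    (vrAdamStep p (domGrad U F) (k + 2) s y).m - gradient f s.xNext
      = (1 - p.β) • (s.m - gradient f s.x)
        + (domNoise U f F s.xNext y - (1 - p.β) • domNoise U f F s.x y) := by
  simp only [vrAdamStep, domGrad_eq (f := f) hx, domGrad_eq (f := f) hx']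
  module

theorem IsRegularState.potential_step_le (hs : IsRegularState U f σ G D p k s w)
    (hP : IsTunedProblem U f F L₀ Lρ ρ L σ G D p) {y : Ξ} (hn : ‖domNoise U f F s.x y‖ ≤ σ)
    (hn' : ‖domNoise U f F s.xNext y‖ ≤ σ) :
    f s.xNext + p.η / (p.lam * p.β)
        * ‖(vrAdamStep p (domGrad U F) (k + 2) s y).m - gradient f s.xNext‖ ^ 2
      ≤ f s.x + p.η / (p.lam * p.β) * ‖s.m - gradient f s.x‖ ^ 2
        - (p.η / (16 * G) * ‖gradient f s.x‖ ^ 2 + p.lam / (16 * p.η) * ‖s.xNext - s.x‖ ^ 2)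
        + 2 * p.η * p.β * σ ^ 2 / p.lam
        + 2 * (p.η / (p.lam * p.β)) * (1 - p.β) * inner ℝ (s.m - gradient f s.x)
          (domNoise U f F s.xNext y - (1 - p.β) • domNoise U f F s.x y) := by
  obtain ⟨h, hh⟩ := hs.exists_scaling
  rw [error_step_eq hs.mem (hs.xNext_mem hP)]
  have key := hh.potential_le hP.tuned hP.objective hP.smooth hP.effSmooth hs.mem hs.gradient_le
    hs.error_le (W := domNoise U f F s.xNext y - (1 - p.β) • domNoise U f F s.x y) ?_
  · rwa [add_sub_cancel] at key
  -- The innovation is regrouped into β times fresh noise, at most βσ, and a difference of noises at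
  -- neighbouring points, at most 2L times the step.
  · have e1 : domNoise U f F s.xNext y - (1 - p.β) • domNoise U f F s.x y
        = p.β • domNoise U f F s.xNext y
          + (1 - p.β) • (domNoise U f F s.xNext y - domNoise U f F s.x y) := by module
    have h1 := norm_noise_sub_le hP hs.mem hs.gradient_le (hs.norm_step_le hP) hn
    rw [add_sub_cancel] at h1
    have hβ := hP.tuned.β_pos
    have hβ1 := hP.tuned.β_le_one
    rw [e1]
    refine (norm_add_le _ _).trans ?_
    rw [norm_smul, norm_smul, Real.norm_of_nonneg hβ.le, Real.norm_of_nonneg (by linarith)]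
    refine add_le_add (mul_le_mul_of_nonneg_left hn' hβ.le) ?_
    exact (mul_le_of_le_one_left (norm_nonneg _) (by linarith)).trans h1

/-- With q = 4L²·(step)², the remainder is a multiple of (q/β)²q. The factor (q/β)² is bounded
through the maximal step length 2ηD and the definition of β; the last q keeps the squared step,
which is summable. -/
theorem IsRegularState.correction_step_le (hs : IsRegularState U f σ G D p k s w)
    (hP : IsTunedProblem U f F L₀ Lρ ρ L σ G D p) {y : Ξ} (hn : ‖domNoise U f F s.x y‖ ≤ σ) :
    ‖(1 - p.β) • (w + (domNoise U f F s.xNext y - domNoise U f F s.x y))‖ ^ 6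
      ≤ ‖w‖ ^ 6 + 6 * (1 - p.β) ^ 6
          * (‖w‖ ^ 4 * inner ℝ w (domNoise U f F s.xNext y - domNoise U f F s.x y))
        + 2 * 40 ^ 3 * (D ^ 2 * p.lam ^ 3 / (100 * G)) ^ 2 * (4 * L ^ 2)
          * ‖s.xNext - s.x‖ ^ 2 := by
  have hG := hP.tuned.G_pos
  have hβ := hP.tuned.β_pos
  have hη := hP.tuned.η_pos
  have hL := hP.tuned.L_pos
  have h1 := norm_noise_sub_le hP hs.mem hs.gradient_le (hs.norm_step_le hP) hn
  rw [add_sub_cancel] at h1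
  have h2 : ‖domNoise U f F s.xNext y - domNoise U f F s.x y‖ ^ 2
      ≤ 4 * L ^ 2 * ‖s.xNext - s.x‖ ^ 2 := by
    calc _ ≤ (2 * L * ‖s.xNext - s.x‖) ^ 2 := pow_le_pow_left₀ (norm_nonneg _) h1 2
      _ = _ := by ring
  refine (norm_smul_add_pow_six_le w _ hβ hP.tuned.β_le_one (by positivity) h2).trans ?_
  have h3 : 4 * L ^ 2 * ‖s.xNext - s.x‖ ^ 2 / p.β ≤ D ^ 2 * p.lam ^ 3 / (100 * G) := by
    rw [div_le_div_iff₀ hβ (by positivity)]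
    calc 4 * L ^ 2 * ‖s.xNext - s.x‖ ^ 2 * (100 * G)
        ≤ 4 * L ^ 2 * (2 * p.η * D) ^ 2 * (100 * G) := by
          gcongr
          exact hs.norm_step_le hP
      _ = D ^ 2 * (1600 * L ^ 2 * G * p.η ^ 2) := by ring
      _ = D ^ 2 * p.lam ^ 3 * p.β := by rw [← hP.tuned.β_eq]; ring
  have h4 : (4 * L ^ 2 * ‖s.xNext - s.x‖ ^ 2 / p.β) ^ 2 ≤ (D ^ 2 * p.lam ^ 3 / (100 * G)) ^ 2 :=
    pow_le_pow_left₀ (by positivity) h3 2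
  have h5 : 2 * 40 ^ 3 * (4 * L ^ 2 * ‖s.xNext - s.x‖ ^ 2 / p.β) ^ 2
      * (4 * L ^ 2 * ‖s.xNext - s.x‖ ^ 2)
      ≤ 2 * 40 ^ 3 * (D ^ 2 * p.lam ^ 3 / (100 * G)) ^ 2 * (4 * L ^ 2 * ‖s.xNext - s.x‖ ^ 2) := by
    gcongr
  linarith

end Transition

theorem IsAlive.mono {k l : ℕ} (h : IsAlive U f F x₁ L G D p ζ ξ l) (hkl : k ≤ l) :
    IsAlive U f F x₁ L G D p ζ ξ k := fun j hj => h j (hj.trans hkl)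

/-- As long as it is alive, a trajectory with bounded noise is regular. -/
theorem IsAlive.isRegularState (hP : IsTunedProblem U f F L₀ Lρ ρ L σ G D p)
    (hx₁ : ‖gradient f x₁‖ ≤ G) (hn : IsNoiseBounded U f F x₁ σ p ζ ξ) {k : ℕ} (hk : k + 1 ≤ p.T)
    (ha : IsAlive U f F x₁ L G D p ζ ξ k) :
    IsRegularState U f σ G D p k (domState U F x₁ p ζ ξ k) (domCorrection U f F x₁ p ζ ξ k) := by
  have hT := hP.tuned
  have hG := hT.G_pos
  have hL := hT.L_pos
  have hσD := hT.σ_le_D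
  have hσG := hT.σ_le_G
  have hβ₂ := hT.β₂_pos
  have hβ₂1 := hT.β₂_le_one
  have hsq1 : √p.β₂ ≤ 1 := Real.sqrt_le_iff.2 ⟨zero_le_one, by simpa using hβ₂1⟩
  have herr : ∀ {e w : EuclideanSpace ℝ (Fin d)}, ‖e - w‖ ≤ σ → ‖w‖ ≤ p.lam * D / 2 →
      ‖e‖ ≤ p.lam * D := fun {e w} h1 h2 => by
    have := norm_le_norm_add_norm_sub' e w
    linarith
  have hcoord : ∀ {y g : EuclideanSpace ℝ (Fin d)}, ‖y - g‖ ≤ σ → ‖g‖ ≤ G → ∀ i, |y i| ≤ 3 / 2 * G :=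
    fun {y g} h1 h2 i => by
      have h3 := norm_le_norm_add_norm_sub' y g
      have h4 := PiLp.norm_apply_le y i
      rw [Real.norm_eq_abs] at h4
      linarith
  induction k with
  | zero =>
    obtain ⟨hmem, -, hw⟩ := ha 0 le_rfl
    have hb := hn.batch
    set s := domState U F x₁ p ζ ξ 0 with hs
    have hsx : s.x = x₁ := rfl
    have hv : ∀ i, s.v i = p.β₂ * s.m i ^ 2 := fun i => rfl
    have hxN : ∀ i, s.xNext i = s.x i - p.η * s.m i / (|s.m i| + p.lam) := fun i => rfl
    have hu : ‖s.m - gradient f s.x - domCorrection U f F x₁ p ζ ξ 0‖ ≤ σ := by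
      rw [domCorrection, sub_zero]; exact hb
    refine ⟨hmem, hx₁, hu, herr hu hw, fun i => ?_, fun i => ?_, ?_⟩
    · rw [hv]; positivity
    · rw [hv, zero_add, pow_one, sub_sub_cancel, ← sq_abs]
      have := hcoord hb hx₁ i
      gcongr
    -- The first iteration divides by |m₁| + λ, so m₁ itself serves as the gradient estimate.
    · refine ⟨_, isScaledStep_of_denominator hT (y := s.m) (q := fun i => |s.m i|) hb
        (fun i => abs_nonneg _) (fun i => mul_le_of_le_one_left (abs_nonneg _) hsq1)
        (hcoord hb hx₁) fun i => ?_⟩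
      simp only [PiLp.sub_apply, hxN, hsx]
      ring
  | succ k ih =>
    have hreg := ih (by omega) (ha.mono (Nat.le_succ k))
    obtain ⟨hmem, hgap, hw⟩ := ha (k + 1) le_rfl
    have hn1 := hn.sample k (by omega)
    have hn2 := hn.sample_prev k (by omega)
    set s := domState U F x₁ p ζ ξ k with hs
    set s' := domState U F x₁ p ζ ξ (k + 1) with hs'
    set y := ξ (k + 2) with hy
    have hstep : s' = vrAdamStep p (domGrad U F) (k + 2) s y := rfl
    have hsx : s'.x = s.xNext := rfl
    -- Smoothness of one step gives the a priori bound 3/2 G; with it the gap controls the gradient,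
    -- and the bound on the gap improves this to G.
    have hgr : ‖gradient f s'.x‖ ≤ G := by
      have h1 := hP.objective.sq_norm_gradient_le hP.smooth hP.effSmooth hmem
        (hreg.norm_gradient_xNext_le hP)
      refine le_of_sq_le_sq ?_ hG.le
      refine h1.trans ?_
      calc 6 * L * (f s'.x - sInf (f '' U)) ≤ 6 * L * (G ^ 2 / (6 * L)) := by gcongr
        _ = G ^ 2 := by field_simp
    -- The error minus the correction satisfies u' = (1 - β)u + β·noise, a convex combination of
    -- vectors of norm at most σ.
    have hu : ‖s'.m - gradient f s'.x - domCorrection U f F x₁ p ζ ξ (k + 1)‖ ≤ σ := by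
      have e1 : s'.m - gradient f s'.x - domCorrection U f F x₁ p ζ ξ (k + 1)
          = (1 - p.β) • (s.m - gradient f s.x - domCorrection U f F x₁ p ζ ξ k)
            + p.β • domNoise U f F s'.x y := by
        rw [hsx, hstep, error_step_eq hreg.mem (hreg.xNext_mem hP), domCorrection]
        change _ - (1 - p.β) • (_ + (domNoise U f F s.xNext y - domNoise U f F s.x y)) = _
        module
      have hβ := hT.β_pos
      have hβ1 := hT.β_le_one
      rw [e1]
      refine (norm_add_le _ _).trans ?_
      rw [norm_smul, norm_smul, Real.norm_of_nonneg hβ.le, Real.norm_of_nonneg (by linarith)]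
      have h1 := mul_le_mul_of_nonneg_left hreg.error_sub_le (by linarith : 0 ≤ 1 - p.β)
      have h2 := mul_le_mul_of_nonneg_left hn1 hβ.le
      linarith
    have hyg : ‖domGrad U F s'.x y - gradient f s'.x‖ ≤ σ := by
      rw [domGrad_eq (f := f) hmem, add_sub_cancel_right]; exact hn1
    have hv : ∀ i, s'.v i = (1 - p.β₂) * s.v i + p.β₂ * domGrad U F s'.x y i ^ 2 := fun i => rfl
    have hxN : ∀ i, s'.xNext i
        = s'.x i - p.η / (√(s'.v i / (1 - (1 - p.β₂) ^ (k + 2))) + p.lam) * s'.m i := fun i => rfl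
    have hpow : (1 - p.β₂) ^ (k + 2) < 1 := by
      calc (1 - p.β₂) ^ (k + 2) ≤ 1 - p.β₂ := by
            have := pow_le_pow_of_le_one (by linarith : 0 ≤ 1 - p.β₂) (by linarith)
              (by omega : 1 ≤ k + 2)
            rwa [pow_one] at this
        _ < 1 := by linarith
    have hpow0 : 0 ≤ (1 - p.β₂) ^ (k + 2) := pow_nonneg (by linarith) _
    have hvnn : ∀ i, 0 ≤ s'.v i := fun i => by
      rw [hv]
      have := hreg.v_nonneg i
      have : 0 ≤ 1 - p.β₂ := by linarith
      positivity
    -- The weights in v_t sum to 1 - (1 - β₂)^t with t = k + 2, which is the bias correction in the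
    -- denominator of v̂_t; hence √v̂_t ≤ 3/2 G.
    have hvle : ∀ i, s'.v i ≤ (1 - (1 - p.β₂) ^ (k + 1 + 1)) * (3 / 2 * G) ^ 2 := fun i => by
      rw [hv]
      have h1 := mul_le_mul_of_nonneg_left (hreg.v_le i) (by linarith : 0 ≤ 1 - p.β₂)
      have h2 : domGrad U F s'.x y i ^ 2 ≤ (3 / 2 * G) ^ 2 := by
        rw [← sq_abs]
        exact pow_le_pow_left₀ (abs_nonneg _) (hcoord hyg hgr i) 2
      have h3 := mul_le_mul_of_nonneg_left h2 hβ₂.le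
      have e1 : (1 - p.β₂) ^ (k + 1 + 1) = (1 - p.β₂) ^ (k + 1) * (1 - p.β₂) := pow_succ _ _
      rw [e1]
      linarith
    refine ⟨hmem, hgr, hu, herr hu hw, hvnn, hvle, ?_⟩
    refine ⟨_, isScaledStep_of_denominator hT (y := domGrad U F s'.x y)
      (q := fun i => √(s'.v i / (1 - (1 - p.β₂) ^ (k + 2)))) hyg (fun i => Real.sqrt_nonneg _)
      (fun i => ?_) (fun i => ?_) fun i => ?_⟩
    -- The lower bound v̂_t ≥ v_t ≥ β₂ times the newest squared stochastic gradient: the bias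
    -- correction divides by at most 1.
    · rw [← Real.sqrt_sq_eq_abs, ← Real.sqrt_mul hβ₂.le]
      refine Real.sqrt_le_sqrt ?_
      rw [le_div_iff₀ (by linarith)]
      have h1 : p.β₂ * domGrad U F s'.x y i ^ 2 ≤ s'.v i := by
        rw [hv]
        have := mul_nonneg (by linarith : 0 ≤ 1 - p.β₂) (hreg.v_nonneg i)
        linarith
      exact (mul_le_of_le_one_right (by positivity) (by linarith)).trans h1
    · rw [Real.sqrt_le_left (by positivity), div_le_iff₀ (by linarith), mul_comm]
      exact hvle i
    · simp only [PiLp.sub_apply, hxN]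
      ring

end Trajectory

/-! ### Measurability and independence along the trajectory -/

/-- A function that is continuous in `x ∈ U` and measurable in `s` is jointly measurable, once it is
set to zero outside `U`. -/
theorem measurable_indicator_uncurry {E E' Ξ : Type*} [TopologicalSpace E]
    [TopologicalSpace.MetrizableSpace E] [SecondCountableTopology E] [MeasurableSpace E]
    [BorelSpace E] [TopologicalSpace E'] [TopologicalSpace.PseudoMetrizableSpace E']
    [MeasurableSpace E'] [BorelSpace E'] [Zero E'] [MeasurableSpace Ξ] {U : Set E}
    (hU : MeasurableSet U) {u : E → Ξ → E'} (hc : ∀ s, ContinuousOn (fun x => u x s) U)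
    (hm : ∀ x ∈ U, Measurable (u x)) :
    Measurable fun z : E × Ξ => U.indicator (fun y => u y z.2) z.1 := by
  classical
  -- A Carathéodory function on the subtype U is jointly measurable; the extension by zero is then
  -- glued along U.
  have h1 : Measurable (Function.uncurry fun (x : U) (s : Ξ) => u x s) :=
    measurable_uncurry_of_continuous_of_measurable
      (fun s => continuousOn_iff_continuous_domRestrict.1 (hc s)) fun x => hm x x.2
  have hs : MeasurableSet {z : E × Ξ | z.1 ∈ U} := measurable_fst hU
  have h2 : Measurable fun z : {z : E × Ξ | z.1 ∈ U} =>
      Function.uncurry (fun (x : U) (s : Ξ) => u x s) (⟨z.1.1, z.2⟩, z.1.2) := by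
    refine h1.comp (Measurable.prodMk ?_ (measurable_snd.comp measurable_subtype_coe))
    exact (measurable_fst.comp measurable_subtype_coe).subtype_mk
  have h3 := Measurable.dite h2 (g := fun _ => (0 : E')) measurable_const hs
  convert h3 using 2 with z
  by_cases hz : z.1 ∈ U <;> simp [hz]

theorem ContinuousOn.measurable_indicator {E E' : Type*} [TopologicalSpace E] [MeasurableSpace E]
    [BorelSpace E] [TopologicalSpace E'] [MeasurableSpace E'] [BorelSpace E'] [Zero E'] {U : Set E}
    {u : E → E'} (hu : ContinuousOn u U) (hU : MeasurableSet U) : Measurable (U.indicator u) := by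
  classical
  rw [← Set.piecewise_eq_indicator]
  exact hu.measurable_piecewise continuousOn_const hU

section Measurability

variable {d : ℕ} {Ξ : Type*} [MeasurableSpace Ξ] {U : Set (EuclideanSpace ℝ (Fin d))}
  {f : EuclideanSpace ℝ (Fin d) → ℝ} {F : EuclideanSpace ℝ (Fin d) → Ξ → ℝ} {P : Measure Ξ}
  {L₀ Lρ ρ σ : ℝ}

theorem measurable_domGrad (hU : IsOpen U) (hF : ∀ s, IsGenSmoothOn U (fun x => F x s) L₀ Lρ ρ)
    (hN : IsBoundedNoise U f F P σ) :
    Measurable fun z : EuclideanSpace ℝ (Fin d) × Ξ => domGrad U F z.1 z.2 :=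
  measurable_indicator_uncurry hU.measurableSet
    (fun s => (hF s).differentiableOn_gradient.continuousOn) hN.measurable

theorem measurable_domNoise (hU : IsOpen U) (hf : IsGenSmoothOn U f L₀ Lρ ρ)
    (hF : ∀ s, IsGenSmoothOn U (fun x => F x s) L₀ Lρ ρ) (hN : IsBoundedNoise U f F P σ) :
    Measurable fun z : EuclideanSpace ℝ (Fin d) × Ξ => domNoise U f F z.1 z.2 :=
  measurable_indicator_uncurry hU.measurableSet
    (fun s => (hF s).differentiableOn_gradient.continuousOn.sub
      hf.differentiableOn_gradient.continuousOn) fun x hx => (hN.measurable x hx).sub_const _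

variable {Ω : Type*} [MeasurableSpace Ω] {p : VRAdamInput} {x₁ : EuclideanSpace ℝ (Fin d)}
  {ζ : Fin p.S₁ → Ω → Ξ} {ξ : ℕ → Ω → Ξ}

theorem EuclideanSpace.measurable_toLp_comp {g : Fin d → Ω → ℝ} (hg : ∀ i, Measurable (g i)) :
    Measurable fun ω => (WithLp.toLp 2 fun i => g i ω : EuclideanSpace ℝ (Fin d)) :=
  (PiLp.continuous_toLp 2 _).measurable.comp (measurable_pi_lambda _ hg)

theorem EuclideanSpace.measurable_apply {g : Ω → EuclideanSpace ℝ (Fin d)} (hg : Measurable g)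
    (i : Fin d) : Measurable fun ω => g ω i :=
  (EuclideanSpace.proj (𝕜 := ℝ) i).continuous.measurable.comp hg

/-- The σ-algebra on Ω is arbitrary here, so the result serves both for the ambient σ-algebra and
for that of the past, where it says that the state is adapted. -/
theorem measurable_vrAdamState
    {g : EuclideanSpace ℝ (Fin d) → Ξ → EuclideanSpace ℝ (Fin d)}
    (hg : Measurable fun z : EuclideanSpace ℝ (Fin d) × Ξ => g z.1 z.2)
    (hζ : ∀ i, Measurable (ζ i)) {k : ℕ} (hξ : ∀ j ∈ Finset.Icc 2 (k + 1), Measurable (ξ j)) :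
    Measurable (fun ω => (vrAdamState p g x₁ (fun i => ζ i ω) (fun j => ξ j ω) k).x) ∧
    Measurable (fun ω => (vrAdamState p g x₁ (fun i => ζ i ω) (fun j => ξ j ω) k).xNext) ∧
    Measurable (fun ω => (vrAdamState p g x₁ (fun i => ζ i ω) (fun j => ξ j ω) k).m) ∧
    Measurable (fun ω => (vrAdamState p g x₁ (fun i => ζ i ω) (fun j => ξ j ω) k).v) := by
  induction k with
  | zero =>
    have hm : Measurable fun ω =>
        (vrAdamState p g x₁ (fun i => ζ i ω) (fun j => ξ j ω) 0).m := by
      simp only [vrAdamState, vrAdamInit]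
      have hsum : Measurable fun ω => ∑ i, g x₁ (ζ i ω) :=
        Finset.measurable_fun_sum _ fun i _ => hg.comp (measurable_const.prodMk (hζ i))
      exact hsum.const_smul (1 / (p.S₁ : ℝ))
    have hmi := EuclideanSpace.measurable_apply hm
    refine ⟨measurable_const, ?_, hm, ?_⟩
    · refine EuclideanSpace.measurable_toLp_comp fun i => ?_
      have habs := (continuous_abs.measurable.comp (hmi i)).add_const p.lam
      exact Measurable.const_sub (((hmi i).const_mul p.η).div habs) (x₁ i)
    · exact EuclideanSpace.measurable_toLp_comp fun i => measurable_const.mul ((hmi i).pow_const 2)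
  | succ k ih =>
    obtain ⟨h1, h2, h3, h4⟩ := ih fun j hj => hξ j (by simp at hj ⊢; omega)
    have hξk : Measurable (ξ (k + 2)) := hξ _ (by simp)
    have hg1 := hg.comp (h2.prodMk hξk)
    have hg2 := hg.comp (h1.prodMk hξk)
    simp only [Function.comp_def] at hg1 hg2
    simp only [vrAdamState, vrAdamStep]
    have hm := ((h3.const_smul (1 - p.β)).add (hg1.const_smul p.β)).add
      ((hg1.sub hg2).const_smul (1 - p.β))
    have hv : ∀ i, Measurable fun ω => (1 - p.β₂)
        * (vrAdamState p g x₁ (fun i => ζ i ω) (fun j => ξ j ω) k).v i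
        + p.β₂ * g (vrAdamState p g x₁ (fun i => ζ i ω) (fun j => ξ j ω) k).xNext (ξ (k + 2) ω) i ^ 2 :=
      fun i => ((EuclideanSpace.measurable_apply h4 i).const_mul _).add
        (((EuclideanSpace.measurable_apply hg1 i).pow_const 2).const_mul _)
    refine ⟨h2, EuclideanSpace.measurable_toLp_comp fun i => ?_, hm,
      EuclideanSpace.measurable_toLp_comp hv⟩
    exact (EuclideanSpace.measurable_apply h2 i).sub (((((hv i).div_const _).sqrt.add_const
      p.lam).const_div p.η).mul (EuclideanSpace.measurable_apply hm i))

theorem measurable_domCorrection (hU : IsOpen U) (hf : IsGenSmoothOn U f L₀ Lρ ρ)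
    (hF : ∀ s, IsGenSmoothOn U (fun x => F x s) L₀ Lρ ρ) (hN : IsBoundedNoise U f F P σ)
    (hζ : ∀ i, Measurable (ζ i)) {k : ℕ} (hξ : ∀ j ∈ Finset.Icc 2 (k + 1), Measurable (ξ j)) :
    Measurable fun ω => domCorrection U f F x₁ p (fun i => ζ i ω) (fun j => ξ j ω) k := by
  induction k with
  | zero => exact measurable_const
  | succ k ih =>
    have hξ' : ∀ j ∈ Finset.Icc 2 (k + 1), Measurable (ξ j) :=
      fun j hj => hξ j (by simp at hj ⊢; omega)
    have hξk : Measurable (ξ (k + 2)) := hξ _ (by simp)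
    obtain ⟨h1, h2, -, -⟩ := measurable_vrAdamState (x₁ := x₁) (measurable_domGrad hU hF hN) hζ hξ'
    have hn := measurable_domNoise hU hf hF hN
    exact ((ih hξ').add ((hn.comp (h2.prodMk hξk)).sub (hn.comp (h1.prodMk hξk)))).const_smul
      (1 - p.β)

theorem measurableSet_isAlive {L G D : ℝ} (hO : IsObjective U f) (hf : IsGenSmoothOn U f L₀ Lρ ρ)
    (hF : ∀ s, IsGenSmoothOn U (fun x => F x s) L₀ Lρ ρ) (hN : IsBoundedNoise U f F P σ)
    (hζ : ∀ i, Measurable (ζ i)) {k : ℕ} (hξ : ∀ j ∈ Finset.Icc 2 (k + 1), Measurable (ξ j)) :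
    MeasurableSet {ω | IsAlive U f F x₁ L G D p (fun i => ζ i ω) (fun j => ξ j ω) k} := by
  have : {ω | IsAlive U f F x₁ L G D p (fun i => ζ i ω) (fun j => ξ j ω) k}
      = ⋂ j, ⋂ _ : j ≤ k,
        ({ω | (domState U F x₁ p (fun i => ζ i ω) (fun j => ξ j ω) j).x ∈
          {x ∈ U | f x ≤ G ^ 2 / (6 * L) + sInf (f '' U)}} ∩
        {ω | ‖domCorrection U f F x₁ p (fun i => ζ i ω) (fun j => ξ j ω) j‖ ≤ p.lam * D / 2}) := by
    ext ω
    simp only [IsAlive, Set.mem_iInter, Set.mem_inter_iff, Set.mem_ofPred_eq, sub_le_iff_le_add,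
      and_assoc]
  rw [this]
  refine MeasurableSet.iInter fun j => MeasurableSet.iInter fun hj => ?_
  have hξ' : ∀ i ∈ Finset.Icc 2 (j + 1), Measurable (ξ i) :=
    fun i hi => hξ i (by simp at hi ⊢; omega)
  refine MeasurableSet.inter ?_ ?_
  · exact (measurable_vrAdamState (x₁ := x₁) (measurable_domGrad hO.isOpen hF hN) hζ hξ').1
      (hO.isClosed_sublevel _).measurableSet
  · exact measurableSet_le (measurable_domCorrection hO.isOpen hf hF hN hζ hξ').norm
      measurable_const

end Measurability

/-! ### Independence of the next sample from the past -/

section Independence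

variable {Ω Ξ X : Type*} [MeasurableSpace Ξ]

/-- The σ-algebra of the mega-batch and of the samples used in iterations `2, …, k + 1`. -/
abbrev pastSigma {S₁ : ℕ} (T : ℕ) (ζ : Fin S₁ → Ω → Ξ) (ξ : ℕ → Ω → Ξ) (k : ℕ) : MeasurableSpace Ω :=
  ⨆ i ∈ {i : Fin S₁ ⊕ Finset.Icc 2 T | ∀ t : Finset.Icc 2 T, i = Sum.inr t → (t : ℕ) ≤ k + 1},
    MeasurableSpace.comap (Sum.elim ζ (fun t : Finset.Icc 2 T => ξ t) i) inferInstance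

variable {S₁ T : ℕ} {ζ : Fin S₁ → Ω → Ξ} {ξ : ℕ → Ω → Ξ}

theorem measurable_batch_pastSigma (k : ℕ) (i : Fin S₁) :
    Measurable[pastSigma T ζ ξ k] (ζ i) := by
  refine Measurable.mono (comap_measurable (ζ i)) ?_ le_rfl
  exact le_iSup₂_of_le (f := fun i (_ : i ∈ {i : Fin S₁ ⊕ Finset.Icc 2 T |
    ∀ t : Finset.Icc 2 T, i = Sum.inr t → (t : ℕ) ≤ k + 1}) => MeasurableSpace.comap
      (Sum.elim ζ (fun t : Finset.Icc 2 T => ξ t) i) inferInstance) (Sum.inl i) (by simp) le_rfl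

theorem measurable_sample_pastSigma {k j : ℕ} (hk : k + 1 ≤ T) (hj : j ∈ Finset.Icc 2 (k + 1)) :
    Measurable[pastSigma T ζ ξ k] (ξ j) := by
  have hj' := Finset.mem_Icc.1 hj
  have hjT : j ∈ Finset.Icc 2 T := Finset.mem_Icc.2 ⟨hj'.1, hj'.2.trans hk⟩
  refine Measurable.mono (comap_measurable (ξ j)) ?_ le_rfl
  exact le_iSup₂_of_le (f := fun i (_ : i ∈ {i : Fin S₁ ⊕ Finset.Icc 2 T |
    ∀ t : Finset.Icc 2 T, i = Sum.inr t → (t : ℕ) ≤ k + 1}) => MeasurableSpace.comap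
      (Sum.elim ζ (fun t : Finset.Icc 2 T => ξ t) i) inferInstance) (Sum.inr ⟨j, hjT⟩)
      (by intro t ht; rw [← Sum.inr.inj ht]; exact hj'.2) le_rfl

variable [mΩ : MeasurableSpace Ω] [MeasurableSpace X] {μ : Measure Ω} {P : Measure Ξ}

theorem IsIIDSampling.measurable_family (h : IsIIDSampling μ P S₁ T ζ ξ)
    (i : Fin S₁ ⊕ Finset.Icc 2 T) :
    Measurable (Sum.elim ζ (fun t : Finset.Icc 2 T => ξ t) i) := by
  rcases i with i | t
  · exact h.measurable_batch i
  · exact h.measurable_sample t t.2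

theorem IsIIDSampling.pastSigma_le (h : IsIIDSampling μ P S₁ T ζ ξ) (k : ℕ) :
    pastSigma T ζ ξ k ≤ mΩ :=
  iSup₂_le fun i _ => (h.measurable_family i).comap_le

/-- A function of the past is independent of the next sample. -/
theorem IsIIDSampling.indepFun_of_measurable_past (h : IsIIDSampling μ P S₁ T ζ ξ) {k : ℕ}
    (hk : k + 2 ≤ T) {Z : Ω → X} (hZ : Measurable[pastSigma T ζ ξ k] Z) :
    IndepFun Z (ξ (k + 2)) μ := by
  have hkT : k + 2 ∈ Finset.Icc 2 T := Finset.mem_Icc.2 ⟨by omega, hk⟩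
  have hind := indep_iSup_of_disjoint (fun i => (h.measurable_family i).comap_le) h.indep
    (S := {i : Fin S₁ ⊕ Finset.Icc 2 T | ∀ t : Finset.Icc 2 T, i = Sum.inr t → (t : ℕ) ≤ k + 1})
    (T := {Sum.inr ⟨k + 2, hkT⟩}) (by
      rw [Set.disjoint_singleton_right]
      intro hcon
      have := hcon ⟨k + 2, hkT⟩ rfl
      simp at this)
  rw [iSup_singleton] at hind
  rw [IndepFun_iff_Indep]
  exact indep_of_indep_of_le_left hind hZ.comap_le

/-- By independence the joint law is a product, and Fubini integrates out the fresh sample with the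
past frozen. A non-integrable φ does no harm, its integral being zero by convention. -/
theorem integral_eq_zero_of_indepFun [IsFiniteMeasure μ] [SFinite P] {Z : Ω → X} {Y : Ω → Ξ}
    (hZY : IndepFun Z Y μ) (hZ : Measurable Z) (hY : Measurable Y) (hP : μ.map Y = P)
    {φ : X × Ξ → ℝ} (hφ : Measurable φ) (h0 : ∀ z, ∫ s, φ (z, s) ∂P = 0) :
    ∫ ω, φ (Z ω, Y ω) ∂μ = 0 := by
  have hmap := (indepFun_iff_map_prod_eq_prod_map_map hZ.aemeasurable hY.aemeasurable).1 hZY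
  rw [hP] at hmap
  rw [← integral_map (φ := fun ω => (Z ω, Y ω)) (f := φ) (hZ.prodMk hY).aemeasurable
    hφ.aestronglyMeasurable, hmap]
  by_cases hi : Integrable φ ((μ.map Z).prod P)
  · rw [integral_prod _ hi]
    simp [h0]
  · exact integral_undef hi

/-- The noise bound fails on a null set that depends on the point. Independence and Fubini make the
bound valid at a random point determined by the past. -/
theorem ae_of_indepFun [IsFiniteMeasure μ] [SFinite P] {Z : Ω → X} {Y : Ω → Ξ}
    (hZY : IndepFun Z Y μ) (hZ : Measurable Z) (hY : Measurable Y) (hP : μ.map Y = P)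
    {q : X × Ξ → Prop} (hq : MeasurableSet {z | q z}) (h0 : ∀ z, ∀ᵐ s ∂P, q (z, s)) :
    ∀ᵐ ω ∂μ, q (Z ω, Y ω) := by
  have hmap := (indepFun_iff_map_prod_eq_prod_map_map hZ.aemeasurable hY.aemeasurable).1 hZY
  rw [hP] at hmap
  have h1 : ∀ᵐ z ∂((μ.map Z).prod P), q z :=
    (Measure.ae_prod_mem_iff_ae_ae_mem hq).2 (Filter.Eventually.of_forall h0)
  rw [← hmap] at h1
  exact (ae_map_iff (hZ.prodMk hY).aemeasurable hq).1 h1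

end Independence

/-! ### Mean and size of the noise at a fixed point -/

section Noise

variable {d : ℕ} {Ξ : Type*} [MeasurableSpace Ξ] {U : Set (EuclideanSpace ℝ (Fin d))}
  {f : EuclideanSpace ℝ (Fin d) → ℝ} {F : EuclideanSpace ℝ (Fin d) → Ξ → ℝ} {P : Measure Ξ}
  {σ : ℝ}

theorem IsBoundedNoise.ae_norm_domNoise_le (hN : IsBoundedNoise U f F P σ) (hσ : 0 ≤ σ)
    (x : EuclideanSpace ℝ (Fin d)) : ∀ᵐ s ∂P, ‖domNoise U f F x s‖ ≤ σ := by
  by_cases hx : x ∈ U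
  · simpa [domNoise, hx] using hN.bounded x hx
  · simp [domNoise, hx, hσ]

theorem IsBoundedNoise.measurable_domNoise_apply (hN : IsBoundedNoise U f F P σ)
    (x : EuclideanSpace ℝ (Fin d)) : Measurable (domNoise U f F x) := by
  by_cases hx : x ∈ U
  · have : domNoise U f F x = fun s => stochGrad F x s - gradient f x := by
      ext1 s; simp [domNoise, hx]
    rw [this]
    exact (hN.measurable x hx).sub_const _
  · have : domNoise U f F x = fun _ => 0 := by
      ext1 s; simp [domNoise, hx]
    rw [this]
    exact measurable_const

variable [IsProbabilityMeasure P]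

theorem IsBoundedNoise.integrable_domNoise (hN : IsBoundedNoise U f F P σ) (hσ : 0 ≤ σ)
    (x : EuclideanSpace ℝ (Fin d)) : Integrable (domNoise U f F x) P :=
  Integrable.of_bound (hN.measurable_domNoise_apply x).aestronglyMeasurable σ
    (hN.ae_norm_domNoise_le hσ x)

theorem IsBoundedNoise.integral_domNoise (hN : IsBoundedNoise U f F P σ) (hσ : 0 ≤ σ)
    (x : EuclideanSpace ℝ (Fin d)) : ∫ s, domNoise U f F x s ∂P = 0 := by
  by_cases hx : x ∈ U
  · have hi := hN.integrable_domNoise hσ x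
    have e1 : ∀ s, domNoise U f F x s = stochGrad F x s - gradient f x := fun s => by
      simp [domNoise, hx]
    simp only [e1]
    have hi2 : Integrable (stochGrad F x) P := by
      refine (hi.add (integrable_const (gradient f x))).congr (Filter.Eventually.of_forall fun s => ?_)
      simp [e1]
    rw [integral_sub hi2 (integrable_const _), hN.unbiased x hx]
    simp
  · simp [domNoise, hx]

theorem IsBoundedNoise.integral_inner_eq_zero (hN : IsBoundedNoise U f F P σ) (hσ : 0 ≤ σ)
    (y x x' : EuclideanSpace ℝ (Fin d)) (b : ℝ) :
    ∫ s, (inner ℝ y (domNoise U f F x' s - b • domNoise U f F x s) : ℝ) ∂P = 0 := by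
  have h1 := hN.integrable_domNoise hσ x'
  have h2 := (hN.integrable_domNoise hσ x).smul b
  have h3 := integral_inner (𝕜 := ℝ) (h1.sub h2) y
  simp only [Pi.sub_apply, Pi.smul_apply] at h3
  have h4 := integral_sub h1 h2
  simp only [Pi.smul_apply] at h4
  rw [h3, h4, integral_smul, hN.integral_domNoise hσ, hN.integral_domNoise hσ]
  simp

end Noise

/-! ### Summing up a drift inequality -/

/-- Summation of a drift inequality that is valid on a decreasing sequence of events. -/
theorem setIntegral_drift {Ω : Type*} [MeasurableSpace Ω] {μ : Measure Ω} {A : ℕ → Set Ω}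
    {Φ q M : ℕ → Ω → ℝ} {n : ℕ} (hA : ∀ k ≤ n, MeasurableSet (A k))
    (hanti : ∀ k < n, A (k + 1) ⊆ A k) (hΦ : ∀ k ≤ n, AEStronglyMeasurable (Φ k) μ)
    (hΦ0 : IntegrableOn (Φ 0) (A 0) μ) (hnn : ∀ k < n, ∀ᵐ ω ∂μ, ω ∈ A k → 0 ≤ Φ (k + 1) ω)
    (hq : ∀ k < n, IntegrableOn (q k) (A k) μ) (hM : ∀ k < n, IntegrableOn (M k) (A k) μ)
    (hM0 : ∀ k < n, ∫ ω in A k, M k ω ∂μ = 0)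
    (hstep : ∀ k < n, ∀ᵐ ω ∂μ, ω ∈ A k → Φ (k + 1) ω ≤ Φ k ω - q k ω + M k ω) :
    IntegrableOn (Φ n) (A n) μ ∧ (∀ k < n, IntegrableOn (Φ (k + 1)) (A k) μ) ∧
    ∫ ω in A n, Φ n ω ∂μ + ∑ k ∈ Finset.range n, ∫ ω in A k \ A (k + 1), Φ (k + 1) ω ∂μ
      + ∑ k ∈ Finset.range n, ∫ ω in A k, q k ω ∂μ ≤ ∫ ω in A 0, Φ 0 ω ∂μ := by
  induction n with
  | zero => exact ⟨hΦ0, by simp, by simp⟩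
  | succ n ih =>
    obtain ⟨i1, i2, i3⟩ := ih (fun k hk => hA k (by omega)) (fun k hk => hanti k (by omega))
      (fun k hk => hΦ k (by omega)) (fun k hk => hnn k (by omega)) (fun k hk => hq k (by omega))
      (fun k hk => hM k (by omega)) (fun k hk => hM0 k (by omega)) (fun k hk => hstep k (by omega))
    have hn := Nat.lt_succ_self n
    have hAn := hA n hn.le
    have hAn1 := hA (n + 1) le_rfl
    have hrhs : IntegrableOn (fun ω => Φ n ω - q n ω + M n ω) (A n) μ :=
      (i1.sub (hq n hn)).add (hM n hn)
    have hst : ∀ᵐ ω ∂(μ.restrict (A n)), Φ (n + 1) ω ≤ Φ n ω - q n ω + M n ω :=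
      (ae_restrict_iff' hAn).2 (hstep n hn)
    have hnn' : ∀ᵐ ω ∂(μ.restrict (A n)), 0 ≤ Φ (n + 1) ω := (ae_restrict_iff' hAn).2 (hnn n hn)
    -- Integrability is propagated by the inequality itself: the next value is nonnegative and below
    -- an integrable function.
    have hint : IntegrableOn (Φ (n + 1)) (A n) μ := by
      refine Integrable.mono' hrhs (hΦ (n + 1) le_rfl).restrict ?_
      filter_upwards [hst, hnn'] with ω h1 h2
      rwa [Real.norm_of_nonneg h2]
    refine ⟨hint.mono_set (hanti n hn), fun k hk => ?_, ?_⟩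
    · rcases Nat.lt_succ_iff_lt_or_eq.1 hk with h | rfl
      · exact i2 k h
      · exact hint
    · have h1 : ∫ ω in A n, Φ (n + 1) ω ∂μ ≤ ∫ ω in A n, (Φ n ω - q n ω + M n ω) ∂μ :=
        integral_mono_ae hint hrhs hst
      have h2 : ∫ ω in A n, (Φ n ω - q n ω + M n ω) ∂μ
          = ∫ ω in A n, Φ n ω ∂μ - ∫ ω in A n, q n ω ∂μ := by
        have h3 := integral_add (i1.sub (hq n hn)) (hM n hn)
        simp only [Pi.sub_apply] at h3
        rw [h3, hM0 n hn, add_zero, integral_sub i1 (hq n hn)]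
      -- The part of A n that leaves at this step is not discarded: its integral is the value at
      -- death, to which Markov's inequality will apply.
      have h3 : ∫ ω in A n, Φ (n + 1) ω ∂μ = ∫ ω in A (n + 1), Φ (n + 1) ω ∂μ
          + ∫ ω in A n \ A (n + 1), Φ (n + 1) ω ∂μ := by
        rw [setIntegral_sdiff hAn1 hint (hanti n hn)]; ring
      rw [Finset.sum_range_succ, Finset.sum_range_succ]
      linarith

/-! ### Drift inequalities along a trajectory -/

section Drift

variable {d : ℕ} {Ξ : Type*}

section Definitions

variable (U : Set (EuclideanSpace ℝ (Fin d))) (f : EuclideanSpace ℝ (Fin d) → ℝ)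
  (F : EuclideanSpace ℝ (Fin d) → Ξ → ℝ) (x₁ : EuclideanSpace ℝ (Fin d)) (p : VRAdamInput)
  (ζ : Fin p.S₁ → Ξ) (ξ : ℕ → Ξ) (k : ℕ)

/-- The gradient of the objective at the iterate, zero outside the domain. -/
noncomputable def iterGrad : EuclideanSpace ℝ (Fin d) :=
  U.indicator (gradient f) (domState U F x₁ p ζ ξ k).x

/-- The error of the gradient estimate `m`. -/
noncomputable def iterError : EuclideanSpace ℝ (Fin d) :=
  (domState U F x₁ p ζ ξ k).m - iterGrad U f F x₁ p ζ ξ k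

/-- The displacement of the iterate. -/
noncomputable def iterStep : EuclideanSpace ℝ (Fin d) :=
  (domState U F x₁ p ζ ξ k).xNext - (domState U F x₁ p ζ ξ k).x

/-- The suboptimality gap plus a multiple of the squared estimation error. -/
noncomputable def iterPotential : ℝ :=
  U.indicator (fun x => f x - sInf (f '' U)) (domState U F x₁ p ζ ξ k).x
    + p.η / (p.lam * p.β) * ‖iterError U f F x₁ p ζ ξ k‖ ^ 2

/-- A combination of the noises of the new sample at the new and at the old iterate. -/
noncomputable def iterNoise (b : ℝ) : EuclideanSpace ℝ (Fin d) :=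
  domNoise U f F (domState U F x₁ p ζ ξ k).xNext (ξ (k + 2))
    - b • domNoise U f F (domState U F x₁ p ζ ξ k).x (ξ (k + 2))

end Definitions

variable {U : Set (EuclideanSpace ℝ (Fin d))} {f : EuclideanSpace ℝ (Fin d) → ℝ}
  {F : EuclideanSpace ℝ (Fin d) → Ξ → ℝ} {x₁ : EuclideanSpace ℝ (Fin d)} {p : VRAdamInput}
  {ζ : Fin p.S₁ → Ξ} {ξ : ℕ → Ξ} {L₀ Lρ ρ L σ G D : ℝ} {k : ℕ}

theorem iterPotential_nonneg (hP : IsTunedProblem U f F L₀ Lρ ρ L σ G D p) :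
    0 ≤ iterPotential U f F x₁ p ζ ξ k := by
  have := hP.tuned.η_pos
  have := hP.tuned.lam_pos
  have := hP.tuned.β_pos
  refine add_nonneg (Set.indicator_nonneg (fun x hx => hP.objective.gap_nonneg hx) _) (by positivity)

theorem IsRegularState.iterGrad_eq
    (hs : IsRegularState U f σ G D p k (domState U F x₁ p ζ ξ k) (domCorrection U f F x₁ p ζ ξ k)) :
    iterGrad U f F x₁ p ζ ξ k = gradient f (domState U F x₁ p ζ ξ k).x :=
  Set.indicator_of_mem hs.mem _

theorem IsRegularState.norm_iterGrad_le
    (hs : IsRegularState U f σ G D p k (domState U F x₁ p ζ ξ k) (domCorrection U f F x₁ p ζ ξ k)) :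
    ‖iterGrad U f F x₁ p ζ ξ k‖ ≤ G := by
  rw [hs.iterGrad_eq]; exact hs.gradient_le

theorem IsRegularState.norm_iterError_le
    (hs : IsRegularState U f σ G D p k (domState U F x₁ p ζ ξ k) (domCorrection U f F x₁ p ζ ξ k)) :
    ‖iterError U f F x₁ p ζ ξ k‖ ≤ p.lam * D := by
  rw [iterError, hs.iterGrad_eq]; exact hs.error_le

theorem IsRegularState.iterPotential_succ_le (hP : IsTunedProblem U f F L₀ Lρ ρ L σ G D p)
    (hn : IsNoiseBounded U f F x₁ σ p ζ ξ) (hk : k + 2 ≤ p.T)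
    (hs : IsRegularState U f σ G D p k (domState U F x₁ p ζ ξ k) (domCorrection U f F x₁ p ζ ξ k)) :
    iterPotential U f F x₁ p ζ ξ (k + 1) ≤ iterPotential U f F x₁ p ζ ξ k
      - (p.η / (16 * G) * ‖iterGrad U f F x₁ p ζ ξ k‖ ^ 2
        + p.lam / (16 * p.η) * ‖iterStep U F x₁ p ζ ξ k‖ ^ 2 - 2 * p.η * p.β * σ ^ 2 / p.lam)
      + 2 * (p.η / (p.lam * p.β)) * (1 - p.β) * inner ℝ (iterError U f F x₁ p ζ ξ k)
          (iterNoise U f F x₁ p ζ ξ k (1 - p.β)) := by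
  have key := hs.potential_step_le hP (hn.sample_prev k hk) (hn.sample k hk)
  have hx' := hs.xNext_mem hP
  have e1 : iterGrad U f F x₁ p ζ ξ (k + 1) = gradient f (domState U F x₁ p ζ ξ k).xNext :=
    Set.indicator_of_mem hx' _
  have e2 : iterPotential U f F x₁ p ζ ξ (k + 1)
      = f (domState U F x₁ p ζ ξ k).xNext - sInf (f '' U) + p.η / (p.lam * p.β)
        * ‖(vrAdamStep p (domGrad U F) (k + 2) (domState U F x₁ p ζ ξ k) (ξ (k + 2))).m
          - gradient f (domState U F x₁ p ζ ξ k).xNext‖ ^ 2 := by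
    rw [iterPotential, iterError, e1]
    congr 1
    exact Set.indicator_of_mem hx' _
  have e3 : iterPotential U f F x₁ p ζ ξ k
      = f (domState U F x₁ p ζ ξ k).x - sInf (f '' U) + p.η / (p.lam * p.β)
        * ‖(domState U F x₁ p ζ ξ k).m - gradient f (domState U F x₁ p ζ ξ k).x‖ ^ 2 := by
    rw [iterPotential, iterError, hs.iterGrad_eq]
    congr 1
    exact Set.indicator_of_mem hs.mem _
  rw [e2, e3, iterError, hs.iterGrad_eq, iterStep, iterNoise]
  linarith

/-- Meant for the last iterate: no further sample is drawn there, so the drift inequality is not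
available. -/
theorem IsRegularState.sq_norm_iterGrad_le (hP : IsTunedProblem U f F L₀ Lρ ρ L σ G D p)
    (hs : IsRegularState U f σ G D p k (domState U F x₁ p ζ ξ k) (domCorrection U f F x₁ p ζ ξ k)) :
    p.η / (16 * G) * ‖iterGrad U f F x₁ p ζ ξ k‖ ^ 2 ≤ iterPotential U f F x₁ p ζ ξ k := by
  obtain ⟨h, hh⟩ := hs.exists_scaling
  have key := hh.sq_norm_gradient_le_potential hP.tuned hP.objective hP.smooth hP.effSmooth hs.mem
    hs.gradient_le hs.error_le
  have e3 : iterPotential U f F x₁ p ζ ξ k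
      = f (domState U F x₁ p ζ ξ k).x - sInf (f '' U) + p.η / (p.lam * p.β)
        * ‖(domState U F x₁ p ζ ξ k).m - gradient f (domState U F x₁ p ζ ξ k).x‖ ^ 2 := by
    rw [iterPotential, iterError, hs.iterGrad_eq]
    congr 1
    exact Set.indicator_of_mem hs.mem _
  rw [e3, hs.iterGrad_eq]
  exact key

/-- Written as Φ - q + M to fit the summation lemma: q is minus the growth term, and M is linear in
the fresh noise with the past coefficient ‖w‖⁴w. -/
theorem IsRegularState.correction_succ_le (hP : IsTunedProblem U f F L₀ Lρ ρ L σ G D p)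
    (hn : IsNoiseBounded U f F x₁ σ p ζ ξ) (hk : k + 2 ≤ p.T)
    (hs : IsRegularState U f σ G D p k (domState U F x₁ p ζ ξ k) (domCorrection U f F x₁ p ζ ξ k)) :
    ‖domCorrection U f F x₁ p ζ ξ (k + 1)‖ ^ 6 ≤ ‖domCorrection U f F x₁ p ζ ξ k‖ ^ 6
      - (-(2 * 40 ^ 3 * (D ^ 2 * p.lam ^ 3 / (100 * G)) ^ 2 * (4 * L ^ 2)
          * ‖iterStep U F x₁ p ζ ξ k‖ ^ 2))
      + 6 * (1 - p.β) ^ 6 * inner ℝ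
        (‖domCorrection U f F x₁ p ζ ξ k‖ ^ 4 • domCorrection U f F x₁ p ζ ξ k)
        (iterNoise U f F x₁ p ζ ξ k 1) := by
  have key := hs.correction_step_le hP (hn.sample_prev k hk)
  rw [iterNoise, one_smul, inner_smul_left, iterStep, domCorrection]
  simp only [conj_trivial]
  change ‖(1 - p.β) • (domCorrection U f F x₁ p ζ ξ k
    + (domNoise U f F (domState U F x₁ p ζ ξ k).xNext (ξ (k + 2))
      - domNoise U f F (domState U F x₁ p ζ ξ k).x (ξ (k + 2))))‖ ^ 6 ≤ _
  linarith

/-- When the trajectory dies, then the potential or the correction is large. -/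
theorem IsRegularState.one_le_of_not_isAlive (hP : IsTunedProblem U f F L₀ Lρ ρ L σ G D p)
    (hs : IsRegularState U f σ G D p k (domState U F x₁ p ζ ξ k) (domCorrection U f F x₁ p ζ ξ k))
    (ha : IsAlive U f F x₁ L G D p ζ ξ k) (hd : ¬ IsAlive U f F x₁ L G D p ζ ξ (k + 1)) :
    1 ≤ 6 * L / G ^ 2 * iterPotential U f F x₁ p ζ ξ (k + 1)
      + (2 / (p.lam * D)) ^ 6 * ‖domCorrection U f F x₁ p ζ ξ (k + 1)‖ ^ 6 := by
  have hL := hP.tuned.L_pos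
  have hG := hP.tuned.G_pos
  have hlam := hP.tuned.lam_pos
  have hη := hP.tuned.η_pos
  have hβ := hP.tuned.β_pos
  have hD : 0 < D := zero_lt_one.trans_le hP.tuned.one_le_D
  have hx' := hs.xNext_mem hP
  have hpot := iterPotential_nonneg (x₁ := x₁) (ζ := ζ) (ξ := ξ) (k := k + 1) hP
  by_contra hcon
  refine hd fun j hj => ?_
  rcases Nat.le_succ_iff.1 hj with h | rfl
  · exact ha j h
  refine ⟨hx', ?_, ?_⟩
  · by_contra hgap
    rw [not_le] at hgap
    have h1 : f (domState U F x₁ p ζ ξ (k + 1)).x - sInf (f '' U)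
        ≤ iterPotential U f F x₁ p ζ ξ (k + 1) := by
      have e1 : U.indicator (fun x => f x - sInf (f '' U)) (domState U F x₁ p ζ ξ (k + 1)).x
        = f (domState U F x₁ p ζ ξ (k + 1)).x - sInf (f '' U) := Set.indicator_of_mem hx' _
      rw [iterPotential, e1]
      exact le_add_of_nonneg_right (by positivity)
    have h2 : 1 ≤ 6 * L / G ^ 2 * iterPotential U f F x₁ p ζ ξ (k + 1) := by
      calc 1 = 6 * L / G ^ 2 * (G ^ 2 / (6 * L)) := by field_simp
        _ ≤ _ := by
          gcongr
          linarith
    have h3 : 0 ≤ (2 / (p.lam * D)) ^ 6 * ‖domCorrection U f F x₁ p ζ ξ (k + 1)‖ ^ 6 := by positivity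
    linarith
  · by_contra hw
    rw [not_le] at hw
    have h2 : 1 ≤ (2 / (p.lam * D)) ^ 6 * ‖domCorrection U f F x₁ p ζ ξ (k + 1)‖ ^ 6 := by
      calc 1 = (2 / (p.lam * D)) ^ 6 * (p.lam * D / 2) ^ 6 := by field_simp
        _ ≤ _ := by gcongr
    have h3 : 0 ≤ 6 * L / G ^ 2 * iterPotential U f F x₁ p ζ ξ (k + 1) := by positivity
    linarith

end Drift

/-! ### The random trajectory -/

section Random

variable {d : ℕ} {Ξ Ω : Type*} [MeasurableSpace Ξ] {U : Set (EuclideanSpace ℝ (Fin d))}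
  {f : EuclideanSpace ℝ (Fin d) → ℝ} {F : EuclideanSpace ℝ (Fin d) → Ξ → ℝ}
  {x₁ : EuclideanSpace ℝ (Fin d)} {p : VRAdamInput} {L₀ Lρ ρ L σ G D : ℝ} {P : Measure Ξ}
  {ζ : Fin p.S₁ → Ω → Ξ} {ξ : ℕ → Ω → Ξ} {k : ℕ}

section Measurable

variable [MeasurableSpace Ω]

theorem measurable_iter (hP : IsTunedProblem U f F L₀ Lρ ρ L σ G D p)
    (hN : IsBoundedNoise U f F P σ) (hζ : ∀ i, Measurable (ζ i))
    (hξ : ∀ j ∈ Finset.Icc 2 (k + 1), Measurable (ξ j)) :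
    Measurable (fun ω => iterGrad U f F x₁ p (fun i => ζ i ω) (fun j => ξ j ω) k) ∧
    Measurable (fun ω => iterError U f F x₁ p (fun i => ζ i ω) (fun j => ξ j ω) k) ∧
    Measurable (fun ω => iterStep U F x₁ p (fun i => ζ i ω) (fun j => ξ j ω) k) ∧
    Measurable (fun ω => iterPotential U f F x₁ p (fun i => ζ i ω) (fun j => ξ j ω) k) := by
  obtain ⟨h1, h2, h3, -⟩ := measurable_vrAdamState (x₁ := x₁)
    (measurable_domGrad hP.objective.isOpen hP.smooth_component hN) hζ hξ
  have hU := hP.objective.isOpen.measurableSet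
  have hg : Measurable fun ω => iterGrad U f F x₁ p (fun i => ζ i ω) (fun j => ξ j ω) k :=
    (hP.smooth.differentiableOn_gradient.continuousOn.measurable_indicator hU).comp h1
  have he : Measurable fun ω => iterError U f F x₁ p (fun i => ζ i ω) (fun j => ξ j ω) k :=
    h3.sub hg
  refine ⟨hg, he, h2.sub h1, ?_⟩
  have hgap : Measurable fun ω => U.indicator (fun x => f x - sInf (f '' U))
      (domState U F x₁ p (fun i => ζ i ω) (fun j => ξ j ω) k).x :=
    ((hP.objective.differentiableOn.continuousOn.sub continuousOn_const).measurable_indicator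
      hU).comp h1
  exact hgap.add ((he.norm.pow_const 2).const_mul (p.η / (p.lam * p.β)))

end Measurable

variable [MeasurableSpace Ω] {μ : Measure Ω}

theorem IsIIDSampling.measurable_upTo (hI : IsIIDSampling μ P p.S₁ p.T ζ ξ) (hk : k + 1 ≤ p.T) :
    ∀ j ∈ Finset.Icc 2 (k + 1), Measurable (ξ j) := fun j hj =>
  hI.measurable_sample j (by simp at hj ⊢; omega)

theorem measurable_iterNoise (hP : IsTunedProblem U f F L₀ Lρ ρ L σ G D p)
    (hN : IsBoundedNoise U f F P σ) (hI : IsIIDSampling μ P p.S₁ p.T ζ ξ) (hk : k + 2 ≤ p.T)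
    (b : ℝ) :
    Measurable fun ω => iterNoise U f F x₁ p (fun i => ζ i ω) (fun j => ξ j ω) k b := by
  have hnm := measurable_domNoise hP.objective.isOpen hP.smooth hP.smooth_component hN
  have hst := measurable_vrAdamState (x₁ := x₁)
    (measurable_domGrad hP.objective.isOpen hP.smooth_component hN)
    hI.measurable_batch (hI.measurable_upTo (k := k) (by omega))
  have hY := hI.measurable_sample (k + 2) (by simp; omega)
  exact (hnm.comp (hst.2.1.prodMk hY)).sub ((hnm.comp (hst.1.prodMk hY)).const_smul b)

variable [IsProbabilityMeasure μ] [IsProbabilityMeasure P]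

/-- Almost surely the noise along the trajectory is bounded by `σ`. -/
theorem ae_isNoiseBounded (hP : IsTunedProblem U f F L₀ Lρ ρ L σ G D p)
    (hN : IsBoundedNoise U f F P σ) (hI : IsIIDSampling μ P p.S₁ p.T ζ ξ) (hx₁ : x₁ ∈ U)
    (hS : 1 ≤ p.S₁) :
    ∀ᵐ ω ∂μ, IsNoiseBounded U f F x₁ σ p (fun i => ζ i ω) (fun j => ξ j ω) := by
  have hσ := hP.tuned.σ_nonneg
  have hnm := measurable_domNoise hP.objective.isOpen hP.smooth hP.smooth_component hN
  have hbatch : ∀ᵐ ω ∂μ, ∀ i, ‖domNoise U f F x₁ (ζ i ω)‖ ≤ σ := by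
    refine ae_all_iff.2 fun i => ?_
    have h1 := hN.ae_norm_domNoise_le hσ x₁
    rw [← hI.law_batch i] at h1
    exact ae_of_ae_map (hI.measurable_batch i).aemeasurable h1
  have hset : MeasurableSet {z : EuclideanSpace ℝ (Fin d) × Ξ | ‖domNoise U f F z.1 z.2‖ ≤ σ} :=
    measurableSet_le hnm.norm measurable_const
  have hsample : ∀ᵐ ω ∂μ, ∀ k, k + 2 ≤ p.T →
      ‖domNoise U f F (domState U F x₁ p (fun i => ζ i ω) (fun j => ξ j ω) (k + 1)).x
        (ξ (k + 2) ω)‖ ≤ σ ∧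
      ‖domNoise U f F (domState U F x₁ p (fun i => ζ i ω) (fun j => ξ j ω) k).x
        (ξ (k + 2) ω)‖ ≤ σ := by
    refine ae_all_iff.2 fun k => ?_
    by_cases hk : k + 2 ≤ p.T
    swap
    · exact Filter.Eventually.of_forall fun ω h => absurd h hk
    -- Both x and xNext of this state are functions of the past, hence independent of the sample of
    -- iteration k + 2, which is evaluated at these two points.
    have hst := @measurable_vrAdamState d Ξ _ Ω (pastSigma p.T ζ ξ k) p x₁ ζ ξ _
      (measurable_domGrad hP.objective.isOpen hP.smooth_component hN)
      (measurable_batch_pastSigma k) k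
      (fun j hj => measurable_sample_pastSigma (by omega) hj)
    have hY := hI.measurable_sample (k + 2) (by simp; omega)
    have hlaw := hI.law_sample (k + 2) (by simp; omega)
    have h1 := ae_of_indepFun (hI.indepFun_of_measurable_past hk hst.2.1)
      (hst.2.1.mono (hI.pastSigma_le k) le_rfl) hY hlaw hset (hN.ae_norm_domNoise_le hσ)
    have h2 := ae_of_indepFun (hI.indepFun_of_measurable_past hk hst.1)
      (hst.1.mono (hI.pastSigma_le k) le_rfl) hY hlaw hset (hN.ae_norm_domNoise_le hσ)
    filter_upwards [h1, h2] with ω h1 h2 _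
    exact ⟨h1, h2⟩
  filter_upwards [hbatch, hsample] with ω h1 h2
  refine ⟨?_, fun k hk => (h2 k hk).1, fun k hk => (h2 k hk).2⟩
  have hS0 : (0 : ℝ) < p.S₁ := by exact_mod_cast hS
  have e1 : (domState U F x₁ p (fun i => ζ i ω) (fun j => ξ j ω) 0).m - gradient f x₁
      = (1 / (p.S₁ : ℝ)) • ∑ i, domNoise U f F x₁ (ζ i ω) := by
    simp only [domState, vrAdamState, vrAdamInit, domGrad_eq (f := f) hx₁, Finset.sum_add_distrib,
      Finset.sum_const, Finset.card_univ, Fintype.card_fin, smul_add]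
    rw [← Nat.cast_smul_eq_nsmul ℝ, smul_smul, one_div_mul_cancel hS0.ne', one_smul,
      add_sub_cancel_right]
  rw [e1, norm_smul, Real.norm_of_nonneg (by positivity), one_div, inv_mul_le_iff₀ hS0]
  refine (norm_sum_le_of_le _ fun i _ => h1 i).trans ?_
  simp

/-- Linear functionals of the new noise have mean zero on events of the past. -/
theorem setIntegral_inner_iterNoise (hP : IsTunedProblem U f F L₀ Lρ ρ L σ G D p)
    (hN : IsBoundedNoise U f F P σ) (hI : IsIIDSampling μ P p.S₁ p.T ζ ξ) (hk : k + 2 ≤ p.T)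
    {A : Set Ω} (hA : MeasurableSet[pastSigma p.T ζ ξ k] A) {y : Ω → EuclideanSpace ℝ (Fin d)}
    (hy : Measurable[pastSigma p.T ζ ξ k] y) (b : ℝ) :
    ∫ ω in A, (inner ℝ (y ω)
      (iterNoise U f F x₁ p (fun i => ζ i ω) (fun j => ξ j ω) k b) : ℝ) ∂μ = 0 := by
  have hσ := hP.tuned.σ_nonneg
  have hnm := measurable_domNoise hP.objective.isOpen hP.smooth hP.smooth_component hN
  have hst := @measurable_vrAdamState d Ξ _ Ω (pastSigma p.T ζ ξ k) p x₁ ζ ξ _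
    (measurable_domGrad hP.objective.isOpen hP.smooth_component hN)
    (measurable_batch_pastSigma k) k
    (fun j hj => measurable_sample_pastSigma (by omega) hj)
  have hY := hI.measurable_sample (k + 2) (by simp; omega)
  have hlaw := hI.law_sample (k + 2) (by simp; omega)
  -- The event A is moved into the coefficient, which stays measurable with respect to the past and
  -- turns the set integral into a full expectation.
  have hyA : Measurable[pastSigma p.T ζ ξ k] (A.indicator y) :=
    Measurable.indicator (m := pastSigma p.T ζ ξ k) hy hA
  have hZ : Measurable[pastSigma p.T ζ ξ k] fun ω =>
      (A.indicator y ω, (domState U F x₁ p (fun i => ζ i ω) (fun j => ξ j ω) k).xNext,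
        (domState U F x₁ p (fun i => ζ i ω) (fun j => ξ j ω) k).x) :=
    hyA.prodMk (hst.2.1.prodMk hst.1)
  have hφ : Measurable fun z : (EuclideanSpace ℝ (Fin d) × EuclideanSpace ℝ (Fin d)
      × EuclideanSpace ℝ (Fin d)) × Ξ => (inner ℝ z.1.1
        (domNoise U f F z.1.2.1 z.2 - b • domNoise U f F z.1.2.2 z.2) : ℝ) := by
    have h1 : Measurable fun z : (EuclideanSpace ℝ (Fin d) × EuclideanSpace ℝ (Fin d)
      × EuclideanSpace ℝ (Fin d)) × Ξ => domNoise U f F z.1.2.1 z.2 :=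
      hnm.comp (f := fun z : (EuclideanSpace ℝ (Fin d) × EuclideanSpace ℝ (Fin d)
        × EuclideanSpace ℝ (Fin d)) × Ξ => (z.1.2.1, z.2)) (by fun_prop)
    have h2 : Measurable fun z : (EuclideanSpace ℝ (Fin d) × EuclideanSpace ℝ (Fin d)
      × EuclideanSpace ℝ (Fin d)) × Ξ => domNoise U f F z.1.2.2 z.2 :=
      hnm.comp (f := fun z : (EuclideanSpace ℝ (Fin d) × EuclideanSpace ℝ (Fin d)
        × EuclideanSpace ℝ (Fin d)) × Ξ => (z.1.2.2, z.2)) (by fun_prop)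
    exact Measurable.inner (by fun_prop) (h1.sub (h2.const_smul b))
  have key := integral_eq_zero_of_indepFun (hI.indepFun_of_measurable_past hk hZ)
    (hZ.mono (hI.pastSigma_le k) le_rfl) hY hlaw hφ
    fun z => hN.integral_inner_eq_zero hσ z.1 z.2.2 z.2.1 b
  rw [← integral_indicator (hI.pastSigma_le k _ hA), ← key]
  congr 1
  ext1 ω
  by_cases hω : ω ∈ A <;> simp [hω, iterNoise]

/-- Linear functionals of the new noise are integrable where their coefficients are bounded. -/
theorem integrableOn_inner_iterNoise (hP : IsTunedProblem U f F L₀ Lρ ρ L σ G D p)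
    (hN : IsBoundedNoise U f F P σ) (hI : IsIIDSampling μ P p.S₁ p.T ζ ξ) (hk : k + 2 ≤ p.T)
    (hx₁ : x₁ ∈ U) (hS : 1 ≤ p.S₁) {A : Set Ω} (hA : MeasurableSet A)
    {y : Ω → EuclideanSpace ℝ (Fin d)} (hy : Measurable y) {K : ℝ}
    (hyK : ∀ᵐ ω ∂μ, ω ∈ A → ‖y ω‖ ≤ K) (b : ℝ) :
    IntegrableOn (fun ω => (inner ℝ (y ω)
      (iterNoise U f F x₁ p (fun i => ζ i ω) (fun j => ξ j ω) k b) : ℝ)) A μ := by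
  refine Integrable.of_bound
    (hy.inner (measurable_iterNoise hP hN hI hk b)).aestronglyMeasurable (K * (σ + |b| * σ)) ?_
  refine (ae_restrict_iff' hA).2 ?_
  filter_upwards [hyK, ae_isNoiseBounded hP hN hI hx₁ hS] with ω h1 h2 hω
  refine (norm_inner_le_norm _ _).trans ?_
  have h3 : ‖iterNoise U f F x₁ p (fun i => ζ i ω) (fun j => ξ j ω) k b‖ ≤ σ + |b| * σ := by
    refine (norm_sub_le _ _).trans (add_le_add (h2.sample k hk) ?_)
    rw [norm_smul, Real.norm_eq_abs]
    exact mul_le_mul_of_nonneg_left (h2.sample_prev k hk) (abs_nonneg b)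
  exact mul_le_mul (h1 hω) h3 (norm_nonneg _) ((norm_nonneg _).trans (h1 hω))

/-- The batch average has variance at most `σ² / S₁`. -/
theorem integral_sq_norm_iterError_zero_le (hP : IsTunedProblem U f F L₀ Lρ ρ L σ G D p)
    (hN : IsBoundedNoise U f F P σ) (hI : IsIIDSampling μ P p.S₁ p.T ζ ξ) (hx₁ : x₁ ∈ U)
    (hS : 1 ≤ p.S₁) :
    ∫ ω, ‖iterError U f F x₁ p (fun i => ζ i ω) (fun j => ξ j ω) 0‖ ^ 2 ∂μ ≤ σ ^ 2 / p.S₁ := by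
  have hσ := hP.tuned.σ_nonneg
  have hS0 : (0 : ℝ) < p.S₁ := by exact_mod_cast hS
  have hnm := hN.measurable_domNoise_apply x₁
  have hm : ∀ i, Measurable fun ω => domNoise U f F x₁ (ζ i ω) := fun i =>
    hnm.comp (hI.measurable_batch i)
  have hb : ∀ i, ∀ᵐ ω ∂μ, ‖domNoise U f F x₁ (ζ i ω)‖ ≤ σ := fun i => by
    have h1 := hN.ae_norm_domNoise_le hσ x₁
    rw [← hI.law_batch i] at h1
    exact ae_of_ae_map (hI.measurable_batch i).aemeasurable h1
  have e1 : ∀ ω, iterError U f F x₁ p (fun i => ζ i ω) (fun j => ξ j ω) 0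
      = (1 / (p.S₁ : ℝ)) • ∑ i, domNoise U f F x₁ (ζ i ω) := by
    intro ω
    have e2 : iterGrad U f F x₁ p (fun i => ζ i ω) (fun j => ξ j ω) 0 = gradient f x₁ :=
      Set.indicator_of_mem hx₁ _
    rw [iterError, e2]
    simp only [domState, vrAdamState, vrAdamInit, domGrad_eq (f := f) hx₁, Finset.sum_add_distrib,
      Finset.sum_const, Finset.card_univ, Fintype.card_fin, smul_add]
    rw [← Nat.cast_smul_eq_nsmul ℝ, smul_smul, one_div_mul_cancel hS0.ne', one_smul,
      add_sub_cancel_right]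
  have e3 : ∀ ω, ‖iterError U f F x₁ p (fun i => ζ i ω) (fun j => ξ j ω) 0‖ ^ 2
      = 1 / (p.S₁ : ℝ) ^ 2 * ∑ i, ∑ j,
        (inner ℝ (domNoise U f F x₁ (ζ i ω)) (domNoise U f F x₁ (ζ j ω)) : ℝ) := by
    intro ω
    rw [e1, norm_smul, mul_pow, Real.norm_of_nonneg (by positivity), ← real_inner_self_eq_norm_sq,
      sum_inner]
    simp only [inner_sum]
    ring
  have hint : ∀ i j, Integrable (fun ω =>
      (inner ℝ (domNoise U f F x₁ (ζ i ω)) (domNoise U f F x₁ (ζ j ω)) : ℝ)) μ := by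
    intro i j
    refine Integrable.of_bound ((hm i).inner (hm j)).aestronglyMeasurable (σ * σ) ?_
    filter_upwards [hb i, hb j] with ω h1 h2
    exact (norm_inner_le_norm _ _).trans (mul_le_mul h1 h2 (norm_nonneg _) hσ)
  have hoff : ∀ i j, i ≠ j → ∫ ω,
      (inner ℝ (domNoise U f F x₁ (ζ i ω)) (domNoise U f F x₁ (ζ j ω)) : ℝ) ∂μ = 0 := by
    intro i j hij
    have hind : IndepFun (ζ i) (ζ j) μ :=
      hI.indep.indepFun (i := Sum.inl i) (j := Sum.inl j) (by simpa using hij)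
    refine integral_eq_zero_of_indepFun hind (hI.measurable_batch i) (hI.measurable_batch j)
      (hI.law_batch j)
      (φ := fun z => (inner ℝ (domNoise U f F x₁ z.1) (domNoise U f F x₁ z.2) : ℝ))
      ((hnm.comp measurable_fst).inner (hnm.comp measurable_snd)) fun z => ?_
    -- With coefficient 0 the second noise disappears, and this is the mean of a single noise
    -- vector.
    simpa using hN.integral_inner_eq_zero hσ (domNoise U f F x₁ z) x₁ x₁ 0
  have hdiag : ∀ i, ∫ ω,
      (inner ℝ (domNoise U f F x₁ (ζ i ω)) (domNoise U f F x₁ (ζ i ω)) : ℝ) ∂μ ≤ σ ^ 2 := by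
    intro i
    have h1 : ∀ᵐ ω ∂μ,
        (inner ℝ (domNoise U f F x₁ (ζ i ω)) (domNoise U f F x₁ (ζ i ω)) : ℝ) ≤ σ ^ 2 := by
      filter_upwards [hb i] with ω h
      rw [real_inner_self_eq_norm_sq]
      exact pow_le_pow_left₀ (norm_nonneg _) h 2
    refine (integral_mono_ae (hint i i) (integrable_const _) h1).trans ?_
    simp
  simp only [e3]
  rw [integral_const_mul, integral_finsetSum _ fun i _ => integrable_finsetSum _ fun j _ => hint i j]
  have h1 : ∀ i ∈ Finset.univ, ∫ ω, ∑ j,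
      (inner ℝ (domNoise U f F x₁ (ζ i ω)) (domNoise U f F x₁ (ζ j ω)) : ℝ) ∂μ ≤ σ ^ 2 := by
    intro i _
    rw [integral_finsetSum _ fun j _ => hint i j, Finset.sum_eq_single i (fun j _ hj => hoff i j hj.symm)
      (by simp)]
    exact hdiag i
  calc 1 / (p.S₁ : ℝ) ^ 2 * ∑ i, ∫ ω, ∑ j,
        (inner ℝ (domNoise U f F x₁ (ζ i ω)) (domNoise U f F x₁ (ζ j ω)) : ℝ) ∂μ
      ≤ 1 / (p.S₁ : ℝ) ^ 2 * ∑ _i : Fin p.S₁, σ ^ 2 := by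
        gcongr with i hi
        exact h1 i hi
    _ = σ ^ 2 / p.S₁ := by
        rw [Finset.sum_const, Finset.card_univ, Fintype.card_fin, nsmul_eq_mul]
        field_simp

end Random

/-! ### Summation over the iterations and the probability of failure -/

section Summation

variable {d : ℕ} {Ξ Ω : Type*} {U : Set (EuclideanSpace ℝ (Fin d))}
  {f : EuclideanSpace ℝ (Fin d) → ℝ} {F : EuclideanSpace ℝ (Fin d) → Ξ → ℝ}
  {x₁ : EuclideanSpace ℝ (Fin d)} {p : VRAdamInput} {L₀ Lρ ρ L σ G D : ℝ}
  {ζ : Fin p.S₁ → Ω → Ξ} {ξ : ℕ → Ω → Ξ}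

/-- The event that the trajectory is alive at the end of iteration `k + 1`. -/
def aliveSet (U : Set (EuclideanSpace ℝ (Fin d))) (f : EuclideanSpace ℝ (Fin d) → ℝ)
    (F : EuclideanSpace ℝ (Fin d) → Ξ → ℝ) (x₁ : EuclideanSpace ℝ (Fin d)) (L G D : ℝ)
    (p : VRAdamInput) (ζ : Fin p.S₁ → Ω → Ξ) (ξ : ℕ → Ω → Ξ) (k : ℕ) : Set Ω :=
  {ω | IsAlive U f F x₁ L G D p (fun i => ζ i ω) (fun j => ξ j ω) k}

theorem aliveSet_anti {k l : ℕ} (hkl : k ≤ l) :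
    aliveSet U f F x₁ L G D p ζ ξ l ⊆ aliveSet U f F x₁ L G D p ζ ξ k :=
  fun _ h => h.mono hkl

theorem aliveSet_zero (hP : IsTunedProblem U f F L₀ Lρ ρ L σ G D p) (hx₁ : x₁ ∈ U)
    (hΔ : f x₁ - sInf (f '' U) ≤ G ^ 2 / (6 * L)) :
    aliveSet U f F x₁ L G D p ζ ξ 0 = Set.univ := by
  refine Set.eq_univ_of_forall fun ω j hj => ?_
  obtain rfl : j = 0 := by omega
  refine ⟨hx₁, hΔ, ?_⟩
  have h1 := hP.tuned.lam_pos
  have h2 := hP.tuned.one_le_D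
  rw [domCorrection, norm_zero]
  positivity

variable [MeasurableSpace Ξ] {P : Measure Ξ}

theorem measurableSet_pastSigma_aliveSet (hP : IsTunedProblem U f F L₀ Lρ ρ L σ G D p)
    (hN : IsBoundedNoise U f F P σ) {k : ℕ} (hk : k + 1 ≤ p.T) :
    MeasurableSet[pastSigma p.T ζ ξ k] (aliveSet U f F x₁ L G D p ζ ξ k) :=
  @measurableSet_isAlive d Ξ _ U f F P L₀ Lρ ρ σ Ω (pastSigma p.T ζ ξ k) p x₁ ζ ξ L G D hP.objective
    hP.smooth hP.smooth_component hN (measurable_batch_pastSigma k) k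
    fun _ hj => measurable_sample_pastSigma hk hj

variable [MeasurableSpace Ω] {μ : Measure Ω}

theorem measurableSet_aliveSet (hP : IsTunedProblem U f F L₀ Lρ ρ L σ G D p)
    (hN : IsBoundedNoise U f F P σ) (hI : IsIIDSampling μ P p.S₁ p.T ζ ξ) {k : ℕ}
    (hk : k + 1 ≤ p.T) : MeasurableSet (aliveSet U f F x₁ L G D p ζ ξ k) :=
  measurableSet_isAlive hP.objective hP.smooth hP.smooth_component hN hI.measurable_batch
    (hI.measurable_upTo hk)

variable [IsProbabilityMeasure μ] [IsProbabilityMeasure P]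

theorem ae_isRegularState (hP : IsTunedProblem U f F L₀ Lρ ρ L σ G D p)
    (hN : IsBoundedNoise U f F P σ) (hI : IsIIDSampling μ P p.S₁ p.T ζ ξ) (hx₁ : x₁ ∈ U)
    (hg₁ : ‖gradient f x₁‖ ≤ G) (hS : 1 ≤ p.S₁) :
    ∀ᵐ ω ∂μ, IsNoiseBounded U f F x₁ σ p (fun i => ζ i ω) (fun j => ξ j ω) ∧
      ∀ k, k + 1 ≤ p.T → ω ∈ aliveSet U f F x₁ L G D p ζ ξ k →
      IsRegularState U f σ G D p k (domState U F x₁ p (fun i => ζ i ω) (fun j => ξ j ω) k)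
        (domCorrection U f F x₁ p (fun i => ζ i ω) (fun j => ξ j ω) k) := by
  filter_upwards [ae_isNoiseBounded hP hN hI hx₁ hS] with ω hω
  exact ⟨hω, fun k hk ha => IsAlive.isRegularState hP hg₁ hω hk ha⟩

theorem integrableOn_sq_norm_iterGrad (hP : IsTunedProblem U f F L₀ Lρ ρ L σ G D p)
    (hN : IsBoundedNoise U f F P σ) (hI : IsIIDSampling μ P p.S₁ p.T ζ ξ) (hx₁ : x₁ ∈ U)
    (hg₁ : ‖gradient f x₁‖ ≤ G) (hS : 1 ≤ p.S₁) {k : ℕ} (hk : k + 1 ≤ p.T) :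
    IntegrableOn (fun ω => ‖iterGrad U f F x₁ p (fun i => ζ i ω) (fun j => ξ j ω) k‖ ^ 2)
      (aliveSet U f F x₁ L G D p ζ ξ k) μ := by
  have hm := measurable_iter (x₁ := x₁) hP hN hI.measurable_batch (hI.measurable_upTo hk)
  refine Integrable.of_bound (hm.1.norm.pow_const 2).aestronglyMeasurable (G ^ 2) ?_
  refine (ae_restrict_iff' (measurableSet_aliveSet hP hN hI hk)).2 ?_
  filter_upwards [ae_isRegularState hP hN hI hx₁ hg₁ hS] with ω h hω
  rw [Real.norm_of_nonneg (by positivity)]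
  exact pow_le_pow_left₀ (norm_nonneg _) (h.2 k hk hω).norm_iterGrad_le 2

theorem integrableOn_sq_norm_iterStep (hP : IsTunedProblem U f F L₀ Lρ ρ L σ G D p)
    (hN : IsBoundedNoise U f F P σ) (hI : IsIIDSampling μ P p.S₁ p.T ζ ξ) (hx₁ : x₁ ∈ U)
    (hg₁ : ‖gradient f x₁‖ ≤ G) (hS : 1 ≤ p.S₁) {k : ℕ} (hk : k + 1 ≤ p.T) :
    IntegrableOn (fun ω => ‖iterStep U F x₁ p (fun i => ζ i ω) (fun j => ξ j ω) k‖ ^ 2)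
      (aliveSet U f F x₁ L G D p ζ ξ k) μ := by
  have hm := measurable_iter (x₁ := x₁) hP hN hI.measurable_batch (hI.measurable_upTo hk)
  refine Integrable.of_bound (hm.2.2.1.norm.pow_const 2).aestronglyMeasurable
    ((2 * p.η * D) ^ 2) ?_
  refine (ae_restrict_iff' (measurableSet_aliveSet hP hN hI hk)).2 ?_
  filter_upwards [ae_isRegularState hP hN hI hx₁ hg₁ hS] with ω h hω
  rw [Real.norm_of_nonneg (by positivity)]
  exact pow_le_pow_left₀ (norm_nonneg _) ((h.2 k hk hω).norm_step_le hP) 2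

/-- The potential summed over the iterations. -/
theorem sum_iterPotential_le (hP : IsTunedProblem U f F L₀ Lρ ρ L σ G D p)
    (hN : IsBoundedNoise U f F P σ) (hI : IsIIDSampling μ P p.S₁ p.T ζ ξ) (hx₁ : x₁ ∈ U)
    (hg₁ : ‖gradient f x₁‖ ≤ G) (hS : 1 ≤ p.S₁) {n : ℕ} (hn : n + 1 = p.T) :
    (∀ k < n, IntegrableOn
      (fun ω => iterPotential U f F x₁ p (fun i => ζ i ω) (fun j => ξ j ω) (k + 1))
      (aliveSet U f F x₁ L G D p ζ ξ k) μ) ∧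
    p.η / (16 * G) * ∑ k ∈ Finset.range (n + 1), ∫ ω in aliveSet U f F x₁ L G D p ζ ξ k,
        ‖iterGrad U f F x₁ p (fun i => ζ i ω) (fun j => ξ j ω) k‖ ^ 2 ∂μ
      + p.lam / (16 * p.η) * ∑ k ∈ Finset.range n, ∫ ω in aliveSet U f F x₁ L G D p ζ ξ k,
        ‖iterStep U F x₁ p (fun i => ζ i ω) (fun j => ξ j ω) k‖ ^ 2 ∂μ
      + ∑ k ∈ Finset.range n,
        ∫ ω in aliveSet U f F x₁ L G D p ζ ξ k \ aliveSet U f F x₁ L G D p ζ ξ (k + 1),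
          iterPotential U f F x₁ p (fun i => ζ i ω) (fun j => ξ j ω) (k + 1) ∂μ
      ≤ f x₁ - sInf (f '' U) + p.η / (p.lam * p.β) * (σ ^ 2 / p.S₁)
        + n * (2 * p.η * p.β * σ ^ 2 / p.lam) := by
  have hη := hP.tuned.η_pos
  have hlam := hP.tuned.lam_pos
  have hβ := hP.tuned.β_pos
  have hσ := hP.tuned.σ_nonneg
  have hreg := ae_isRegularState hP hN hI hx₁ hg₁ hS
  have hAm : ∀ k ≤ n, MeasurableSet (aliveSet U f F x₁ L G D p ζ ξ k) := fun k hk =>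
    measurableSet_aliveSet hP hN hI (by omega)
  have hgi : ∀ k ≤ n, IntegrableOn
      (fun ω => ‖iterGrad U f F x₁ p (fun i => ζ i ω) (fun j => ξ j ω) k‖ ^ 2)
      (aliveSet U f F x₁ L G D p ζ ξ k) μ := fun k hk =>
    integrableOn_sq_norm_iterGrad hP hN hI hx₁ hg₁ hS (by omega)
  have hsi : ∀ k ≤ n, IntegrableOn
      (fun ω => ‖iterStep U F x₁ p (fun i => ζ i ω) (fun j => ξ j ω) k‖ ^ 2)
      (aliveSet U f F x₁ L G D p ζ ξ k) μ := fun k hk =>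
    integrableOn_sq_norm_iterStep hP hN hI hx₁ hg₁ hS (by omega)
  have hmeas : ∀ k ≤ n, Measurable
      (fun ω => iterPotential U f F x₁ p (fun i => ζ i ω) (fun j => ξ j ω) k) := fun k hk =>
    (measurable_iter hP hN hI.measurable_batch (hI.measurable_upTo (by omega))).2.2.2
  have hm0 := measurable_iter (x₁ := x₁) (k := 0) hP hN hI.measurable_batch
    (hI.measurable_upTo (by omega))
  have hΦ0 : ∀ ω, iterPotential U f F x₁ p (fun i => ζ i ω) (fun j => ξ j ω) 0
      = f x₁ - sInf (f '' U) + p.η / (p.lam * p.β)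
        * ‖iterError U f F x₁ p (fun i => ζ i ω) (fun j => ξ j ω) 0‖ ^ 2 := by
    intro ω
    rw [iterPotential]
    congr 1
    exact Set.indicator_of_mem hx₁ _
  have herr : Integrable
      (fun ω => ‖iterError U f F x₁ p (fun i => ζ i ω) (fun j => ξ j ω) 0‖ ^ 2) μ := by
    refine Integrable.of_bound (hm0.2.1.norm.pow_const 2).aestronglyMeasurable (σ ^ 2) ?_
    filter_upwards [hreg] with ω h
    rw [Real.norm_of_nonneg (by positivity)]
    refine pow_le_pow_left₀ (norm_nonneg _) ?_ 2
    have e2 : iterGrad U f F x₁ p (fun i => ζ i ω) (fun j => ξ j ω) 0 = gradient f x₁ :=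
      Set.indicator_of_mem hx₁ _
    rw [iterError, e2]
    exact h.1.batch
  have hΦ0i : Integrable
      (fun ω => iterPotential U f F x₁ p (fun i => ζ i ω) (fun j => ξ j ω) 0) μ := by
    simp only [hΦ0]
    exact (integrable_const _).add (herr.const_mul _)
  have hpast : ∀ k < n, Measurable[pastSigma p.T ζ ξ k]
      (fun ω => iterError U f F x₁ p (fun i => ζ i ω) (fun j => ξ j ω) k) := fun k hk =>
    (@measurable_iter d Ξ Ω _ U f F x₁ p L₀ Lρ ρ L σ G D P ζ ξ k (pastSigma p.T ζ ξ k) hP hN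
      (measurable_batch_pastSigma k) fun j hj => measurable_sample_pastSigma (by omega) hj).2.1
  have hqi : ∀ k < n, IntegrableOn (fun ω =>
      p.η / (16 * G) * ‖iterGrad U f F x₁ p (fun i => ζ i ω) (fun j => ξ j ω) k‖ ^ 2
      + p.lam / (16 * p.η) * ‖iterStep U F x₁ p (fun i => ζ i ω) (fun j => ξ j ω) k‖ ^ 2
      - 2 * p.η * p.β * σ ^ 2 / p.lam) (aliveSet U f F x₁ L G D p ζ ξ k) μ := fun k hk =>
    (((hgi k hk.le).const_mul (p.η / (16 * G))).fun_add
      ((hsi k hk.le).const_mul (p.lam / (16 * p.η)))).sub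
        (integrable_const (2 * p.η * p.β * σ ^ 2 / p.lam))
  have key := setIntegral_drift (μ := μ) (n := n) (A := aliveSet U f F x₁ L G D p ζ ξ)
    (Φ := fun k ω => iterPotential U f F x₁ p (fun i => ζ i ω) (fun j => ξ j ω) k)
    (q := fun k ω => p.η / (16 * G) * ‖iterGrad U f F x₁ p (fun i => ζ i ω) (fun j => ξ j ω) k‖ ^ 2
      + p.lam / (16 * p.η) * ‖iterStep U F x₁ p (fun i => ζ i ω) (fun j => ξ j ω) k‖ ^ 2
      - 2 * p.η * p.β * σ ^ 2 / p.lam)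
    (M := fun k ω => 2 * (p.η / (p.lam * p.β)) * (1 - p.β)
      * inner ℝ (iterError U f F x₁ p (fun i => ζ i ω) (fun j => ξ j ω) k)
        (iterNoise U f F x₁ p (fun i => ζ i ω) (fun j => ξ j ω) k (1 - p.β)))
    hAm (fun k _ => aliveSet_anti (Nat.le_succ k)) (fun k hk => (hmeas k hk).aestronglyMeasurable)
    hΦ0i.integrableOn
    (fun k _ => Filter.Eventually.of_forall fun ω _ => iterPotential_nonneg hP)
    hqi
    (fun k hk => Integrable.const_mul (integrableOn_inner_iterNoise hP hN hI (by omega) hx₁ hS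
      (hAm k hk.le) ((hpast k hk).mono (hI.pastSigma_le k) le_rfl) (K := p.lam * D) (by
        filter_upwards [hreg] with ω h hω
        exact (h.2 k (by omega) hω).norm_iterError_le) _) _)
    (fun k hk => by
      rw [integral_const_mul, setIntegral_inner_iterNoise hP hN hI (by omega)
        (measurableSet_pastSigma_aliveSet hP hN (by omega)) (hpast k hk), mul_zero])
    (fun k hk => by
      filter_upwards [hreg] with ω h hω
      exact (h.2 k (by omega) hω).iterPotential_succ_le hP h.1 (by omega))
  obtain ⟨hin, hik, hsum⟩ := key
  refine ⟨hik, ?_⟩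
  have hlast : p.η / (16 * G) * ∫ ω in aliveSet U f F x₁ L G D p ζ ξ n,
        ‖iterGrad U f F x₁ p (fun i => ζ i ω) (fun j => ξ j ω) n‖ ^ 2 ∂μ
      ≤ ∫ ω in aliveSet U f F x₁ L G D p ζ ξ n,
        iterPotential U f F x₁ p (fun i => ζ i ω) (fun j => ξ j ω) n ∂μ := by
    rw [← integral_const_mul]
    refine integral_mono_ae ((hgi n le_rfl).const_mul _) hin
      ((ae_restrict_iff' (hAm n le_rfl)).2 ?_)
    filter_upwards [hreg] with ω h hω
    exact (h.2 n (by omega) hω).sq_norm_iterGrad_le hP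
  have hinit : ∫ ω in aliveSet U f F x₁ L G D p ζ ξ 0,
      iterPotential U f F x₁ p (fun i => ζ i ω) (fun j => ξ j ω) 0 ∂μ
      ≤ f x₁ - sInf (f '' U) + p.η / (p.lam * p.β) * (σ ^ 2 / p.S₁) := by
    refine (setIntegral_le_integral hΦ0i
      (Filter.Eventually.of_forall fun ω => iterPotential_nonneg hP)).trans ?_
    simp only [hΦ0]
    rw [integral_add (integrable_const _) (herr.const_mul _), integral_const_mul]
    have h1 := integral_sq_norm_iterError_zero_le hP hN hI hx₁ hS
    have h2 : 0 ≤ p.η / (p.lam * p.β) := by positivity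
    have h3 := mul_le_mul_of_nonneg_left h1 h2
    simpa using h3
  have hq : ∀ k ∈ Finset.range n,
      p.η / (16 * G) * ∫ ω in aliveSet U f F x₁ L G D p ζ ξ k,
        ‖iterGrad U f F x₁ p (fun i => ζ i ω) (fun j => ξ j ω) k‖ ^ 2 ∂μ
      + p.lam / (16 * p.η) * ∫ ω in aliveSet U f F x₁ L G D p ζ ξ k,
        ‖iterStep U F x₁ p (fun i => ζ i ω) (fun j => ξ j ω) k‖ ^ 2 ∂μ
      - 2 * p.η * p.β * σ ^ 2 / p.lam
      ≤ ∫ ω in aliveSet U f F x₁ L G D p ζ ξ k,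
        (p.η / (16 * G) * ‖iterGrad U f F x₁ p (fun i => ζ i ω) (fun j => ξ j ω) k‖ ^ 2
        + p.lam / (16 * p.η) * ‖iterStep U F x₁ p (fun i => ζ i ω) (fun j => ξ j ω) k‖ ^ 2
        - 2 * p.η * p.β * σ ^ 2 / p.lam) ∂μ := by
    intro k hk
    have hk' := (Finset.mem_range.1 hk).le
    have i1 := (hgi k hk').const_mul (p.η / (16 * G))
    have i2 := (hsi k hk').const_mul (p.lam / (16 * p.η))
    have e1 := integral_sub (i1.add i2) (integrable_const (2 * p.η * p.β * σ ^ 2 / p.lam))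
    have e2 := integral_add i1 i2
    simp only [Pi.add_apply] at e1
    rw [e1, e2, integral_const_mul, integral_const_mul, integral_const, smul_eq_mul]
    have h1 : (μ.restrict (aliveSet U f F x₁ L G D p ζ ξ k)).real Set.univ ≤ 1 := by
      rw [measureReal_restrict_apply_univ]
      exact measureReal_le_one
    have h2 : 0 ≤ 2 * p.η * p.β * σ ^ 2 / p.lam := by positivity
    have h3 := mul_le_of_le_one_left h2 h1
    linarith
  have hqs := Finset.sum_le_sum hq
  rw [Finset.sum_sub_distrib, Finset.sum_add_distrib, ← Finset.mul_sum, ← Finset.mul_sum,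
    Finset.sum_const, Finset.card_range, nsmul_eq_mul] at hqs
  rw [Finset.sum_range_succ, mul_add]
  linarith

/-- The sixth power of the correction summed over the iterations. -/
theorem sum_correction_le (hP : IsTunedProblem U f F L₀ Lρ ρ L σ G D p)
    (hN : IsBoundedNoise U f F P σ) (hI : IsIIDSampling μ P p.S₁ p.T ζ ξ) (hx₁ : x₁ ∈ U)
    (hg₁ : ‖gradient f x₁‖ ≤ G) (hS : 1 ≤ p.S₁) {n : ℕ} (hn : n + 1 = p.T) :
    (∀ k < n, IntegrableOn
      (fun ω => ‖domCorrection U f F x₁ p (fun i => ζ i ω) (fun j => ξ j ω) (k + 1)‖ ^ 6)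
      (aliveSet U f F x₁ L G D p ζ ξ k) μ) ∧
    ∑ k ∈ Finset.range n,
        ∫ ω in aliveSet U f F x₁ L G D p ζ ξ k \ aliveSet U f F x₁ L G D p ζ ξ (k + 1),
          ‖domCorrection U f F x₁ p (fun i => ζ i ω) (fun j => ξ j ω) (k + 1)‖ ^ 6 ∂μ
      ≤ 2 * 40 ^ 3 * (D ^ 2 * p.lam ^ 3 / (100 * G)) ^ 2 * (4 * L ^ 2)
        * ∑ k ∈ Finset.range n, ∫ ω in aliveSet U f F x₁ L G D p ζ ξ k,
          ‖iterStep U F x₁ p (fun i => ζ i ω) (fun j => ξ j ω) k‖ ^ 2 ∂μ := by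
  have hreg := ae_isRegularState hP hN hI hx₁ hg₁ hS
  have hAm : ∀ k ≤ n, MeasurableSet (aliveSet U f F x₁ L G D p ζ ξ k) := fun k hk =>
    measurableSet_aliveSet hP hN hI (by omega)
  have hsi : ∀ k ≤ n, IntegrableOn
      (fun ω => ‖iterStep U F x₁ p (fun i => ζ i ω) (fun j => ξ j ω) k‖ ^ 2)
      (aliveSet U f F x₁ L G D p ζ ξ k) μ := fun k hk =>
    integrableOn_sq_norm_iterStep hP hN hI hx₁ hg₁ hS (by omega)
  have hmeas : ∀ k ≤ n, Measurable
      (fun ω => domCorrection U f F x₁ p (fun i => ζ i ω) (fun j => ξ j ω) k) := fun k hk =>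
    measurable_domCorrection hP.objective.isOpen hP.smooth hP.smooth_component hN
      hI.measurable_batch (hI.measurable_upTo (by omega))
  have hpast : ∀ k < n, Measurable[pastSigma p.T ζ ξ k]
      (fun ω => ‖domCorrection U f F x₁ p (fun i => ζ i ω) (fun j => ξ j ω) k‖ ^ 4
        • domCorrection U f F x₁ p (fun i => ζ i ω) (fun j => ξ j ω) k) := fun k hk => by
    have h1 := @measurable_domCorrection d Ξ _ U f F P L₀ Lρ ρ σ Ω (pastSigma p.T ζ ξ k) p x₁ ζ ξ
      hP.objective.isOpen hP.smooth hP.smooth_component hN (measurable_batch_pastSigma k) k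
      fun j hj => measurable_sample_pastSigma (by omega) hj
    exact (by fun_prop : Continuous fun v : EuclideanSpace ℝ (Fin d) => ‖v‖ ^ 4 • v).measurable.comp h1
  have key := setIntegral_drift (μ := μ) (n := n) (A := aliveSet U f F x₁ L G D p ζ ξ)
    (Φ := fun k ω => ‖domCorrection U f F x₁ p (fun i => ζ i ω) (fun j => ξ j ω) k‖ ^ 6)
    (q := fun k ω => -(2 * 40 ^ 3 * (D ^ 2 * p.lam ^ 3 / (100 * G)) ^ 2 * (4 * L ^ 2)
          * ‖iterStep U F x₁ p (fun i => ζ i ω) (fun j => ξ j ω) k‖ ^ 2))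
    (M := fun k ω => 6 * (1 - p.β) ^ 6
      * inner ℝ (‖domCorrection U f F x₁ p (fun i => ζ i ω) (fun j => ξ j ω) k‖ ^ 4
          • domCorrection U f F x₁ p (fun i => ζ i ω) (fun j => ξ j ω) k)
        (iterNoise U f F x₁ p (fun i => ζ i ω) (fun j => ξ j ω) k 1))
    hAm (fun k _ => aliveSet_anti (Nat.le_succ k))
    (fun k hk => ((hmeas k hk).norm.pow_const 6).aestronglyMeasurable)
    (by simp [domCorrection])
    (fun k _ => Filter.Eventually.of_forall fun ω _ => by positivity)
    (fun k hk => ((hsi k hk.le).const_mul _).neg)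
    (fun k hk => Integrable.const_mul (integrableOn_inner_iterNoise hP hN hI (by omega) hx₁ hS
      (hAm k hk.le) ((hpast k hk).mono (hI.pastSigma_le k) le_rfl)
      (K := (p.lam * D / 2) ^ 4 * (p.lam * D / 2)) (Filter.Eventually.of_forall fun ω hω => by
        have h1 := (hω k le_rfl).2.2
        rw [norm_smul, norm_pow, norm_norm]
        have := (norm_nonneg _).trans h1
        gcongr) _) _)
    (fun k hk => by
      rw [integral_const_mul, setIntegral_inner_iterNoise hP hN hI (by omega)
        (measurableSet_pastSigma_aliveSet hP hN (by omega)) (hpast k hk), mul_zero])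
    (fun k hk => by
      filter_upwards [hreg] with ω h hω
      exact (h.2 k (by omega) hω).correction_succ_le hP h.1 (by omega))
  obtain ⟨-, hik, hsum⟩ := key
  refine ⟨hik, ?_⟩
  -- The correction starts from zero, so everything comes from the squared steps.
  have h0 : ∫ ω in aliveSet U f F x₁ L G D p ζ ξ 0,
      ‖domCorrection U f F x₁ p (fun i => ζ i ω) (fun j => ξ j ω) 0‖ ^ 6 ∂μ = 0 := by
    simp [domCorrection]
  have h1 : 0 ≤ ∫ ω in aliveSet U f F x₁ L G D p ζ ξ n,
      ‖domCorrection U f F x₁ p (fun i => ζ i ω) (fun j => ξ j ω) n‖ ^ 6 ∂μ :=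
    integral_nonneg fun ω => by positivity
  simp only [integral_neg, integral_const_mul, Finset.sum_neg_distrib, ← Finset.mul_sum] at hsum
  linarith

/-- The probability that the trajectory dies. -/
theorem measureReal_compl_aliveSet_le (hP : IsTunedProblem U f F L₀ Lρ ρ L σ G D p)
    (hN : IsBoundedNoise U f F P σ) (hI : IsIIDSampling μ P p.S₁ p.T ζ ξ) (hx₁ : x₁ ∈ U)
    (hg₁ : ‖gradient f x₁‖ ≤ G) (hΔ : f x₁ - sInf (f '' U) ≤ G ^ 2 / (6 * L)) (hS : 1 ≤ p.S₁)
    {n : ℕ} (hn : n + 1 = p.T) :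
    μ.real (aliveSet U f F x₁ L G D p ζ ξ n)ᶜ
      ≤ 6 * L / G ^ 2 * ∑ k ∈ Finset.range n,
        ∫ ω in aliveSet U f F x₁ L G D p ζ ξ k \ aliveSet U f F x₁ L G D p ζ ξ (k + 1),
          iterPotential U f F x₁ p (fun i => ζ i ω) (fun j => ξ j ω) (k + 1) ∂μ
        + (2 / (p.lam * D)) ^ 6 * ∑ k ∈ Finset.range n,
        ∫ ω in aliveSet U f F x₁ L G D p ζ ξ k \ aliveSet U f F x₁ L G D p ζ ξ (k + 1),
          ‖domCorrection U f F x₁ p (fun i => ζ i ω) (fun j => ξ j ω) (k + 1)‖ ^ 6 ∂μ := by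
  have hreg := ae_isRegularState hP hN hI hx₁ hg₁ hS
  have hAm : ∀ k ≤ n, MeasurableSet (aliveSet U f F x₁ L G D p ζ ξ k) := fun k hk =>
    measurableSet_aliveSet hP hN hI (by omega)
  have hi1 := (sum_iterPotential_le hP hN hI hx₁ hg₁ hS hn).1
  have hi2 := (sum_correction_le hP hN hI hx₁ hg₁ hS hn).1
  have hdie : ∀ k ∈ Finset.range n,
      μ.real (aliveSet U f F x₁ L G D p ζ ξ k \ aliveSet U f F x₁ L G D p ζ ξ (k + 1))
      ≤ 6 * L / G ^ 2
        * ∫ ω in aliveSet U f F x₁ L G D p ζ ξ k \ aliveSet U f F x₁ L G D p ζ ξ (k + 1),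
          iterPotential U f F x₁ p (fun i => ζ i ω) (fun j => ξ j ω) (k + 1) ∂μ
        + (2 / (p.lam * D)) ^ 6
        * ∫ ω in aliveSet U f F x₁ L G D p ζ ξ k \ aliveSet U f F x₁ L G D p ζ ξ (k + 1),
          ‖domCorrection U f F x₁ p (fun i => ζ i ω) (fun j => ξ j ω) (k + 1)‖ ^ 6 ∂μ := by
    intro k hk
    have hk' := Finset.mem_range.1 hk
    have hms := (hAm k hk'.le).diff (hAm (k + 1) hk')
    have j1 := ((hi1 k hk').mono_set (Set.sdiff_subset
      (t := aliveSet U f F x₁ L G D p ζ ξ (k + 1)))).const_mul (6 * L / G ^ 2)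
    have j2 := ((hi2 k hk').mono_set (Set.sdiff_subset
      (t := aliveSet U f F x₁ L G D p ζ ξ (k + 1)))).const_mul ((2 / (p.lam * D)) ^ 6)
    rw [← integral_const_mul, ← integral_const_mul, ← integral_add j1 j2]
    -- Markov's inequality at the time of death: there one of the two normalized quantities exceeds
    -- 1.
    have e1 : μ.real (aliveSet U f F x₁ L G D p ζ ξ k \ aliveSet U f F x₁ L G D p ζ ξ (k + 1))
        = ∫ _ω in aliveSet U f F x₁ L G D p ζ ξ k \ aliveSet U f F x₁ L G D p ζ ξ (k + 1),
          (1 : ℝ) ∂μ := by simp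
    rw [e1]
    refine integral_mono_ae (integrable_const _) (j1.add j2) ((ae_restrict_iff' hms).2 ?_)
    filter_upwards [hreg] with ω h hω
    exact (h.2 k (by omega) hω.1).one_le_of_not_isAlive hP hω.1 hω.2
  -- The run is alive at the start, so the failure event is the disjoint union of the deaths at the
  -- successive iterations.
  have htel : ∀ m ≤ n, μ.real (aliveSet U f F x₁ L G D p ζ ξ m)ᶜ = ∑ k ∈ Finset.range m,
      μ.real (aliveSet U f F x₁ L G D p ζ ξ k \ aliveSet U f F x₁ L G D p ζ ξ (k + 1)) := by
    intro m hm
    induction m with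
    | zero => simp [aliveSet_zero hP hx₁ hΔ]
    | succ m ih =>
      rw [Finset.sum_range_succ, ← ih (by omega), probReal_compl_eq_one_sub (hAm _ hm),
        probReal_compl_eq_one_sub (hAm m (by omega)),
        measureReal_sdiff (aliveSet_anti (Nat.le_succ m)) (hAm _ hm)]
      ring
  rw [htel n le_rfl, Finset.mul_sum, Finset.mul_sum, ← Finset.sum_add_distrib]
  exact Finset.sum_le_sum hdie

/-- The probability that the average of the squared gradients is large on a trajectory that stays
alive. -/
theorem measureReal_large_average_le (hP : IsTunedProblem U f F L₀ Lρ ρ L σ G D p)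
    (hN : IsBoundedNoise U f F P σ) (hI : IsIIDSampling μ P p.S₁ p.T ζ ξ) (hx₁ : x₁ ∈ U)
    (hg₁ : ‖gradient f x₁‖ ≤ G) (hS : 1 ≤ p.S₁) {n : ℕ} (hn : n + 1 = p.T) (M : ℝ) :
    M * μ.real (aliveSet U f F x₁ L G D p ζ ξ n ∩ {ω | M ≤ ∑ k ∈ Finset.range (n + 1),
        ‖iterGrad U f F x₁ p (fun i => ζ i ω) (fun j => ξ j ω) k‖ ^ 2})
      ≤ ∑ k ∈ Finset.range (n + 1), ∫ ω in aliveSet U f F x₁ L G D p ζ ξ k,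
        ‖iterGrad U f F x₁ p (fun i => ζ i ω) (fun j => ξ j ω) k‖ ^ 2 ∂μ := by
  have hAm := measurableSet_aliveSet (x₁ := x₁) (k := n) hP hN hI (by omega)
  have hgi : ∀ k ∈ Finset.range (n + 1), IntegrableOn
      (fun ω => ‖iterGrad U f F x₁ p (fun i => ζ i ω) (fun j => ξ j ω) k‖ ^ 2)
      (aliveSet U f F x₁ L G D p ζ ξ k) μ := fun k hk =>
    integrableOn_sq_norm_iterGrad hP hN hI hx₁ hg₁ hS (by have := Finset.mem_range.1 hk; omega)
  have hgn : ∀ k ∈ Finset.range (n + 1), IntegrableOn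
      (fun ω => ‖iterGrad U f F x₁ p (fun i => ζ i ω) (fun j => ξ j ω) k‖ ^ 2)
      (aliveSet U f F x₁ L G D p ζ ξ n) μ := fun k hk =>
    (hgi k hk).mono_set (aliveSet_anti (by have := Finset.mem_range.1 hk; omega))
  have h1 := mul_meas_ge_le_integral_of_nonneg (μ := μ.restrict (aliveSet U f F x₁ L G D p ζ ξ n))
    (f := fun ω => ∑ k ∈ Finset.range (n + 1),
      ‖iterGrad U f F x₁ p (fun i => ζ i ω) (fun j => ξ j ω) k‖ ^ 2)
    (Filter.Eventually.of_forall fun ω => Finset.sum_nonneg fun k _ => by positivity)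
    (integrable_finsetSum _ hgn) M
  rw [measureReal_restrict_apply' hAm, integral_finsetSum _ hgn, Set.inter_comm] at h1
  -- The run that is alive at the end was alive at every earlier time, so each integral may be
  -- enlarged to the earlier event.
  refine h1.trans (Finset.sum_le_sum fun k hk => ?_)
  exact setIntegral_mono_set (hgi k hk) (Filter.Eventually.of_forall fun ω => by positivity)
    (aliveSet_anti (by have := Finset.mem_range.1 hk; omega)).eventuallyLE

end Summation

/-! ### The convergence guarantee -/

section Convergence

theorem mul_le_of_le_mul_extDiv {η c a b : ℝ} (hc : 0 ≤ c) (ha : 0 ≤ a) (hb : 0 ≤ b)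
    (h : ENNReal.ofReal η ≤ ENNReal.ofReal c * extDiv a b) : η * b ≤ c * a := by
  rcases hb.eq_or_lt with rfl | hb
  · rw [mul_zero]; positivity
  · rw [extDiv, ← ENNReal.ofReal_div_of_pos hb, ← ENNReal.ofReal_mul hc,
      ENNReal.ofReal_le_ofReal_iff (by positivity), mul_div_assoc', le_div_iff₀ hb] at h
    exact h

/-- The tail bound of the analysis, for parameters that satisfy the required inequalities. -/
theorem ofReal_le_measure_of_tuned {d : ℕ} {Ξ Ω : Type*} [MeasurableSpace Ξ] [MeasurableSpace Ω]
    {U : Set (EuclideanSpace ℝ (Fin d))}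
    {f : EuclideanSpace ℝ (Fin d) → ℝ} {F : EuclideanSpace ℝ (Fin d) → Ξ → ℝ}
    {x₁ : EuclideanSpace ℝ (Fin d)} {p : VRAdamInput} {L₀ Lρ ρ L σ G D δ ε : ℝ} {P : Measure Ξ}
    {ζ : Fin p.S₁ → Ω → Ξ} {ξ : ℕ → Ω → Ξ} {μ : Measure Ω} [IsProbabilityMeasure μ]
    [IsProbabilityMeasure P] (hP : IsTunedProblem U f F L₀ Lρ ρ L σ G D p)
    (hN : IsBoundedNoise U f F P σ) (hI : IsIIDSampling μ P p.S₁ p.T ζ ξ) (hx₁ : x₁ ∈ U)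
    (hg₁ : ‖gradient f x₁‖ ≤ G) (hS : 1 ≤ p.S₁) (hδ : 0 < δ) (hδ1 : δ < 1)
    (hΔpos : 0 < f x₁ - sInf (f '' U))
    (hΔ : 1000 * (f x₁ - sInf (f '' U)) * L * D ≤ 7 * G ^ 2 * δ)
    (hT : 1000 * G * (f x₁ - sInf (f '' U)) ≤ p.T * ε ^ 2 * (p.η * δ)) (hT1 : 1 ≤ p.T)
    (hnoise : p.η / (p.lam * p.β) * (σ ^ 2 / p.S₁) + p.T * (2 * p.η * p.β * σ ^ 2 / p.lam)
      ≤ f x₁ - sInf (f '' U)) :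
    ENNReal.ofReal (1 - δ) ≤
      μ {ω | (∀ t ∈ Finset.Icc 1 p.T,
          vrAdamIterate p (stochGrad F) x₁ (fun i => ζ i ω) (fun s => ξ s ω) t ∈ U ∧
          ‖gradient f (vrAdamIterate p (stochGrad F) x₁ (fun i => ζ i ω) (fun s => ξ s ω) t)‖ ≤ G) ∧
        1 / (p.T : ℝ) * ∑ t ∈ Finset.Icc 1 p.T, ‖gradient f
          (vrAdamIterate p (stochGrad F) x₁ (fun i => ζ i ω) (fun s => ξ s ω) t)‖ ^ 2 ≤ ε ^ 2} := by
  obtain ⟨n, hn⟩ : ∃ n, n + 1 = p.T := ⟨p.T - 1, by omega⟩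
  have hη := hP.tuned.η_pos
  have hlam := hP.tuned.lam_pos
  have hG := hP.tuned.G_pos
  have hL := hP.tuned.L_pos
  have hD := hP.tuned.one_le_D
  have hβ := hP.tuned.β_pos
  have hσ := hP.tuned.σ_nonneg
  have hT0 : (0 : ℝ) < p.T := by exact_mod_cast hT1
  set Δ := f x₁ - sInf (f '' U) with hΔdef
  have hLΔ : 1000 * (L * Δ) ≤ 7 * G ^ 2 * δ := by
    refine le_trans ?_ hΔ
    have := mul_le_mul_of_nonneg_left hD (by positivity : 0 ≤ 1000 * Δ * L)
    linarith
  have hA : Δ ≤ G ^ 2 / (6 * L) := by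
    rw [le_div_iff₀ (by positivity)]
    nlinarith [mul_pos hL hΔpos, mul_lt_mul_of_pos_left hδ1 (by positivity : 0 < G ^ 2)]
  have hpot := (sum_iterPotential_le hP hN hI hx₁ hg₁ hS hn).2
  have hcor := (sum_correction_le hP hN hI hx₁ hg₁ hS hn).2
  have hdead := measureReal_compl_aliveSet_le hP hN hI hx₁ hg₁ hA hS hn
  have havg := measureReal_large_average_le hP hN hI hx₁ hg₁ hS hn (p.T * ε ^ 2)
  have hAm := measurableSet_aliveSet (x₁ := x₁) (k := n) hP hN hI (by omega)
  have hreg := ae_isRegularState hP hN hI hx₁ hg₁ hS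
  set Al := aliveSet U f F x₁ L G D p ζ ξ with hAl
  set sg := ∑ k ∈ Finset.range (n + 1), ∫ ω in Al k,
    ‖iterGrad U f F x₁ p (fun i => ζ i ω) (fun j => ξ j ω) k‖ ^ 2 ∂μ with hsg
  set V := ∑ k ∈ Finset.range n, ∫ ω in Al k,
    ‖iterStep U F x₁ p (fun i => ζ i ω) (fun j => ξ j ω) k‖ ^ 2 ∂μ with hV
  set I := ∑ k ∈ Finset.range n, ∫ ω in Al k \ Al (k + 1),
    iterPotential U f F x₁ p (fun i => ζ i ω) (fun j => ξ j ω) (k + 1) ∂μ with hIdef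
  set J := ∑ k ∈ Finset.range n, ∫ ω in Al k \ Al (k + 1),
    ‖domCorrection U f F x₁ p (fun i => ζ i ω) (fun j => ξ j ω) (k + 1)‖ ^ 6 ∂μ with hJ
  have hsg0 : 0 ≤ sg := Finset.sum_nonneg fun k _ => integral_nonneg fun ω => by positivity
  have hV0 : 0 ≤ V := Finset.sum_nonneg fun k _ => integral_nonneg fun ω => by positivity
  have hI0 : 0 ≤ I := Finset.sum_nonneg fun k _ => integral_nonneg fun ω => iterPotential_nonneg hP
  -- One Δ is the initial gap, the other pays for the initial batch error and the accumulated noise.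
  have htot : p.η / (16 * G) * sg + p.lam / (16 * p.η) * V + I ≤ 2 * Δ := by
    have h1 : (n : ℝ) * (2 * p.η * p.β * σ ^ 2 / p.lam)
        ≤ p.T * (2 * p.η * p.β * σ ^ 2 / p.lam) := by
      have : (n : ℝ) ≤ p.T := by exact_mod_cast (by omega : n ≤ p.T)
      gcongr
    linarith
  have hsg' : 0 ≤ p.η / (16 * G) * sg := by positivity
  have hV' : 0 ≤ p.lam / (16 * p.η) * V := by positivity
  have hsgle : sg ≤ 32 * G * Δ / p.η := by
    have h1 : p.η / (16 * G) * sg ≤ 2 * Δ := by linarith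
    rw [le_div_iff₀ hη]
    rw [div_mul_eq_mul_div, div_le_iff₀ (by positivity)] at h1
    linarith
  have hVle : V ≤ 32 * p.η * Δ / p.lam := by
    have h1 : p.lam / (16 * p.η) * V ≤ 2 * Δ := by linarith
    rw [le_div_iff₀ hlam]
    rw [div_mul_eq_mul_div, div_le_iff₀ (by positivity)] at h1
    linarith
  have hfail : μ.real (Al n)ᶜ ≤ 158 / 1000 * δ := by
    have h1 : 6 * L / G ^ 2 * I ≤ 84 / 1000 * δ := by
      calc 6 * L / G ^ 2 * I ≤ 6 * L / G ^ 2 * (2 * Δ) := by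
            gcongr
            linarith
        _ = 12 * (L * Δ) / G ^ 2 := by ring
        _ ≤ 84 / 1000 * δ := by
            rw [div_le_iff₀ (by positivity)]
            linarith
    -- Here the powers match: after inserting the bound on V, only ηL/λ, LΔ/G² and D⁻² are left, the
    -- first two being small by the choice of η and of G.
    have h2 : (2 / (p.lam * D)) ^ 6 * J ≤ 74 / 1000 * δ := by
      have hD0 : 0 < D := by linarith
      calc (2 / (p.lam * D)) ^ 6 * J
          ≤ (2 / (p.lam * D)) ^ 6 * (2 * 40 ^ 3 * (D ^ 2 * p.lam ^ 3 / (100 * G)) ^ 2 * (4 * L ^ 2)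
            * (32 * p.η * Δ / p.lam)) := by
            gcongr
            refine hcor.trans ?_
            gcongr
        _ = 104857.6 * (p.η * L) * (L * Δ) / (p.lam * G ^ 2 * D ^ 2) := by
            field_simp
            ring
        _ ≤ 104857.6 * (p.lam / 10000) * (7 * G ^ 2 * δ / 1000) / (p.lam * G ^ 2 * D ^ 2) := by
            have := hP.tuned.η_le_lam
            gcongr
            · linarith
            · linarith
        _ = 104857.6 / 10000 * 7 / 1000 * δ / D ^ 2 := by field_simp
        _ ≤ 104857.6 / 10000 * 7 / 1000 * δ / 1 := by
            gcongr
            exact one_le_pow₀ hD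
        _ ≤ 74 / 1000 * δ := by linarith
    linarith
  set B := Al n ∩ {ω | p.T * ε ^ 2 ≤ ∑ k ∈ Finset.range (n + 1),
    ‖iterGrad U f F x₁ p (fun i => ζ i ω) (fun j => ξ j ω) k‖ ^ 2} with hB
  have hBle : μ.real B ≤ 32 / 1000 * δ := by
    have h1 : 1000 * G * Δ / (p.η * δ) * μ.real B ≤ 32 * G * Δ / p.η := by
      refine le_trans ?_ (havg.trans hsgle)
      gcongr
      rw [div_le_iff₀ (by positivity)]
      exact hT
    have h2 : 1000 * G * Δ / (p.η * δ) * μ.real B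
        = 1000 * (G * Δ / p.η) * (μ.real B / δ) := by field_simp
    have h3 : 32 * G * Δ / p.η = 1000 * (G * Δ / p.η) * (32 / 1000) := by ring
    rw [h2, h3] at h1
    have h4 := le_of_mul_le_mul_left h1 (by positivity)
    rwa [div_le_iff₀ hδ] at h4
  -- The total failure probability is at most (0.158 + 0.032)δ.
  have hgood : 1 - δ ≤ μ.real (Al n \ B) := by
    have h1 : μ.real (Al n) ≤ μ.real (Al n \ B) + μ.real B := by
      refine (measureReal_mono ?_).trans (measureReal_union_le _ _)
      rw [Set.sdiff_union_self]
      exact Set.subset_union_left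
    have h2 := probReal_compl_eq_one_sub (μ := μ) hAm
    rw [h2] at hfail
    linarith
  refine (ENNReal.ofReal_le_ofReal hgood).trans ?_
  rw [ofReal_measureReal]
  refine measure_mono_ae ?_
  filter_upwards [hreg] with ω hω hmem
  obtain ⟨hal, hnB⟩ := hmem
  have hsum : ∑ k ∈ Finset.range (n + 1),
      ‖iterGrad U f F x₁ p (fun i => ζ i ω) (fun j => ξ j ω) k‖ ^ 2 < p.T * ε ^ 2 := by
    by_contra hcon
    exact hnB ⟨hal, not_lt.1 hcon⟩
  have heq := vrAdamState_eq_domState (U := U) (F := F) (x₁ := x₁) (p := p) (ζ := fun i => ζ i ω)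
    (ξ := fun j => ξ j ω) (n := n) fun k hk => (hal k hk).1
  have hit : ∀ t ∈ Finset.Icc 1 p.T,
      vrAdamIterate p (stochGrad F) x₁ (fun i => ζ i ω) (fun s => ξ s ω) t
        = (domState U F x₁ p (fun i => ζ i ω) (fun j => ξ j ω) (t - 1)).x := fun t ht => by
    rw [vrAdamIterate, heq (t - 1) (by have := Finset.mem_Icc.1 ht; omega)]
  have hregt : ∀ k ≤ n, IsRegularState U f σ G D p k
      (domState U F x₁ p (fun i => ζ i ω) (fun j => ξ j ω) k)
      (domCorrection U f F x₁ p (fun i => ζ i ω) (fun j => ξ j ω) k) := fun k hk =>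
    hω.2 k (by omega) (IsAlive.mono hal hk)
  refine ⟨fun t ht => ?_, ?_⟩
  · rw [hit t ht]
    have hr := hregt (t - 1) (by have := Finset.mem_Icc.1 ht; omega)
    exact ⟨hr.mem, hr.gradient_le⟩
  · have e1 : ∑ t ∈ Finset.Icc 1 p.T, ‖gradient f
        (vrAdamIterate p (stochGrad F) x₁ (fun i => ζ i ω) (fun s => ξ s ω) t)‖ ^ 2
        = ∑ k ∈ Finset.range (n + 1),
          ‖iterGrad U f F x₁ p (fun i => ζ i ω) (fun j => ξ j ω) k‖ ^ 2 := by
      refine Finset.sum_nbij' (fun t => t - 1) (fun k => k + 1) ?_ ?_ ?_ ?_ ?_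
      · intro t ht; simp at ht ⊢; omega
      · intro k hk; simp at hk ⊢; omega
      · intro t ht; simp at ht ⊢; omega
      · intro k hk; simp
      · intro t ht
        rw [hit t ht, (hregt (t - 1) (by have := Finset.mem_Icc.1 ht; omega)).iterGrad_eq]
    rw [e1, one_div, inv_mul_le_iff₀ hT0]
    exact hsum.le

/-- The convergence guarantee for admissible parameters. -/
theorem ofReal_le_measure_of_isAdmissible {d : ℕ} {Ξ Ω : Type*} [MeasurableSpace Ξ]
    [MeasurableSpace Ω] {U : Set (EuclideanSpace ℝ (Fin d))}
    {f : EuclideanSpace ℝ (Fin d) → ℝ} {F : EuclideanSpace ℝ (Fin d) → Ξ → ℝ}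
    {x₁ : EuclideanSpace ℝ (Fin d)} {p : VRAdamInput} {L₀ Lρ ρ σ G δ ε : ℝ} {P : Measure Ξ}
    {ζ : Fin p.S₁ → Ω → Ξ} {ξ : ℕ → Ω → Ξ} {μ : Measure Ω} [IsProbabilityMeasure μ]
    [IsProbabilityMeasure P] (hL₀ : 0 ≤ L₀) (hLρ : 0 ≤ Lρ) (hρ : 0 ≤ ρ) (hρ2 : ρ < 2) (hσ : 0 ≤ σ)
    (hδ : 0 < δ) (hδ1 : δ < 1) (hε : 0 < ε) (hO : IsObjective U f) (hx₁ : x₁ ∈ U)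
    (hf : IsGenSmoothOn U f L₀ Lρ ρ) (hF : ∀ s, IsGenSmoothOn U (fun x => F x s) L₀ Lρ ρ)
    (hN : IsBoundedNoise U f F P σ) (hI : IsIIDSampling μ P p.S₁ p.T ζ ξ)
    (hA : IsAdmissible (1 / 10000) 1000 d L₀ Lρ ρ σ (f x₁ - sInf (f '' U)) ‖gradient f x₁‖ δ ε G p) :
    ENNReal.ofReal (1 - δ) ≤
      μ {ω | (∀ t ∈ Finset.Icc 1 p.T,
          vrAdamIterate p (stochGrad F) x₁ (fun i => ζ i ω) (fun s => ξ s ω) t ∈ U ∧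
          ‖gradient f (vrAdamIterate p (stochGrad F) x₁ (fun i => ζ i ω) (fun s => ξ s ω) t)‖ ≤ G) ∧
        1 / (p.T : ℝ) * ∑ t ∈ Finset.Icc 1 p.T, ‖gradient f
          (vrAdamIterate p (stochGrad F) x₁ (fun i => ζ i ω) (fun s => ξ s ω) t)‖ ^ 2 ≤ ε ^ 2} := by
  have hlam := hA.lam_pos
  have hG := hA.G_pos
  have hη := hA.η_pos
  have hβ₂ := hA.β₂_pos
  have hprob : ENNReal.ofReal (1 - δ) ≤ μ Set.univ := by
    rw [measure_univ]; exact ENNReal.ofReal_le_one.2 (by linarith)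
  -- A vanishing gap gives T = 0, and then both claims are about an empty range of iterations.
  rcases (hO.gap_nonneg hx₁).eq_or_lt with h0 | hΔpos
  · have hT0 : p.T = 0 := by rw [hA.T_eq, ← h0]; simp
    refine hprob.trans (measure_mono fun ω _ => ?_)
    have : Finset.Icc 1 p.T = ∅ := by rw [hT0]; simp
    simp only [Set.mem_ofPred_eq, this, Finset.sum_empty, mul_zero]
    exact ⟨by simp, by positivity⟩
  set Δ := f x₁ - sInf (f '' U) with hΔdef
  set L := effSmooth L₀ Lρ ρ G with hLdef
  have hGρ : 0 < G ^ ρ := Real.rpow_pos_of_pos hG ρ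
  -- L = 0 would force L₀ = Lρ = 0, and then x₁ would be a minimizer, against Δ > 0.
  have hL : 0 < L := by
    by_contra hcon
    have h1 : 0 ≤ Lρ * G ^ ρ := by positivity
    have h2 : 3 * L₀ + 4 * Lρ * G ^ ρ ≤ 0 := not_lt.1 hcon
    have h3 : L₀ = 0 := by linarith
    have h4 : Lρ = 0 := by
      rcases mul_eq_zero.1 (by linarith : Lρ * G ^ ρ = 0) with h | h
      · exact h
      · exact absurd h hGρ.ne'
    subst h3 h4
    exact hΔpos.ne' (hO.gap_eq_zero hf hρ hx₁)
  have heff : IsEffSmooth L₀ Lρ ρ G L := by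
    refine ⟨hLρ, hρ, hG, hL, ?_⟩
    rw [Real.mul_rpow zero_le_two hG.le, hLdef, effSmooth]
    -- This is where ρ < 2 gives the strict inequality that the barrier argument needs.
    have h2 : (2 : ℝ) ^ ρ < 4 := by
      calc (2 : ℝ) ^ ρ < 2 ^ (2 : ℝ) := Real.rpow_lt_rpow_of_exponent_lt one_lt_two hρ2
        _ = 4 := by norm_num
    rcases hLρ.eq_or_lt with h | h
    · rw [hLdef, effSmooth, ← h] at hL
      rw [← h]
      linarith
    · have := mul_lt_mul_of_pos_left h2 (mul_pos h hGρ)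
      linarith
  -- the step size conditions
  have hηle := hA.η_le
  rw [stepBound] at hηle
  have hc : (0 : ℝ) ≤ 1 / 10000 := by norm_num
  have hs2 : p.η * L ≤ 1 / 10000 * (G * √(p.β₂ / d)) := by
    refine mul_le_of_le_mul_extDiv hc (by positivity) hL.le (hηle.trans ?_)
    gcongr
    exact (min_le_right _ _).trans (min_le_left _ _)
  have hs3 : p.η * L ≤ 1 / 10000 * p.lam := by
    refine mul_le_of_le_mul_extDiv hc hlam.le hL.le (hηle.trans ?_)
    gcongr
    exact (min_le_right _ _).trans ((min_le_right _ _).trans (min_le_left _ _))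
  have hs5 : p.η * (σ * G * L) ≤ 1 / 10000 * (p.lam ^ 2 * √δ * ε) := by
    refine mul_le_of_le_mul_extDiv hc (by positivity) (by positivity) (hηle.trans ?_)
    gcongr
    exact (min_le_right _ _).trans ((min_le_right _ _).trans ((min_le_right _ _).trans
      (min_le_right _ _)))
  -- In dimension 0 the bound through √(β₂/d) would read ηL ≤ 0, the quotient by zero being zero.
  have hd : 1 ≤ d := by
    rcases Nat.eq_zero_or_pos d with h | h
    · subst h
      simp only [Nat.cast_zero, div_zero, Real.sqrt_zero, mul_zero] at hs2
      exact absurd hs2 (not_le.2 (by positivity))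
    · exact h
  have hdR : (1 : ℝ) ≤ d := by exact_mod_cast hd
  set D := √(d / p.β₂) with hDdef
  have hD1 : 1 ≤ D := by
    rw [hDdef, Real.one_le_sqrt, le_div_iff₀ hβ₂]
    linarith [hA.β₂_le_one]
  have hDsq : D ^ 2 = d / p.β₂ := Real.sq_sqrt (by positivity)
  have hDdiv : √d / √p.β₂ = D := (Real.sqrt_div (by positivity) _).symm
  have hsqβ : 0 < √p.β₂ := Real.sqrt_pos.2 hβ₂
  have hs2' : 10000 * p.η * L * D ≤ G := by
    have h1 : √(p.β₂ / d) * D = 1 := by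
      rw [hDdef, ← Real.sqrt_mul (by positivity), div_mul_div_cancel₀ (by positivity),
        div_self hβ₂.ne', Real.sqrt_one]
    have h2 := mul_le_mul_of_nonneg_right hs2 (by linarith : 0 ≤ D)
    have h3 : 1 / 10000 * (G * √(p.β₂ / d)) * D = 1 / 10000 * G * (√(p.β₂ / d) * D) := by ring
    rw [h3, h1] at h2
    linarith
  have hσD : 2 * σ ≤ p.lam * D := by
    have h1 : 2 * σ ≤ p.lam / √p.β₂ := by
      rw [le_div_iff₀ hsqβ]; exact hA.sqrt_β₂_le
    refine h1.trans ?_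
    rw [← hDdiv, mul_div_assoc', div_le_div_iff_of_pos_right hsqβ]
    have : 1 ≤ √(d : ℝ) := Real.one_le_sqrt.2 hdR
    nlinarith
  have hβeq : p.β * p.lam ^ 3 = 1600 * L ^ 2 * G * p.η ^ 2 := by
    have h1 : (p.lam ^ (-(3 / 2) : ℝ)) ^ 2 * p.lam ^ 3 = 1 := by
      rw [← Real.rpow_natCast, ← Real.rpow_mul hlam.le, ← Real.rpow_natCast p.lam 3,
        ← Real.rpow_add hlam]
      norm_num
    rw [hA.β_eq, ← hLdef]
    have h2 : √G ^ 2 = G := Real.sq_sqrt hG.le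
    calc (40 * L * √G * p.lam ^ (-(3 / 2) : ℝ)) ^ 2 * p.η ^ 2 * p.lam ^ 3
        = 1600 * L ^ 2 * √G ^ 2 * p.η ^ 2 * ((p.lam ^ (-(3 / 2) : ℝ)) ^ 2 * p.lam ^ 3) := by ring
      _ = _ := by rw [h1, h2, mul_one]
  have htuned : IsTuned d L σ G D p := ⟨hL, hG, hlam, hη, hσ, hβ₂, hA.β₂_le_one, hD1, hDsq,
    hA.lam_le, hA.sigma_le, hσD, hA.sqrt_β₂_le, hβeq, hA.β_le_one, hs2', by linarith⟩
  have hP : IsTunedProblem U f F L₀ Lρ ρ L σ G D p := ⟨hO, hf, hF, heff, htuned⟩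
  have hβ := htuned.β_pos
  have hg₁ : ‖gradient f x₁‖ ≤ G := by
    have := hA.grad_le
    linarith [norm_nonneg (gradient f x₁)]
  -- the size of `G`
  have hΔG : 1000 * Δ * L * D ≤ 7 * G ^ 2 * δ := by
    have h1 : 1000 * Δ * L₀ * D ≤ G ^ 2 * δ := by
      have := (Real.sqrt_le_left hG.le).1 hA.L₀_le
      rw [div_le_iff₀ (by positivity)] at this
      rw [← hDdiv, mul_div_assoc', div_le_iff₀ hsqβ]
      linarith
    have h2 : 1000 * Δ * (Lρ * G ^ ρ) * D ≤ G ^ 2 * δ := by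
      have h3 : 1000 * Δ * Lρ * √d / (√p.β₂ * δ) ≤ G ^ (2 - ρ) := by
        have h4 := Real.rpow_le_rpow (by positivity) hA.Lρ_le (by linarith : 0 ≤ 2 - ρ)
        rwa [← Real.rpow_mul (by positivity), one_div_mul_cancel (by linarith), Real.rpow_one] at h4
      have h5 : G ^ (2 - ρ) * G ^ ρ = G ^ 2 := by
        rw [← Real.rpow_add hG, sub_add_cancel, Real.rpow_two]
      rw [div_le_iff₀ (by positivity)] at h3
      have h6 := mul_le_mul_of_nonneg_right h3 hGρ.le
      rw [← hDdiv, mul_div_assoc', div_le_iff₀ hsqβ]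
      calc 1000 * Δ * (Lρ * G ^ ρ) * √d = 1000 * Δ * Lρ * √d * G ^ ρ := by ring
        _ ≤ G ^ (2 - ρ) * (√p.β₂ * δ) * G ^ ρ := h6
        _ = (G ^ (2 - ρ) * G ^ ρ) * δ * √p.β₂ := by ring
        _ = G ^ 2 * δ * √p.β₂ := by rw [h5]
    calc 1000 * Δ * L * D = 3 * (1000 * Δ * L₀ * D) + 4 * (1000 * Δ * (Lρ * G ^ ρ) * D) := by
          rw [hLdef, effSmooth]; ring
      _ ≤ 7 * G ^ 2 * δ := by linarith
  -- the number of iterations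
  set X := 1000 * G * Δ / (p.η * δ * ε ^ 2) with hX
  have hX0 : 0 < X := by positivity
  have hTX : X ≤ p.T := by rw [hA.T_eq]; exact Nat.le_ceil _
  have hTX' : (p.T : ℝ) < X + 1 := by rw [hA.T_eq]; exact Nat.ceil_lt_add_one hX0.le
  have hT1 : 1 ≤ p.T := by
    have : (0 : ℝ) < p.T := hX0.trans_le hTX
    exact_mod_cast this
  have hXeq : X * (p.η * δ * ε ^ 2) = 1000 * G * Δ := div_mul_cancel₀ _ (by positivity)
  -- T is compared below with 2X, which may fail for T = 1. That case is deterministic: X ≤ 1 makes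
  -- 6LΔ ≤ ε², so x₁ itself is good enough.
  rcases hT1.eq_or_lt with hT | hT
  · -- a single iteration
    refine hprob.trans (measure_mono fun ω _ => ?_)
    have hit : vrAdamIterate p (stochGrad F) x₁ (fun i => ζ i ω) (fun s => ξ s ω) 1 = x₁ := rfl
    have h1 := hO.sq_norm_gradient_le hf heff hx₁ (by linarith)
    rw [← hΔdef] at h1
    have h2 : X ≤ 1 := by rw [← hT] at hTX; exact_mod_cast hTX
    have h3 : 1000 * G * Δ ≤ p.η * δ * ε ^ 2 := by
      rw [← hXeq]; exact mul_le_of_le_one_left (by positivity) h2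
    have h4 : 10000 * p.η * L ≤ G := by
      have := mul_le_mul_of_nonneg_left hD1 (by positivity : 0 ≤ 10000 * p.η * L)
      linarith
    have h5 : 6 * L * Δ ≤ ε ^ 2 := by
      have h6 : p.η * (10000000 * (L * Δ)) ≤ p.η * (δ * ε ^ 2) := by
        have := mul_le_mul_of_nonneg_right h4 hΔpos.le
        linarith
      have h7 := le_of_mul_le_mul_left h6 hη
      have h8 : δ * ε ^ 2 ≤ ε ^ 2 := mul_le_of_le_one_left (by positivity) hδ1.le
      have : 0 ≤ L * Δ := by positivity
      linarith
    refine ⟨fun t ht => ?_, ?_⟩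
    · obtain rfl : t = 1 := by have := Finset.mem_Icc.1 ht; omega
      rw [hit]; exact ⟨hx₁, hg₁⟩
    · rw [← hT, Finset.Icc_self, Finset.sum_singleton, hit]
      norm_num
      linarith
  · refine ofReal_le_measure_of_tuned hP hN hI hx₁ hg₁ hA.S₁_pos hδ hδ1 hΔpos hΔG ?_ hT1 ?_
    · calc 1000 * G * Δ = X * (p.η * δ * ε ^ 2) := hXeq.symm
        _ ≤ p.T * (p.η * δ * ε ^ 2) := by gcongr
        _ = p.T * ε ^ 2 * (p.η * δ) := by ring
    · have hT2 : (2 : ℝ) ≤ p.T := by exact_mod_cast hT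
      have hT0 : (0 : ℝ) < p.T := by linarith
      have hTle : (p.T : ℝ) ≤ 2 * X := by linarith
      have hS0 : (0 : ℝ) < p.S₁ := by exact_mod_cast hA.S₁_pos
      -- The lower bound on S₁ is what makes the initial error no more expensive than the noise of
      -- the T iterations.
      have hbatch : p.η / (p.lam * p.β) * (σ ^ 2 / p.S₁)
          ≤ p.T * (2 * p.η * p.β * σ ^ 2 / p.lam) := by
        have h1 : 1 / (p.S₁ : ℝ) ≤ 2 * p.β ^ 2 * p.T :=
          (one_div_le (by positivity) hS0).1 hA.S₁_ge
        calc p.η / (p.lam * p.β) * (σ ^ 2 / p.S₁)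
            = p.η / (p.lam * p.β) * (σ ^ 2 * (1 / p.S₁)) := by ring
          _ ≤ p.η / (p.lam * p.β) * (σ ^ 2 * (2 * p.β ^ 2 * p.T)) := by gcongr
          _ = _ := by field_simp
      -- After inserting β and T ≤ 2X, the total noise is Δ times the square of ησGL/(λ²√δ ε), up to
      -- a constant; the last bound on η makes this small.
      have hmain : 2 * (p.T * (2 * p.η * p.β * σ ^ 2 / p.lam)) ≤ Δ := by
        have hβ' : p.β = 1600 * L ^ 2 * G * p.η ^ 2 / p.lam ^ 3 := by
          rw [eq_div_iff (by positivity)]; exact hβeq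
        have hsq : (p.η * (σ * G * L)) ^ 2 ≤ 1 / 100000000 * (p.lam ^ 4 * δ * ε ^ 2) := by
          have := pow_le_pow_left₀ (by positivity) hs5 2
          have h2 : √δ ^ 2 = δ := Real.sq_sqrt hδ.le
          calc (p.η * (σ * G * L)) ^ 2 ≤ (1 / 10000 * (p.lam ^ 2 * √δ * ε)) ^ 2 := this
            _ = 1 / 100000000 * (p.lam ^ 4 * √δ ^ 2 * ε ^ 2) := by ring
            _ = _ := by rw [h2]
        calc 2 * (p.T * (2 * p.η * p.β * σ ^ 2 / p.lam))
            ≤ 2 * (2 * X * (2 * p.η * p.β * σ ^ 2 / p.lam)) := by gcongr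
          _ = 12800000 * Δ / (p.lam ^ 4 * δ * ε ^ 2) * (p.η * (σ * G * L)) ^ 2 := by
              rw [hβ', hX]; field_simp; ring
          _ ≤ 12800000 * Δ / (p.lam ^ 4 * δ * ε ^ 2)
              * (1 / 100000000 * (p.lam ^ 4 * δ * ε ^ 2)) := by gcongr
          _ = 128 / 1000 * Δ := by field_simp; norm_num
          _ ≤ Δ := by linarith
      linarith

end Convergence

/-! ### The gradient complexity -/

section Complexity

theorem ofReal_le_mul_extDiv {η c a b : ℝ} (hc : 0 < c) (ha : 0 < a) (hb : 0 ≤ b)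
    (h : η * b ≤ c * a) : ENNReal.ofReal η ≤ ENNReal.ofReal c * extDiv a b := by
  rcases hb.eq_or_lt with rfl | hb
  · rw [extDiv, ENNReal.ofReal_zero, ENNReal.div_zero (by simpa using ha),
      ENNReal.mul_top (by simpa using hc)]
    exact le_top
  · rw [extDiv, ← ENNReal.ofReal_div_of_pos hb, ← ENNReal.ofReal_mul hc.le]
    refine ENNReal.ofReal_le_ofReal ?_
    rw [mul_div_assoc', le_div_iff₀ hb]
    exact h

theorem extDiv_pos {a b : ℝ} (ha : 0 < a) : 0 < extDiv a b :=
  ENNReal.div_pos (by simpa using ha) ENNReal.ofReal_ne_top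

theorem localRadius_pos (L₀ Lρ ρ G : ℝ) : 0 < localRadius L₀ Lρ ρ G := by
  refine lt_min (extDiv_pos one_pos) ?_
  split_ifs
  · exact ENNReal.zero_lt_top
  · exact extDiv_pos one_pos

theorem ENNReal.exists_pos_ofReal_le {a : ℝ≥0∞} (ha : 0 < a) :
    ∃ e : ℝ, 0 < e ∧ ENNReal.ofReal e ≤ a := by
  obtain ⟨r, hr, hra⟩ := ENNReal.lt_iff_exists_nnreal_btwn.1 ha
  exact ⟨r, by exact_mod_cast hr, by rw [ENNReal.ofReal_coe_nnreal]; exact hra.le⟩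

theorem ENNReal.le_mul_min {a b x y : ℝ≥0∞} (hx : a ≤ b * x) (hy : a ≤ b * y) :
    a ≤ b * min x y := by
  rcases min_choice x y with h | h <;> rw [h] <;> assumption

/-- For a step size proportional to `ε`, all bounds on the step size are met when `ε` is small. -/
theorem exists_le_stepBound {c : ℝ} (hc : 0 < c) {d : ℕ} (hd : 1 ≤ d)
    {L₀ Lρ ρ σ Δ₁ δ G lam β₂ : ℝ} (hL : 0 ≤ effSmooth L₀ Lρ ρ G) (hσ : 0 ≤ σ) (hδ : 0 < δ)
    (hG : 0 < G) (hlam : 0 < lam) (hβ₂ : 0 < β₂) {e : ℝ} (he : 0 < e)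
    (heq : e * (σ * G * effSmooth L₀ Lρ ρ G) ≤ c * (lam ^ 2 * √δ)) :
    ∃ ε₀ : ℝ, 0 < ε₀ ∧ ∀ ε : ℝ, 0 < ε → ε ≤ ε₀ →
      ENNReal.ofReal (e * ε) ≤ ENNReal.ofReal c * stepBound d L₀ Lρ ρ σ Δ₁ δ ε G lam β₂ := by
  have hdR : (0 : ℝ) < d := by exact_mod_cast hd
  have hsq : 0 < √(β₂ / d) := Real.sqrt_pos.2 (by positivity)
  have hsδ : 0 < √δ := Real.sqrt_pos.2 hδ
  have hcE : ENNReal.ofReal c ≠ 0 := by simpa using hc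
  obtain ⟨e₁, he₁, h₁⟩ := ENNReal.exists_pos_ofReal_le (a := ENNReal.ofReal c
    * (localRadius L₀ Lρ ρ G * ENNReal.ofReal √(β₂ / d)))
    (ENNReal.mul_pos hcE (ENNReal.mul_pos (localRadius_pos _ _ _ _).ne' (by simpa using hsq)).ne')
  obtain ⟨e₂, he₂, h₂⟩ := ENNReal.exists_pos_ofReal_le (a := ENNReal.ofReal c
    * extDiv (G * √(β₂ / d)) (effSmooth L₀ Lρ ρ G))
    (ENNReal.mul_pos hcE (extDiv_pos (by positivity)).ne')
  obtain ⟨e₃, he₃, h₃⟩ := ENNReal.exists_pos_ofReal_le (a := ENNReal.ofReal c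
    * extDiv lam (effSmooth L₀ Lρ ρ G)) (ENNReal.mul_pos hcE (extDiv_pos hlam).ne')
  obtain ⟨e₄, he₄, h₄⟩ := ENNReal.exists_pos_ofReal_le (a := ENNReal.ofReal c
    * extDiv (lam ^ 4 * d * δ) (β₂ * Δ₁ * effSmooth L₀ Lρ ρ G ^ 2))
    (ENNReal.mul_pos hcE (extDiv_pos (by positivity)).ne')
  -- The first four bounds on the step size are positive and do not involve ε, so they hold for
  -- small ε. The fifth is proportional to ε, as is the step size, and holds by the choice of e.
  refine ⟨min (min e₁ e₂) (min e₃ e₄) / e, by positivity, fun ε hε hεle => ?_⟩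
  have hle : e * ε ≤ min (min e₁ e₂) (min e₃ e₄) := by
    rw [le_div_iff₀ he] at hεle; linarith
  have hm1 := ENNReal.ofReal_le_ofReal (hle.trans ((min_le_left _ _).trans (min_le_left _ _)))
  have hm2 := ENNReal.ofReal_le_ofReal (hle.trans ((min_le_left _ _).trans (min_le_right _ _)))
  have hm3 := ENNReal.ofReal_le_ofReal (hle.trans ((min_le_right _ _).trans (min_le_left _ _)))
  have hm4 := ENNReal.ofReal_le_ofReal (hle.trans ((min_le_right _ _).trans (min_le_right _ _)))
  refine ENNReal.le_mul_min (hm1.trans h₁) (ENNReal.le_mul_min (hm2.trans h₂)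
    (ENNReal.le_mul_min (hm3.trans h₃) (ENNReal.le_mul_min (hm4.trans h₄)
      (ofReal_le_mul_extDiv hc (by positivity) (by positivity) ?_))))
  have := mul_le_mul_of_nonneg_right heq hε.le
  linarith

set_option maxHeartbeats 1000000 in
/-- For fixed problem constants there are admissible inputs of the claimed complexity. -/
theorem exists_isAdmissible_gradientEvals_le {c C : ℝ} (hc : 0 < c) (hC : 0 < C)
    {L₀ Lρ ρ σ Δ₁ g₁ δ lam β₂ : ℝ} (hL₀ : 0 ≤ L₀) (hLρ : 0 ≤ Lρ) (hρ : 0 ≤ ρ) (hρ2 : ρ < 2)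
    (hσ : 0 ≤ σ) (hΔ : 0 ≤ Δ₁) (hg₁ : 0 ≤ g₁) (hδ : 0 < δ) (hlam : 0 < lam)
    (hβ₂ : 0 < β₂) (hβ₂1 : β₂ ≤ 1) (hσβ : 2 * σ * √β₂ ≤ lam) :
    ∃ K : ℝ, ∀ d : ℕ, 1 ≤ d → ∃ ε₀ : ℝ, 0 < ε₀ ∧ ∀ ε : ℝ, 0 < ε → ε ≤ ε₀ →
      ∃ (G : ℝ) (p : VRAdamInput), p.lam = lam ∧ p.β₂ = β₂ ∧
        IsAdmissible c C d L₀ Lρ ρ σ Δ₁ g₁ δ ε G p ∧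
        (p.gradientEvals : ℝ) ≤ K * (d : ℝ) ^ ((2 + ρ) / (2 * (2 - ρ))) * ε ^ (-3 : ℤ) := by
  have hsβ : 0 < √β₂ := Real.sqrt_pos.2 hβ₂
  have hsδ : 0 < √δ := Real.sqrt_pos.2 hδ
  have h2ρ : 0 < 2 - ρ := by linarith
  set a := C * Δ₁ / (√β₂ * δ) with ha
  have ha0 : 0 ≤ a := by positivity
  -- The dimension exponent of G: the condition with Lρ requires (√d)^(1/(2-ρ)) = d^κ, while the one
  -- with L₀ requires only d^(1/4), and κ ≥ 1/4.
  set κ := 1 / (2 * (2 - ρ)) with hκ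
  have hκ0 : 0 < κ := by positivity
  set G₀ := 2 * lam + 2 * σ + 2 * g₁ + √(a * L₀) + (a * Lρ) ^ (1 / (2 - ρ)) with hG₀
  have hr1 : 0 ≤ √(a * L₀) := Real.sqrt_nonneg _
  have hr2 : 0 ≤ (a * Lρ) ^ (1 / (2 - ρ)) := by positivity
  have hG₀pos : 0 < G₀ := by positivity
  have hG₀lam : 2 * lam ≤ G₀ := by linarith
  have hG₀σ : 2 * σ ≤ G₀ := by linarith
  have hG₀g : 2 * g₁ ≤ G₀ := by linarith
  have hG₀r : √(a * L₀) ≤ G₀ := by linarith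
  have hG₀s : (a * Lρ) ^ (1 / (2 - ρ)) ≤ G₀ := by linarith
  clear_value G₀
  set Lb := 3 * L₀ + 4 * Lρ * G₀ ^ ρ with hLb
  have hLb0 : 0 ≤ Lb := by positivity
  set K₀ := C * Δ₁ * (σ + 1) * G₀ ^ 2 * (Lb + 1) / (c * lam ^ 2 * √δ * δ) with hK₀
  have hK₀0 : 0 ≤ K₀ := by positivity
  refine ⟨3 + 2 * K₀, fun d hd => ?_⟩
  have hdR : (1 : ℝ) ≤ d := by exact_mod_cast hd
  have hd0 : (0 : ℝ) < d := by linarith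
  set G := G₀ * (d : ℝ) ^ κ with hG
  have hdκ : 1 ≤ (d : ℝ) ^ κ := Real.one_le_rpow hdR hκ0.le
  have hGpos : 0 < G := by positivity
  have hGG₀ : G₀ ≤ G := le_mul_of_one_le_right hG₀pos.le hdκ
  set L := effSmooth L₀ Lρ ρ G with hL
  have hL0 : 0 ≤ L := by rw [hL, effSmooth]; positivity
  have hdρκ : 1 ≤ (d : ℝ) ^ (κ * ρ) := Real.one_le_rpow hdR (by positivity)
  have hLle : L + 1 ≤ (Lb + 1) * (d : ℝ) ^ (κ * ρ) := by
    have h1 : G ^ ρ = G₀ ^ ρ * (d : ℝ) ^ (κ * ρ) := by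
      rw [hG, Real.mul_rpow hG₀pos.le (by positivity), ← Real.rpow_mul hd0.le]
    rw [hL, effSmooth, h1]
    have h2 : 3 * L₀ + 1 ≤ (3 * L₀ + 1) * (d : ℝ) ^ (κ * ρ) :=
      le_mul_of_one_le_right (by positivity) hdρκ
    rw [hLb]
    linarith
  -- The factor of ε in the step size. The summands 1 keep the denominator positive when σ or L
  -- vanishes.
  set e := c * lam ^ 2 * √δ / ((σ + 1) * G * (L + 1)) with he
  have hepos : 0 < e := by positivity
  have heq : e * (σ * G * L) ≤ c * (lam ^ 2 * √δ) := by
    rw [he, div_mul_eq_mul_div, div_le_iff₀ (by positivity)]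
    have : σ * G * L ≤ (σ + 1) * G * (L + 1) := by gcongr <;> linarith
    calc c * lam ^ 2 * √δ * (σ * G * L) ≤ c * lam ^ 2 * √δ * ((σ + 1) * G * (L + 1)) := by gcongr
      _ = _ := by ring
  obtain ⟨ε₁, hε₁, hstep⟩ := exists_le_stepBound (Δ₁ := Δ₁) hc hd hL0 hσ hδ hGpos hlam hβ₂ hepos heq
  set θ := 40 * L * √G * lam ^ (-(3 / 2) : ℝ) with hθ
  have hθ0 : 0 ≤ θ := by positivity
  set X₀ := C * G * Δ₁ / (e * δ) with hX₀
  have hX₀0 : 0 ≤ X₀ := by positivity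
  set M := 1 / (2 * ((θ * e) ^ 2) ^ 2 * X₀) with hM
  have hM0 : 0 ≤ M := by positivity
  -- The threshold ensures the bounds on η, ε ≤ 1, β = (θeε)² ≤ 1, and Mε ≤ 1, which makes the batch
  -- size O(ε⁻³).
  refine ⟨min (min ε₁ 1) (min (1 / (θ * e + 1)) (1 / (M + 1))), by positivity, fun ε hε hεle => ?_⟩
  have hε1 : ε ≤ ε₁ := hεle.trans ((min_le_left _ _).trans (min_le_left _ _))
  have hε2 : ε ≤ 1 := hεle.trans ((min_le_left _ _).trans (min_le_right _ _))
  have hε3 : θ * e * ε ≤ 1 := by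
    have := hεle.trans ((min_le_right _ _).trans (min_le_left _ _))
    rw [le_div_iff₀ (by positivity)] at this
    linarith
  have hε4 : M * ε ≤ 1 := by
    have := hεle.trans ((min_le_right _ _).trans (min_le_right _ _))
    rw [le_div_iff₀ (by positivity)] at this
    linarith
  set β := θ ^ 2 * (e * ε) ^ 2 with hβ
  set X := C * G * Δ₁ / (e * ε * δ * ε ^ 2) with hX
  set T := ⌈X⌉₊ with hT
  have hX0 : 0 ≤ X := by positivity
  have hXX₀ : X = X₀ / ε ^ 3 := by
    rw [hX, hX₀]; field_simp
  set S := ⌈1 / (2 * β ^ 2 * T)⌉₊ + 1 with hS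
  have hε3inv : 1 ≤ 1 / ε ^ 3 := by
    rw [le_div_iff₀ (by positivity), one_mul]
    exact pow_le_one₀ hε.le hε2
  refine ⟨G, ⟨β, β₂, e * ε, lam, T, S⟩, rfl, rfl, ?_, ?_⟩
  · exact
    { lam_pos := hlam
      G_pos := hGpos
      lam_le := hG₀lam.trans hGG₀
      sigma_le := hG₀σ.trans hGG₀
      grad_le := hG₀g.trans hGG₀
      L₀_le := by
        have e1 : C * Δ₁ * L₀ * √d / (√β₂ * δ) = a * L₀ * √d := by rw [ha]; field_simp
        have e2 : √√(d : ℝ) ≤ (d : ℝ) ^ κ := by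
          rw [Real.sqrt_eq_rpow, Real.sqrt_eq_rpow, ← Real.rpow_mul hd0.le]
          refine Real.rpow_le_rpow_of_exponent_le hdR ?_
          rw [hκ, le_div_iff₀ (by positivity)]
          linarith
        simp only
        rw [e1, Real.sqrt_mul (by positivity), hG]
        gcongr
      Lρ_le := by
        have e1 : C * Δ₁ * Lρ * √d / (√β₂ * δ) = a * Lρ * √d := by rw [ha]; field_simp
        have e2 : √(d : ℝ) ^ (1 / (2 - ρ)) = (d : ℝ) ^ κ := by
          rw [Real.sqrt_eq_rpow, ← Real.rpow_mul hd0.le]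
          congr 1
          rw [hκ]; field_simp
        simp only
        rw [e1, Real.mul_rpow (by positivity) (by positivity), e2, hG]
        gcongr
      β₂_pos := hβ₂
      β₂_le_one := hβ₂1
      sqrt_β₂_le := hσβ
      β_eq := rfl
      β_le_one := by
        simp only
        rw [hβ, ← mul_pow]
        refine pow_le_one₀ (by positivity) ?_
        linarith
      η_pos := by positivity
      η_le := hstep ε hε hε1
      T_eq := rfl
      S₁_pos := by simp [hS]
      S₁_ge := by
        simp only
        have := Nat.le_ceil (1 / (2 * β ^ 2 * (T : ℝ)))
        rw [hS]
        push_cast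
        linarith }
  · have hSle : (S : ℝ) ≤ 3 * (1 / ε ^ 3) := by
      -- β is of order ε² and T of order ε⁻³, so the required batch is of order 1/ε. If the leading
      -- constant vanishes, then βT = 0 and the quotient is 0 by convention.
      have h1 : 1 / (2 * β ^ 2 * (T : ℝ)) ≤ M / ε := by
        rcases eq_or_ne (2 * ((θ * e) ^ 2) ^ 2 * X₀) 0 with h0 | h0
        · have h2 : 2 * β ^ 2 * (T : ℝ) = 0 := by
            rcases mul_eq_zero.1 h0 with h | h
            · have h3 : θ * e = 0 := by
                by_contra hne
                exact absurd h (by positivity)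
              have h4 : β = 0 := by
                rw [hβ]
                rcases mul_eq_zero.1 h3 with h | h
                · rw [h]; simp
                · exact absurd h hepos.ne'
              rw [h4]; simp
            · have h3 : T = 0 := by rw [hT, hXX₀, h]; simp
              rw [h3]; simp
          rw [h2, div_zero]
          positivity
        · have hpos : 0 < 2 * ((θ * e) ^ 2) ^ 2 * X₀ := lt_of_le_of_ne (by positivity) h0.symm
          have h2 : 2 * ((θ * e) ^ 2) ^ 2 * X₀ * ε ≤ 2 * β ^ 2 * (T : ℝ) := by
            calc 2 * ((θ * e) ^ 2) ^ 2 * X₀ * ε = 2 * β ^ 2 * X := by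
                  rw [hβ, hXX₀]; field_simp
              _ ≤ 2 * β ^ 2 * (T : ℝ) := by
                  gcongr
                  exact Nat.le_ceil _
          calc 1 / (2 * β ^ 2 * (T : ℝ)) ≤ 1 / (2 * ((θ * e) ^ 2) ^ 2 * X₀ * ε) :=
                one_div_le_one_div_of_le (by positivity) h2
            _ = M / ε := by rw [hM, div_div]
      have h2 : M / ε ≤ 1 / ε ^ 3 := by
        rw [div_le_div_iff₀ hε (by positivity)]
        have : M * ε * ε ^ 2 ≤ 1 * ε := by
          refine mul_le_mul hε4 ?_ (by positivity) zero_le_one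
          nlinarith
        linarith
      have h3 := (Nat.ceil_lt_add_one (by positivity : 0 ≤ 1 / (2 * β ^ 2 * (T : ℝ)))).le
      rw [hS]
      push_cast
      linarith
    have hTle : ((T - 1 : ℕ) : ℝ) ≤ X := by
      rcases Nat.eq_zero_or_pos T with h | h
      · rw [h]; simpa using hX0
      · rw [Nat.cast_sub h]
        have := Nat.ceil_lt_add_one hX0
        push_cast
        linarith
    -- X₀ is proportional to G²(L + 1), so its dimension exponent is at most 2κ + κρ = (2 + ρ)/(2(2
    -- - ρ)).
    have hX₀le : X₀ ≤ K₀ * (d : ℝ) ^ ((2 + ρ) / (2 * (2 - ρ))) := by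
      have h1 : X₀ = C * Δ₁ * (σ + 1) / (c * lam ^ 2 * √δ * δ) * (G ^ 2 * (L + 1)) := by
        rw [hX₀, he]; field_simp
      have h2 : G ^ 2 * (L + 1) ≤ G₀ ^ 2 * (Lb + 1) * (d : ℝ) ^ ((2 + ρ) / (2 * (2 - ρ))) := by
        have h3 : (d : ℝ) ^ ((2 + ρ) / (2 * (2 - ρ))) = ((d : ℝ) ^ κ) ^ 2 * (d : ℝ) ^ (κ * ρ) := by
          rw [← Real.rpow_natCast, ← Real.rpow_mul hd0.le, ← Real.rpow_add hd0]
          congr 1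
          rw [hκ]; push_cast; field_simp
        calc G ^ 2 * (L + 1) ≤ G ^ 2 * ((Lb + 1) * (d : ℝ) ^ (κ * ρ)) := by gcongr
          _ = _ := by rw [h3, hG]; ring
      rw [h1]
      calc C * Δ₁ * (σ + 1) / (c * lam ^ 2 * √δ * δ) * (G ^ 2 * (L + 1))
          ≤ C * Δ₁ * (σ + 1) / (c * lam ^ 2 * √δ * δ)
            * (G₀ ^ 2 * (Lb + 1) * (d : ℝ) ^ ((2 + ρ) / (2 * (2 - ρ)))) := by gcongr
        _ = _ := by rw [hK₀]; ring
    have hpow : ε ^ (-3 : ℤ) = 1 / ε ^ 3 := by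
      rw [zpow_neg, one_div]; norm_cast
    have hd1 : 1 ≤ (d : ℝ) ^ ((2 + ρ) / (2 * (2 - ρ))) :=
      Real.one_le_rpow hdR (by positivity)
    have hgoal : ((VRAdamInput.gradientEvals ⟨β, β₂, e * ε, lam, T, S⟩ : ℕ) : ℝ)
        = S + 2 * ((T - 1 : ℕ) : ℝ) := by
      simp only [VRAdamInput.gradientEvals]
      push_cast
      ring
    rw [hgoal, hpow]
    set Y := (d : ℝ) ^ ((2 + ρ) / (2 * (2 - ρ)))
    have hε3pos : 0 < 1 / ε ^ 3 := by positivity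
    calc (S : ℝ) + 2 * ((T - 1 : ℕ) : ℝ) ≤ 3 * (1 / ε ^ 3) + 2 * X := by linarith
      _ = 3 * (1 / ε ^ 3) + 2 * (X₀ * (1 / ε ^ 3)) := by rw [hXX₀]; ring
      _ ≤ 3 * (Y * (1 / ε ^ 3)) + 2 * (K₀ * Y * (1 / ε ^ 3)) := by
          gcongr
          exact le_mul_of_one_le_left hε3pos.le hd1
      _ = (3 + 2 * K₀) * Y * (1 / ε ^ 3) := by ring

end Complexity

/-! ### The main theorem -/

theorem mainTheorem3 :
    ∃ c C : ℝ, 0 < c ∧ 0 < C ∧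
      -- the convergence guarantee
      (∀ (d : ℕ) (L₀ Lρ ρ σ δ ε G : ℝ) (p : VRAdamInput)
        (U : Set (EuclideanSpace ℝ (Fin d))) (f : EuclideanSpace ℝ (Fin d) → ℝ)
        (x₁ : EuclideanSpace ℝ (Fin d))
        (Ξ : Type*) [MeasurableSpace Ξ] (P : Measure Ξ) [IsProbabilityMeasure P]
        (F : EuclideanSpace ℝ (Fin d) → Ξ → ℝ)
        (Ω : Type*) [MeasurableSpace Ω] (μ : Measure Ω) [IsProbabilityMeasure μ]
        (ζ : Fin p.S₁ → Ω → Ξ) (ξ : ℕ → Ω → Ξ),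
        0 ≤ L₀ → 0 ≤ Lρ → 0 ≤ ρ → ρ < 2 → 0 ≤ σ → 0 < δ → δ < 1 → 0 < ε →
        IsObjective U f → x₁ ∈ U →
        IsGenSmoothOn U f L₀ Lρ ρ →
        (∀ s : Ξ, IsGenSmoothOn U (fun x => F x s) L₀ Lρ ρ) →
        IsBoundedNoise U f F P σ →
        IsIIDSampling μ P p.S₁ p.T ζ ξ →
        IsAdmissible c C d L₀ Lρ ρ σ (f x₁ - sInf (f '' U)) ‖gradient f x₁‖ δ ε G p →
        let x : ℕ → Ω → EuclideanSpace ℝ (Fin d) := fun t ω =>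
          vrAdamIterate p (stochGrad F) x₁ (fun i => ζ i ω) (fun s => ξ s ω) t
        ENNReal.ofReal (1 - δ) ≤
          μ {ω | (∀ t ∈ Finset.Icc 1 p.T, x t ω ∈ U ∧ ‖gradient f (x t ω)‖ ≤ G) ∧
            1 / (p.T : ℝ) * ∑ t ∈ Finset.Icc 1 p.T, ‖gradient f (x t ω)‖ ^ 2 ≤ ε ^ 2}) ∧
      -- the gradient complexity
      (∀ L₀ Lρ ρ σ Δ₁ g₁ δ lam β₂ : ℝ,
        0 ≤ L₀ → 0 ≤ Lρ → 0 ≤ ρ → ρ < 2 → 0 ≤ σ → 0 ≤ Δ₁ → 0 ≤ g₁ → 0 < δ → δ < 1 →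
        0 < lam → 0 < β₂ → β₂ ≤ 1 → 2 * σ * √β₂ ≤ lam →
        ∃ K : ℝ, ∀ d : ℕ, 1 ≤ d → ∃ ε₀ : ℝ, 0 < ε₀ ∧ ∀ ε : ℝ, 0 < ε → ε ≤ ε₀ →
          ∃ (G : ℝ) (p : VRAdamInput), p.lam = lam ∧ p.β₂ = β₂ ∧
            IsAdmissible c C d L₀ Lρ ρ σ Δ₁ g₁ δ ε G p ∧
            (p.gradientEvals : ℝ) ≤
              K * (d : ℝ) ^ ((2 + ρ) / (2 * (2 - ρ))) * ε ^ (-3 : ℤ)) := by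
  refine ⟨1 / 10000, 1000, by norm_num, by norm_num, ?_, ?_⟩
  · intro d L₀ Lρ ρ σ δ ε G p U f x₁ Ξ _ P _ F Ω _ μ _ ζ ξ hL₀ hLρ hρ hρ2 hσ hδ hδ1 hε hO hx₁ hf hF
      hN hI hA
    exact ofReal_le_measure_of_isAdmissible hL₀ hLρ hρ hρ2 hσ hδ hδ1 hε hO hx₁ hf hF hN hI hA
  · intro L₀ Lρ ρ σ Δ₁ g₁ δ lam β₂ hL₀ hLρ hρ hρ2 hσ hΔ hg₁ hδ _ hlam hβ₂ hβ₂1 hσβ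
    exact exists_isAdmissible_gradientEvals_le (by norm_num) (by norm_num) hL₀ hLρ hρ hρ2 hσ hΔ hg₁ hδ
      hlam hβ₂ hβ₂1 hσβ
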